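/- Let $\tfrac23<\gamma<2$ and consider, with $\Omega=1-X^2-S^2$, the system $$\begin{aligned}X'&=TS(1+X)+(1-T)(1-X)\left(1-X^2-\tfrac32(\gamma-\tfrac23)\Omega\right),\\ S'&=-(1+X-S^2)T-S(1-T)\left[(1-X)X-\tfrac32(\gamma-\tfrac23)\Omega\right],\\ T'&=T(1-T)\left[ST+(1-T)\left((1-X)^2+\tfrac32(\gamma-\tfrac23)\Omega\right)\right]\end{aligned}$$ on the Jordan state space $\mathbf S=\{\Omega>0,\ 0<T<1\}$ and its extension $\bar{\mathbf S}=\{\Omega\ge0,\ 0\le T\le1\}$. Let $N_1=(-1,0,1)$, and let $L_{dS}$ be the line of fixed points $\left(X_0,-\sqrt{1-X_0^2},\tfrac{(1-X_0)^2}{(1-X_0)^2+\sqrt{1-X_0^2}}\right)$, $-1<X_0<1$. The coordinates $(\bar X,\bar S,\bar T)=(1+X,S,\tfrac{1-T}{T})$ map $\bar{\mathbf S}\cap\{T>0\}$ bijectively onto $\{\bar X(2-\bar X)-\bar S^2\ge0,\ \bar T\ge0\}$ and put $N_1$ at the origin; with the time $\bar N$ given by $d/d\bar N=T^{-1}d/d\bar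 t$ the system becomes, with $c=1-\tfrac32\gamma$ and $W=\bar X(2-\bar X)-\bar S^2$, $$\begin{aligned}\tfrac{d\bar X}{d\bar N}&=\bar X\bar S+\bar T(2-\bar X)\left[\bar X(2-\bar X)+cW\right],\\ \tfrac{d\bar S}{d\bar N}&=-(\bar X-\bar S^2)-\bar S\bar T\left[-(1-\bar X)(2-\bar X)+cW\right],\\ \tfrac{d\bar T}{d\bar N}&=-\bar T\left\{\bar S+\bar T\left[(2-\bar X)^2-cW\right]\right\}.\end{aligned}$$ Blow up $N_1$ by $\Psi(x,y,z,u)=(u^2x,uy,uz)$, $(x,y,z)\in\mathbb S^2$, $u\ge0$. The physical part of the blow-up space is $\mathcal P=\{x(2-u^2x)-y^2\ge0,\ z\ge0\}$. Then: 1. (Desingularisation.) $\Psi^{-1}(0)=\{u=0\}$, and $\Psi$ maps $\mathcal P\cap\{u>0\}$ bijectively onto the above region without the origin. There is an explicit vector field $V$ on $\mathbb S^2\times[0,\infty)$, regular up to and tangent to the sphere $\{u=0\}$, such that the system in the time $\bar N$ is $u\,D\Psi(V)$, i.e. $d/d\tau=u^{-1}d/d\bar N$. 2. (Fixed points.) The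 fixed points of $V$ in $\mathcal P$ are those of the lift of $L_{dS}$ to $\{u>0\}$, whose closure meets $\{u=0\}$ exactly in $dS_1$, and the four points of $\mathcal P\cap\{u=0\}$ $$R_1=(0,0,1),\quad dS_1=(8v^2,-4v,v),\quad W_\pm=\left(\sqrt2-1,\ \pm\sqrt{2(\sqrt2-1)},\ 0\right),\qquad v^2=\tfrac{\sqrt{545}-17}{128}.$$ In the chart $(x_3,y_3,u_3)=(x/z^2,y/z,uz)$ with time $d\tau_3=z\,d\tau$, the linearisation at $R_1=(0,0,0)$ has eigenvalues $-2(3\gamma-8),6,-4$ with eigenvectors $(2(3\gamma-5),1,0),(0,1,0),(0,0,1)$, and that at $dS_1=(8,-4,0)$ has eigenvalues $-6,-6\gamma,0$ with eigenvectors $(-4,1,0),(2(3\gamma-5),1,0),(0,0,1)$. In the chart $(u_1,y_1,z_1)=(u\sqrt x,y/\sqrt x,z/\sqrt x)$ with time $d\tau_1=\sqrt x\,d\tau$, the linearisation at $W_\pm=(0,\pm\sqrt2,0)$ has eigenvalues $\pm\tfrac1{\sqrt2},\pm\sqrt2,\mp\tfrac3{\sqrt2}$ with eigenvectors $e_1,e_2,e_3$.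 (Eigenvalues are counted with algebraic multiplicity.) 3. (Flow on the sphere $u=0$.) Every orbit with $z>0$, $y^2<2x$ is a heteroclinic orbit $R_1\to dS_1$. On the edge $y^2=2x$, $z>0$ the orbits are $R_1\to W_+$ for $y>0$, $R_1\to dS_1$ for $-4z<y<0$, and $W_-\to dS_1$ for $y<-4z$. 4. (Flow off the sphere.) Every orbit in $\mathcal P\cap\{z=0\}$ (the equator and the boundary $T=1$) other than $W_\pm$ is a heteroclinic orbit $W_+\to W_-$. The half-line $x=y=0$, $z=1$, $u>0$ is forward invariant and all its orbits converge to $R_1$. There is a neighbourhood of $dS_1$ such that every orbit in $\mathcal P$ starting there stays in $\mathcal P$ and converges, as $\tau\to+\infty$, to $dS_1$ if $u=0$ and to a point of the lift of $L_{dS}$ if $u>0$. 5. (Orbits at $N_1$.) The forward orbit of a point of $\bar{\mathbf S}\setminus\{N_1\}$ has $\omega$-limit set $\{N_1\}$ if and only if the point lies on $\{T=1\}$ or on the vacuum orbit $\{X=-1,\ S=0,\ 0<T<1\}$. The backward orbit has $\alpha$-limit set $\{N_1\}$ if and only if the point lies on $\{T=1\}$. 6. No interior orbit, i.e. no orbit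 in $\mathbf S$, has $\{N_1\}$ as its $\omega$-limit set. -/

import Mathlib

open Set Filter Topology

namespace JordanBlowUp

noncomputable section

/-! ### Solutions and limit sets of autonomous vector fields -/

/-- `γ` solves `γ' = V(γ)` on the time set `I` (one-sided derivatives at end points). -/
def IsSolutionOn {n : ℕ} (V : (Fin n → ℝ) → (Fin n → ℝ)) (I : Set ℝ) (γ : ℝ → Fin n → ℝ) : Prop :=
  ∀ t ∈ I, HasDerivWithinAt γ (V (γ t)) I t

/-- The `ω`-limit set of a curve. -/
def omegaLimitSet {n : ℕ} (γ : ℝ → Fin n → ℝ) : Set (Fin n → ℝ) :=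
  {p | MapClusterPt p atTop γ}

/-- The `α`-limit set of a curve. -/
def alphaLimitSet {n : ℕ} (γ : ℝ → Fin n → ℝ) : Set (Fin n → ℝ) :=
  {p | MapClusterPt p atBot γ}

/-- The orbit of `V` through `q` is complete and runs from `a` (as time tends to `-∞`) to `b`
(as time tends to `+∞`). -/
def Connects {n : ℕ} (V : (Fin n → ℝ) → (Fin n → ℝ)) (a b q : Fin n → ℝ) : Prop :=
  ∃ γ : ℝ → Fin n → ℝ, IsSolutionOn V univ γ ∧ γ 0 = q ∧
    Tendsto γ atBot (𝓝 a) ∧ Tendsto γ atTop (𝓝 b)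

/-! ### The dynamical system in the Jordan frame, in the variables `(X, S, T)` -/

/-- `Ω = 1 - X² - S²`. -/
def omegaPf (p : Fin 3 → ℝ) : ℝ := 1 - p 0 ^ 2 - p 1 ^ 2

/-- The right-hand side of the system for `(X, S, T)`; `g` is the equation of state parameter. -/
def jordanField (g : ℝ) (p : Fin 3 → ℝ) : Fin 3 → ℝ :=
  let X := p 0
  let S := p 1
  let T := p 2
  ![T * S * (1 + X)
      + (1 - T) * (1 - X) * (1 - X ^ 2 - 3 / 2 * (g - 2 / 3) * (1 - X ^ 2 - S ^ 2)),
    -(1 + X - S ^ 2) * T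
      - S * (1 - T) * ((1 - X) * X - 3 / 2 * (g - 2 / 3) * (1 - X ^ 2 - S ^ 2)),
    T * (1 - T) * (S * T
      + (1 - T) * ((1 - X) ^ 2 + 3 / 2 * (g - 2 / 3) * (1 - X ^ 2 - S ^ 2)))]

/-- The interior of the Jordan state space: the open cylinder. -/
def jordanInterior : Set (Fin 3 → ℝ) := {p | 0 < omegaPf p ∧ 0 < p 2 ∧ p 2 < 1}

/-- The extended compact Jordan state space: the closed cylinder. -/
def jordanClosed : Set (Fin 3 → ℝ) := {p | 0 ≤ omegaPf p ∧ 0 ≤ p 2 ∧ p 2 ≤ 1}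

/-- The fixed point `N₁`. -/
def pointN1 : Fin 3 → ℝ := ![-1, 0, 1]

/-- The line of de Sitter fixed points. -/
def lineDS : Set (Fin 3 → ℝ) :=
  {p | ∃ X₀ : ℝ, -1 < X₀ ∧ X₀ < 1 ∧
    p = ![X₀, -√(1 - X₀ ^ 2), (1 - X₀) ^ 2 / ((1 - X₀) ^ 2 + √(1 - X₀ ^ 2))]}

/-! ### Local coordinates that put `N₁` at the origin -/

/-- `(X, S, T) ↦ (1 + X, S, (1 - T) / T)`. -/
def localCoord (p : Fin 3 → ℝ) : Fin 3 → ℝ := ![1 + p 0, p 1, (1 - p 2) / p 2]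

/-- The Jordan system in the local coordinates and in the time `N` with `d/dN = T⁻¹ d/dt`. -/
def localField (g : ℝ) (p : Fin 3 → ℝ) : Fin 3 → ℝ :=
  let x := p 0
  let s := p 1
  let t := p 2
  let c := 1 - 3 / 2 * g
  ![x * s + t * (2 - x) * (x * (2 - x) + c * (x * (2 - x) - s ^ 2)),
    -(x - s ^ 2) - s * t * (-(1 - x) * (2 - x) + c * (x * (2 - x) - s ^ 2)),
    -t * (s + t * ((2 - x) ^ 2 - c * (x * (2 - x) - s ^ 2)))]

/-- The extended state space without `{T = 0}`, in the local coordinates. -/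
def localRegion : Set (Fin 3 → ℝ) := {p | 0 ≤ p 0 * (2 - p 0) - p 1 ^ 2 ∧ 0 ≤ p 2}

/-! ### The blow-up of `N₁`

A point of the blow-up space `S² × [0, ∞)` is written `(x, y, z, u)`. -/

/-- The quasi-homogeneous blow-up map `(x, y, z, u) ↦ (u² x, u y, u z)`. -/
def blowUpMap (q : Fin 4 → ℝ) : Fin 3 → ℝ := ![q 3 ^ 2 * q 0, q 3 * q 1, q 3 * q 2]

/-- The local field at `(u² x, u y, u z)` with its components divided by `u³`, `u²`, `u²`;
polynomial in `(x, y, z, u)`, hence also defined at `u = 0`. -/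
def rescaledField (g : ℝ) (q : Fin 4 → ℝ) : Fin 3 → ℝ :=
  let x := q 0
  let y := q 1
  let z := q 2
  let u := q 3
  let c := 1 - 3 / 2 * g
  let w := x * (2 - u ^ 2 * x) - y ^ 2
  ![x * y + z * (2 - u ^ 2 * x) * (x * (2 - u ^ 2 * x) + c * w),
    -(x - y ^ 2) - y * z * (-(1 - u ^ 2 * x) * (2 - u ^ 2 * x) + c * u ^ 2 * w),
    -z * (y + z * ((2 - u ^ 2 * x) ^ 2 - c * u ^ 2 * w))]

/-- The logarithmic derivative of `u` along the desingularised field. -/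
def radialRate (g : ℝ) (q : Fin 4 → ℝ) : ℝ :=
  (q 0 * rescaledField g q 0 + q 1 * rescaledField g q 1 + q 2 * rescaledField g q 2)
    / (2 * q 0 ^ 2 + q 1 ^ 2 + q 2 ^ 2)

/-- The desingularised field on `S² × [0, ∞)`: the field, tangent to `S² × [0, ∞)`, whose image
under the blow-up map is `u⁻¹` times the local field. -/
def blowUpField (g : ℝ) (q : Fin 4 → ℝ) : Fin 4 → ℝ :=
  ![rescaledField g q 0 - 2 * radialRate g q * q 0,
    rescaledField g q 1 - radialRate g q * q 1,
    rescaledField g q 2 - radialRate g q * q 2,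
    radialRate g q * q 3]

/-- The blow-up space `S² × [0, ∞)`. -/
def blowUpSpace : Set (Fin 4 → ℝ) := {q | q 0 ^ 2 + q 1 ^ 2 + q 2 ^ 2 = 1 ∧ 0 ≤ q 3}

/-- The physical part of the blow-up space, `Ω ≥ 0` and `T ≤ 1` (here `Ω = u² (2x - u² x² - y²)`,
and the factor `u²` is removed). -/
def blowUpRegion : Set (Fin 4 → ℝ) :=
  {q ∈ blowUpSpace | 0 ≤ q 0 * (2 - q 3 ^ 2 * q 0) - q 1 ^ 2 ∧ 0 ≤ q 2}

/-- The physical part of the blow-up sphere `{u = 0}`. -/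
def sphereRegion : Set (Fin 4 → ℝ) := {q ∈ blowUpRegion | q 3 = 0}

/-- `R₁`, the north pole of the sphere. -/
def pointR1 : Fin 4 → ℝ := ![0, 0, 1, 0]

/-- The height of `dS₁`: the positive root `v` of `(8 v²)² + (4 v)² + v² = 1`. -/
def heightDS1 : ℝ := √((√545 - 17) / 128)

/-- `dS₁`. -/
def pointDS1 : Fin 4 → ℝ := ![8 * heightDS1 ^ 2, -4 * heightDS1, heightDS1, 0]

/-- `W₊`. -/
def pointWplus : Fin 4 → ℝ := ![√2 - 1, √(2 * (√2 - 1)), 0, 0]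

/-- `W₋`. -/
def pointWminus : Fin 4 → ℝ := ![√2 - 1, -√(2 * (√2 - 1)), 0, 0]

/-- The line of de Sitter fixed points, lifted to the blow-up space. -/
def liftedLineDS : Set (Fin 4 → ℝ) :=
  {q ∈ blowUpRegion | 0 < q 3 ∧ blowUpMap q ∈ localCoord '' lineDS}

/-! ### Directional charts of the blow-up space -/

/-- The chart of the positive `z`-direction, with coordinates `(x₃, y₃, u₃)`. -/
def chartZ (q : Fin 4 → ℝ) : Fin 3 → ℝ := ![q 0 / q 2 ^ 2, q 1 / q 2, q 3 * q 2]

/-- The desingularised field in the coordinates `(x₃, y₃, u₃)`. -/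
def fieldZ (g : ℝ) (p : Fin 3 → ℝ) : Fin 3 → ℝ :=
  let x := p 0
  let y := p 1
  let u := p 2
  let c := 1 - 3 / 2 * g
  let w := x * (2 - u ^ 2 * x) - y ^ 2
  ![3 * x * (y + (2 - u ^ 2 * x) ^ 2) + c * w * (2 - 3 * u ^ 2 * x),
    -x + 2 * y ^ 2 + y * ((2 - u ^ 2 * x) * (3 - 2 * u ^ 2 * x) - 2 * c * w * u ^ 2),
    -u * (y + (2 - u ^ 2 * x) ^ 2 - c * w * u ^ 2)]

/-- The chart of the positive `x`-direction, with coordinates `(u₁, y₁, z₁)`. -/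
def chartX (q : Fin 4 → ℝ) : Fin 3 → ℝ := ![q 3 * √(q 0), q 1 / √(q 0), q 2 / √(q 0)]

/-- The desingularised field in the coordinates `(u₁, y₁, z₁)`. -/
def fieldX (g : ℝ) (p : Fin 3 → ℝ) : Fin 3 → ℝ :=
  let u := p 0
  let y := p 1
  let z := p 2
  let c := 1 - 3 / 2 * g
  let w := 2 - u ^ 2 - y ^ 2
  ![u / 2 * (y + z * (2 - u ^ 2) * (2 - u ^ 2 + c * w)),
    1 / 2 * (-2 + y ^ 2 - y * z * (u ^ 2 * (2 - u ^ 2) + c * w * (2 + u ^ 2))),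
    -(1 / 2) * z * (3 * y + z * (3 * (2 - u ^ 2) ^ 2 + c * w * (2 - 3 * u ^ 2)))]

/-- The linearisation of `V` at `p` has the eigenvectors `v i` with eigenvalues `l i`, and
its eigenvalues with algebraic multiplicities are `l 0, l 1, l 2`. -/
def HasLinearisation (V : (Fin 3 → ℝ) → (Fin 3 → ℝ)) (p : Fin 3 → ℝ)
    (l : Fin 3 → ℝ) (v : Fin 3 → Fin 3 → ℝ) : Prop :=
  DifferentiableAt ℝ V p ∧
  (∀ i, v i ≠ 0 ∧ fderiv ℝ V p (v i) = l i • v i) ∧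
  LinearMap.charpoly ((fderiv ℝ V p : (Fin 3 → ℝ) →L[ℝ] (Fin 3 → ℝ)) :
      (Fin 3 → ℝ) →ₗ[ℝ] (Fin 3 → ℝ))
    = ∏ i, (Polynomial.X - Polynomial.C (l i))

end

end JordanBlowUp

/-! The statements about coordinates, about the relation between the fields and about the
linearisations are computations of differentials. The dynamical statements rest on three
mechanisms.

*Invariant faces.* Along the desingularised field the functions `u`, `z` and `omegaRed`, which is
`u⁻² Ω`, satisfy scalar linear equations (`blowUpRegion_invariant`), so their signs never change.
Multiplied by a cut-off function, the field has complete orbits (`exists_global_solution_cutoff`),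
and an orbit confined by these faces to a compact set is therefore complete (`exists_orbit`). In
the same way `Ω`, `T` and `1 - T` keep their signs along the Jordan system.

*Monotone functions.* On the sphere, and on `z = 0`, each orbit converges because its limit points
lie in the zero set of the derivative of a bounded monotone function
(`eq_zero_of_mapClusterPt_atTop`), while the monotonicity itself tells which of the fixed points
in that zero set is reached. On `z = 0` the function is `y / √x`; on the vacuum edge `y² = 2x` it
is `η = y / z`, whose derivative is a positive multiple of `η (η + 4)`. In the interior of the
sphere an orbit cannot stay in `y ≥ 0` (`IsInteriorOrbit.exists_y_neg`) because `x / z²` would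
increase there, and then `y / √x` would decrease to the upper end of its range. Once `y` is
negative, `y / √x` decreases, so all limit points lie on the vacuum edge, and `η` is eventually
monotone up to a multiple of `Ω`; this leaves only `dS₁` (`IsInteriorOrbit.tendsto_pointDS1`).
Towards the past the same functions give `x → 0`, that is, `R₁`.

*Attraction to the de Sitter line.* The line is the common zero set of `deSitterRed` and
`omegaRed`, the field is a combination of these two functions with smooth coefficients
(`blowUpField_eq_add`), and near `dS₁` the weighted sum `deSitterEnergy` of their squares decays
exponentially. Hence orbits that start close to `dS₁` have finite length and converge
(`converges_of_lyapunov`); the rate of `u` is integrable as well, so the limit of an orbit with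
`u > 0` lies off the sphere.

*Orbits at `N₁`.* In the local coordinates `(x, s, t)` an orbit with `x, t > 0` close to the
origin satisfies `t' = -D t` with `D = decayRate`, and `D' = A D + B Ω` with `B < 0`. The region
`D ≤ 0` is therefore forward invariant. If `t` is to tend to zero, the sign of `D` is determined:
`D > 0` towards the future, `D ≤ 0` towards the past. In the latter case, and also towards the
future if `s` stays positive, the ratio `t / x` is bounded, so that `(s / x)'` tends to `-1`,
against the sign of `s`; towards the future with `s ≤ 0`, the inequality `D > 0` makes `s`
decrease, so `s` cannot tend to zero. This leaves the vacuum line `x = 0` and the boundary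
`t = 0`, where the equations can be integrated. -/

namespace JordanBlowUp

/-! ### Scalar differential inequalities on an interval -/

lemma antitoneOn_of_deriv_nonpos' {I : Set ℝ} (hI : Convex ℝ I) {f f' : ℝ → ℝ}
    (hf : ∀ t ∈ I, HasDerivWithinAt f (f' t) I t) (h : ∀ t ∈ I, f' t ≤ 0) : AntitoneOn f I :=
  antitoneOn_of_hasDerivWithinAt_nonpos hI (fun t ht => (hf t ht).continuousWithinAt)
    (fun t ht => (hf t (interior_subset ht)).mono interior_subset)
    fun t ht => h t (interior_subset ht)

lemma monotoneOn_of_deriv_nonneg' {I : Set ℝ} (hI : Convex ℝ I) {f f' : ℝ → ℝ}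
    (hf : ∀ t ∈ I, HasDerivWithinAt f (f' t) I t) (h : ∀ t ∈ I, 0 ≤ f' t) : MonotoneOn f I :=
  monotoneOn_of_hasDerivWithinAt_nonneg hI (fun t ht => (hf t ht).continuousWithinAt)
    (fun t ht => (hf t (interior_subset ht)).mono interior_subset)
    fun t ht => h t (interior_subset ht)

lemma strictAntiOn_of_deriv_neg' {I : Set ℝ} (hI : Convex ℝ I) {f f' : ℝ → ℝ}
    (hf : ∀ t ∈ I, HasDerivWithinAt f (f' t) I t) (h : ∀ t ∈ I, f' t < 0) : StrictAntiOn f I :=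
  strictAntiOn_of_hasDerivWithinAt_neg hI (fun t ht => (hf t ht).continuousWithinAt)
    (fun t ht => (hf t (interior_subset ht)).mono interior_subset)
    fun t ht => h t (interior_subset ht)

lemma eq_of_deriv_eq_zero {I : Set ℝ} (hI : Convex ℝ I) {f : ℝ → ℝ}
    (hf : ∀ t ∈ I, HasDerivWithinAt f 0 I t) {s t : ℝ} (hs : s ∈ I) (ht : t ∈ I) : f s = f t := by
  have h1 := monotoneOn_of_deriv_nonneg' hI hf fun _ _ => le_rfl
  have h2 := antitoneOn_of_deriv_nonpos' hI hf fun _ _ => le_rfl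
  rcases le_total s t with h | h
  · exact le_antisymm (h1 hs ht h) (h2 hs ht h)
  · exact le_antisymm (h2 ht hs h) (h1 ht hs h)

lemma HasDerivWithinAt.to_Ici {I : Set ℝ} (hI : I.OrdConnected) {f : ℝ → ℝ} {f' a b x : ℝ}
    (ha : a ∈ I) (hb : b ∈ I) (hx : x ∈ Ico a b) (hf : HasDerivWithinAt f f' I x) :
    HasDerivWithinAt f f' (Ici x) x :=
  (hf.mono ((Icc_subset_Icc_left hx.1).trans (hI.out ha hb))).mono_of_mem_nhdsWithin
    (Icc_mem_nhdsGE hx.2)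

/-- A function that decreases wherever it vanishes cannot become positive. -/
lemma nonpos_of_deriv_neg_of_eq_zero {I : Set ℝ} (hI : I.OrdConnected) {f f' : ℝ → ℝ}
    (hf : ∀ t ∈ I, HasDerivWithinAt f (f' t) I t) (h : ∀ t ∈ I, f t = 0 → f' t < 0)
    {a b : ℝ} (ha : a ∈ I) (hb : b ∈ I) (hab : a ≤ b) (h0 : f a ≤ 0) : f b ≤ 0 := by
  have hsub : Icc a b ⊆ I := hI.out ha hb
  refine image_le_of_deriv_right_lt_deriv_boundary (f := f) (f' := f') (a := a) (b := b)
    (B := fun _ => 0) (B' := fun _ => 0)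
    (fun x hx => ((hf x (hsub hx)).mono hsub).continuousWithinAt)
    (fun x hx => HasDerivWithinAt.to_Ici hI ha hb hx (hf x (hsub (Ico_subset_Icc_self hx))))
    h0 (fun x => hasDerivAt_const x 0) (fun x hx hx0 => h x (hsub (Ico_subset_Icc_self hx)) hx0)
    (right_mem_Icc.2 hab)

lemma exists_pos_mul_of_linear_aux {f a : ℝ → ℝ} {s t : ℝ} (hst : s ≤ t)
    (hf : ∀ τ ∈ Icc s t, HasDerivWithinAt f (a τ * f τ) (Icc s t) τ)
    (ha : ContinuousOn a (Icc s t)) : ∃ k, 0 < k ∧ f t = k * f s := by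
  set e : ℝ → ℝ := IccExtend hst (domRestrict (Icc s t) a) with he
  have hec : Continuous e := (continuousOn_iff_continuous_domRestrict.1 ha).Icc_extend'
  have hea : ∀ τ ∈ Icc s t, e τ = a τ := fun τ hτ => by
    rw [he, IccExtend_of_mem hst _ hτ]; rfl
  set A : ℝ → ℝ := fun τ => ∫ r in s..τ, e r
  have hA : ∀ τ, HasDerivAt A (e τ) τ := fun τ => hec.integral_hasStrictDerivAt s τ |>.hasDerivAt
  have hg : ∀ τ ∈ Icc s t, HasDerivWithinAt (fun τ => f τ * Real.exp (-A τ)) 0 (Icc s t) τ := by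
    intro τ hτ
    have := (hf τ hτ).mul ((hA τ).neg.exp.hasDerivWithinAt (s := Icc s t))
    refine this.congr_deriv ?_
    rw [hea τ hτ]; ring
  have hc := le_antisymm
    (monotoneOn_of_deriv_nonneg' (convex_Icc s t) hg (fun _ _ => le_rfl)
      (left_mem_Icc.2 hst) (right_mem_Icc.2 hst) hst)
    (antitoneOn_of_deriv_nonpos' (convex_Icc s t) hg (fun _ _ => le_rfl)
      (left_mem_Icc.2 hst) (right_mem_Icc.2 hst) hst)
  refine ⟨Real.exp (A t), Real.exp_pos _, ?_⟩
  have hAs : A s = 0 := by simp [A]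
  simp only [hAs, neg_zero, Real.exp_zero, mul_one] at hc
  rw [hc, Real.exp_neg]
  field_simp

/-- Solutions of a scalar linear equation `f' = a f` differ by positive factors at any two times, so
that their sign never changes. -/
lemma exists_pos_mul_of_linear {I : Set ℝ} (hI : I.OrdConnected) {f a : ℝ → ℝ}
    (hf : ∀ τ ∈ I, HasDerivWithinAt f (a τ * f τ) I τ) (ha : ContinuousOn a I) {s t : ℝ}
    (hs : s ∈ I) (ht : t ∈ I) : ∃ k, 0 < k ∧ f t = k * f s := by
  rcases le_total s t with h | h
  · exact exists_pos_mul_of_linear_aux h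
      (fun τ hτ => (hf τ (hI.out hs ht hτ)).mono (hI.out hs ht)) (ha.mono (hI.out hs ht))
  · obtain ⟨k, hk, hk'⟩ := exists_pos_mul_of_linear_aux h
      (fun τ hτ => (hf τ (hI.out ht hs hτ)).mono (hI.out ht hs)) (ha.mono (hI.out ht hs))
    exact ⟨k⁻¹, inv_pos.2 hk, by rw [hk']; field_simp⟩

/-! ### Limit points of a curve along which a bounded function increases -/

/-- Barbalat's lemma: if `f` is bounded above and `f' ≥ h ≥ 0` with `h` uniformly continuous, then
`h → 0`. -/
lemma tendsto_zero_of_le_deriv {f f' h : ℝ → ℝ} {a M : ℝ}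
    (hf : ∀ t ≥ a, HasDerivAt f (f' t) t) (hM : ∀ t ≥ a, f t ≤ M)
    (h0 : ∀ t ≥ a, 0 ≤ h t) (hle : ∀ t ≥ a, h t ≤ f' t)
    (hu : UniformContinuousOn h (Ici a)) : Tendsto h atTop (𝓝 0) := by
  have hmono : MonotoneOn f (Ici a) := monotoneOn_of_deriv_nonneg' (convex_Ici a)
    (fun t ht => (hf t ht).hasDerivWithinAt) (fun t ht => (h0 t ht).trans (hle t ht))
  -- `f` has a finite limit
  obtain ⟨ℓ, hℓ⟩ : ∃ ℓ, Tendsto f atTop (𝓝 ℓ) := by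
    have hm : Monotone fun t => f (max t a) := fun s t hst =>
      hmono (mem_Ici.2 (le_max_right _ _)) (mem_Ici.2 (le_max_right _ _)) (max_le_max hst le_rfl)
    have hb : BddAbove (range fun t => f (max t a)) :=
      ⟨M, by rintro _ ⟨t, rfl⟩; exact hM _ (le_max_right _ _)⟩
    refine ⟨_, (tendsto_atTop_ciSup hm hb).congr' ?_⟩
    filter_upwards [eventually_ge_atTop a] with t ht
    rw [max_eq_left ht]
  rw [Metric.tendsto_atTop]
  intro ε hε
  obtain ⟨δ, hδ, hδ'⟩ := Metric.uniformContinuousOn_iff.1 hu (ε / 2) (half_pos hε)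
  obtain ⟨N, hN⟩ := Metric.tendsto_atTop.1 hℓ (ε / 2 * (δ / 2) / 2) (by positivity)
  refine ⟨max N a, fun t ht => ?_⟩
  have hta : a ≤ t := (le_max_right _ _).trans ht
  have htN : N ≤ t := (le_max_left _ _).trans ht
  rw [Real.dist_eq, sub_zero, abs_of_nonneg (h0 t hta)]
  by_contra hcon
  push Not at hcon
  -- `f` grows by a definite amount on `[t, t + δ / 2]`
  have hg : MonotoneOn (fun τ => f τ - ε / 2 * τ) (Icc t (t + δ / 2)) := by
    refine monotoneOn_of_deriv_nonneg' (f' := fun τ => f' τ - ε / 2) (convex_Icc _ _)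
      (fun τ hτ => ?_) (fun τ hτ => ?_)
    · have := (hf τ (hta.trans hτ.1)).sub ((hasDerivAt_id τ).const_mul (ε / 2))
      refine HasDerivAt.hasDerivWithinAt (this.congr_deriv (by ring))
    · have h1 := hδ' t hta τ (hta.trans hτ.1) (by
        rw [Real.dist_eq, abs_sub_comm, abs_of_nonneg (by linarith [hτ.1])]; linarith [hτ.2])
      rw [Real.dist_eq] at h1
      have := (abs_lt.1 h1).2
      have := hle τ (hta.trans hτ.1)
      linarith
  have h1 := hg (left_mem_Icc.2 (by linarith)) (right_mem_Icc.2 (by linarith))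
    (by linarith : t ≤ t + δ / 2)
  have h2 := hN t htN
  have h3 := hN (t + δ / 2) (by linarith)
  rw [Real.dist_eq] at h2 h3
  have := (abs_lt.1 h2).1
  have := (abs_lt.1 h3).2
  simp only at h1
  linarith

section
variable {E : Type*} [NormedAddCommGroup E]

/-- A LaSalle principle: if `f' ≥ H ∘ γ ≥ 0` along a Lipschitz curve `γ` in a compact set, and `f`
is bounded above, then `H` tends to zero along `γ`. -/
lemma tendsto_zero_comp {γ : ℝ → E} {C : NNReal} {K : Set E} {H : E → ℝ}
    {f f' : ℝ → ℝ} {a M : ℝ} (hγ : LipschitzWith C γ) (hK : IsCompact K)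
    (hH : Continuous H) (hmem : ∀ t ≥ a, γ t ∈ K)
    (hf : ∀ t ≥ a, HasDerivAt f (f' t) t) (hM : ∀ t ≥ a, f t ≤ M)
    (h0 : ∀ t ≥ a, 0 ≤ H (γ t)) (hle : ∀ t ≥ a, H (γ t) ≤ f' t) :
    Tendsto (fun t => H (γ t)) atTop (𝓝 0) :=
  tendsto_zero_of_le_deriv hf hM h0 hle
    ((hK.uniformContinuousOn_of_continuous hH.continuousOn).comp
      hγ.uniformContinuous.uniformContinuousOn fun t ht => hmem t ht)

lemma eq_zero_of_mapClusterPt_atTop {γ : ℝ → E} {C : NNReal} {K : Set E} {H : E → ℝ}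
    {f f' : ℝ → ℝ} {a M : ℝ} (hγ : LipschitzWith C γ) (hK : IsCompact K)
    (hH : Continuous H) (hmem : ∀ t ≥ a, γ t ∈ K)
    (hf : ∀ t ≥ a, HasDerivAt f (f' t) t) (hM : ∀ t ≥ a, f t ≤ M)
    (h0 : ∀ t ≥ a, 0 ≤ H (γ t)) (hle : ∀ t ≥ a, H (γ t) ≤ f' t)
    {p : E} (hp : MapClusterPt p atTop γ) : H p = 0 := by
  have h1 : Tendsto (fun t => H (γ t)) atTop (𝓝 0) :=
    tendsto_zero_comp (H := H) (γ := γ) hγ hK hH hmem hf hM h0 hle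
  have h2 : MapClusterPt (H p) atTop (H ∘ γ) := hp.tendsto_comp (hH.tendsto p)
  exact eq_of_nhds_neBot (ClusterPt.mono h2 h1)

/-- The version of the LaSalle principle for time tending to `-∞`. -/
lemma eq_zero_of_mapClusterPt_atBot {γ : ℝ → E} {C : NNReal} {K : Set E} {H : E → ℝ}
    {f f' : ℝ → ℝ} {a M : ℝ} (hγ : LipschitzWith C γ) (hK : IsCompact K)
    (hH : Continuous H) (hmem : ∀ t ≤ a, γ t ∈ K)
    (hf : ∀ t ≤ a, HasDerivAt f (f' t) t) (hM : ∀ t ≤ a, M ≤ f t)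
    (h0 : ∀ t ≤ a, 0 ≤ H (γ t)) (hle : ∀ t ≤ a, H (γ t) ≤ f' t)
    {p : E} (hp : MapClusterPt p atBot γ) : H p = 0 := by
  have hγ' : LipschitzWith C fun t => γ (-t) := by
    refine LipschitzWith.of_dist_le_mul fun s t => ?_
    simpa using hγ.dist_le_mul (-s) (-t)
  have hp' : MapClusterPt p atTop fun t => γ (-t) := by
    have : map (fun t => γ (-t)) atTop = map γ atBot := by
      rw [← map_neg_atTop, map_map]; rfl
    simpa [MapClusterPt, this] using hp
  refine eq_zero_of_mapClusterPt_atTop (a := -a) (f := fun t => -f (-t)) (f' := fun t => f' (-t))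
    (M := -M) hγ' hK hH (fun t ht => hmem _ (by linarith)) (fun t ht => ?_)
    (fun t ht => by linarith [hM (-t) (by linarith)])
    (fun t ht => h0 _ (by linarith)) (fun t ht => hle _ (by linarith)) hp'
  have h := ((hf (-t) (by linarith)).scomp t (hasDerivAt_neg t)).neg
  exact h.congr_deriv (by simp)

/-- Limit points inherit closed conditions. -/
lemma mem_of_mapClusterPt {X ι : Type*} [TopologicalSpace X] {l : Filter ι} {γ : ι → X} {C : Set X}
    (hC : IsClosed C) (h : ∀ᶠ t in l, γ t ∈ C) {p : X} (hp : MapClusterPt p l γ) : p ∈ C :=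
  hC.closure_eq ▸ (mem_closure_iff_clusterPt.2 (ClusterPt.mono hp (le_principal_iff.2 h)))

/-! ### Global solutions -/

variable [NormedSpace ℝ E]

/-- A bounded, globally Lipschitz vector field has complete orbits. -/
theorem exists_global_solution [CompleteSpace E] {V : E → E} {L : NNReal} {M : NNReal}
    (hL : LipschitzWith L V)
    (hM : ∀ x, ‖V x‖ ≤ M) (x : E) : ∃ γ : ℝ → E, γ 0 = x ∧ ∀ t, HasDerivAt γ (V (γ t)) t := by
  have hloc : ∀ n : ℕ, ∃ α : ℝ → E, α 0 = x ∧
      ∀ t ∈ Ioo (-(n + 1 : ℝ)) (n + 1), HasDerivAt α (V (α t)) t := by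
    intro n
    have hn : (0 : ℝ) ≤ n + 1 := by positivity
    have hpl : IsPicardLindelof (fun _ => V) (tmin := -(n + 1 : ℝ)) (tmax := n + 1)
        ⟨0, by constructor <;> linarith⟩ x (M * (n + 1)) 0 M L :=
      IsPicardLindelof.of_time_independent (fun y _ => hM y) (hL.lipschitzOnWith) (by simp)
    obtain ⟨α, h0, hα⟩ := hpl.exists_eq_forall_mem_Icc_hasDerivWithinAt₀
    exact ⟨α, h0, fun t ht => (hα t (Ioo_subset_Icc_self ht)).hasDerivAt (Icc_mem_nhds ht.1 ht.2)⟩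
  choose α hα0 hα using hloc
  have hagree : ∀ m n : ℕ, m ≤ n → EqOn (α m) (α n) (Ioo (-(m + 1 : ℝ)) (m + 1)) := by
    intro m n hmn
    have hmn' : (m : ℝ) ≤ n := by exact_mod_cast hmn
    have hm : (0 : ℝ) ≤ m := by positivity
    refine ODE_solution_unique_of_mem_Ioo (v := fun _ => V) (s := fun _ => univ) (K := L)
      (t₀ := 0) (fun t _ => hL.lipschitzOnWith) (by constructor <;> linarith)
      (fun t ht => ⟨hα m t ht, mem_univ _⟩)
      (fun t ht => ⟨hα n t (Ioo_subset_Ioo (by linarith) (by linarith) ht), mem_univ _⟩)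
      (by rw [hα0, hα0])
  refine ⟨fun t => α ⌈|t|⌉₊ t, by simp [hα0], fun t => ?_⟩
  set n := ⌈|t|⌉₊ + 1
  have hn : |t| + 1 ≤ n := by have := Nat.le_ceil |t|; push_cast [n]; linarith
  have habs := abs_lt.1 (by linarith : |t| < (n : ℝ) + 1)
  have key : ∀ s : ℝ, |s| < |t| + 1 → α ⌈|s|⌉₊ s = α n s := by
    intro s hs
    refine hagree _ _ (Nat.ceil_le.2 (by linarith)) ?_
    have := Nat.le_ceil |s|
    exact abs_lt.1 (by linarith)
  refine HasDerivAt.congr_of_eventuallyEq (f := α n) ?_ ?_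
  · change HasDerivAt (α n) (V (α ⌈|t|⌉₊ t)) t
    rw [key t (by linarith)]
    exact hα n t habs
  · have hnb : {s : ℝ | |s| < |t| + 1} ∈ 𝓝 t :=
      (isOpen_lt continuous_abs continuous_const).mem_nhds (by simp)
    filter_upwards [hnb] with s hs using key s hs

/-- A `C¹` vector field on an open set can be multiplied by a cut-off function that is `1` on a
given compact subset, so that the product has complete orbits. -/
theorem exists_global_solution_cutoff [FiniteDimensional ℝ E] {V : E → E} {O K : Set E}
    (hO : IsOpen O) (hV : ContDiffOn ℝ 1 V O) (hK : IsCompact K) (hKO : K ⊆ O) (x : E) :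
    ∃ χ : E → ℝ, Continuous χ ∧ (∀ y ∈ K, χ y = 1) ∧ ∃ γ : ℝ → E, γ 0 = x ∧
      ∀ t, HasDerivAt γ (χ (γ t) • V (γ t)) t := by
  have : CompleteSpace E := FiniteDimensional.complete ℝ E
  have : ProperSpace E := FiniteDimensional.proper ℝ E
  obtain ⟨K', hK', hKK', hK'O⟩ := exists_compact_between hK hO hKO
  obtain ⟨χ, hχ1, hχ0, -⟩ := exists_contMDiffMap_one_nhds_of_subset_interior
    (modelWithCornersSelf ℝ E) (n := 1) hK.isClosed hKK'
  have hχs : ContDiff ℝ 1 χ := χ.contMDiff.contDiff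
  have htsupp : tsupport χ ⊆ K' :=
    closure_minimal (fun y hy => by_contra fun h => hy (hχ0 y h)) hK'.isClosed
  have hsm : ContDiff ℝ 1 fun y => χ y • V y := by
    rw [contDiff_iff_contDiffAt]
    intro y
    by_cases hy : y ∈ O
    · exact hχs.contDiffAt.smul (hV.contDiffAt (hO.mem_nhds hy))
    · have : (fun y => χ y • V y) =ᶠ[𝓝 y] fun _ => 0 := by
        have hn : y ∉ tsupport χ := fun h => hy (hK'O (htsupp h))
        filter_upwards [notMem_tsupport_iff_eventuallyEq.1 hn] with z hz
        simp [hz]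
      exact contDiffAt_const.congr_of_eventuallyEq this
  have hcs : HasCompactSupport fun y => χ y • V y :=
    HasCompactSupport.smul_right (HasCompactSupport.of_support_subset_isCompact hK'
      ((subset_tsupport _).trans htsupp))
  obtain ⟨L, hL⟩ := hsm.lipschitzWith_of_hasCompactSupport hcs one_ne_zero
  obtain ⟨M, hM⟩ := hcs.exists_bound_of_continuous hsm.continuous
  obtain ⟨γ, hγ0, hγ⟩ := exists_global_solution (M := M.toNNReal) hL
    (fun y => (hM y).trans (Real.le_coe_toNNReal M)) x
  exact ⟨χ, hχs.continuous, fun y hy => hχ1.self_of_nhdsSet y hy, γ, hγ0, hγ⟩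
end

/-! ### Computing differentials along lines -/

lemma fderiv_eq_of_hasDerivAt {n m : ℕ} {F : (Fin n → ℝ) → Fin m → ℝ} {p v : Fin n → ℝ}
    {w : Fin m → ℝ} (hF : DifferentiableAt ℝ F p)
    (h : ∀ i, HasDerivAt (fun s : ℝ => F (p + s • v) i) (w i) 0) : fderiv ℝ F p v = w := by
  have h1 : HasDerivAt (fun s : ℝ => p + s • v) v 0 := by
    simpa using ((hasDerivAt_id (0 : ℝ)).smul_const v).const_add p
  have h2 : HasFDerivAt F (fderiv ℝ F p) ((fun s : ℝ => p + s • v) 0) := by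
    simpa using hF.hasFDerivAt
  exact (h2.comp_hasDerivAt 0 h1).unique (hasDerivAt_pi.2 h)

lemma hasDerivAt_line {n : ℕ} (p v : Fin n → ℝ) (i : Fin n) :
    HasDerivAt (fun s : ℝ => (p + s • v) i) (v i) 0 := by
  simpa using ((hasDerivAt_id (0 : ℝ)).mul_const (v i)).const_add (p i)

/-! ### The local coordinates -/

lemma bijOn_localCoord : BijOn localCoord {p ∈ jordanClosed | 0 < p 2} localRegion := by
  refine ⟨?_, ?_, ?_⟩
  · rintro p ⟨⟨h1, h2, h3⟩, h4⟩
    refine ⟨?_, ?_⟩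
    · simp only [omegaPf] at h1
      simp only [localCoord, Matrix.cons_val]
      nlinarith
    · simp only [localCoord, Matrix.cons_val]
      exact div_nonneg (by linarith) h4.le
  · rintro p ⟨-, hp⟩ q ⟨-, hq⟩ h
    have h0 := congrFun h 0
    have h1 := congrFun h 1
    have h2 := congrFun h 2
    simp only [localCoord, Matrix.cons_val] at h0 h1 h2
    rw [div_eq_div_iff hp.ne' hq.ne'] at h2
    ext i
    fin_cases i
    · simpa using h0
    · exact h1
    · simp only [Fin.reduceFinMk]; linarith
  · rintro p ⟨h1, h2⟩
    have h3 : 0 < 1 + p 2 := by linarith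
    refine ⟨![p 0 - 1, p 1, 1 / (1 + p 2)], ⟨⟨?_, ?_, ?_⟩, ?_⟩, ?_⟩
    · simp only [omegaPf, Matrix.cons_val]; nlinarith
    · simp only [Matrix.cons_val]; positivity
    · simp only [Matrix.cons_val]; rw [div_le_one h3]; linarith
    · simp only [Matrix.cons_val]; positivity
    · ext i
      fin_cases i
      · simp [localCoord]
      · simp [localCoord]
      · simp only [localCoord, Matrix.cons_val, Fin.reduceFinMk]; field_simp; ring

lemma localCoord_pointN1 : localCoord pointN1 = 0 := by
  ext i; fin_cases i <;> simp [localCoord, pointN1]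

lemma differentiableAt_localCoord {p : Fin 3 → ℝ} (hp : p 2 ≠ 0) :
    DifferentiableAt ℝ localCoord p := by
  rw [differentiableAt_pi]
  intro i
  fin_cases i
  · simp only [localCoord, Matrix.cons_val, Fin.zero_eta]; fun_prop
  · simp only [localCoord, Matrix.cons_val, Fin.mk_one]; fun_prop
  · simp only [localCoord, Matrix.cons_val, Fin.reduceFinMk]; fun_prop (disch := assumption)

lemma fderiv_localCoord (g : ℝ) {p : Fin 3 → ℝ} (hp : p 2 ≠ 0) :
    fderiv ℝ localCoord p (jordanField g p) = p 2 • localField g (localCoord p) := by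
  refine fderiv_eq_of_hasDerivAt (differentiableAt_localCoord hp) fun i => ?_
  set v := jordanField g p with hv
  have h0 := hasDerivAt_line p v 0
  have h1 := hasDerivAt_line p v 1
  have h2 := hasDerivAt_line p v 2
  have e2 : (p + (0 : ℝ) • v) 2 = p 2 := by simp
  fin_cases i
  · refine (h0.const_add 1).congr_deriv ?_
    simp only [hv, jordanField, localField, localCoord, Matrix.cons_val, Pi.smul_apply, smul_eq_mul,
      Fin.zero_eta]
    field_simp
    ring
  · refine h1.congr_deriv ?_
    simp only [hv, jordanField, localField, localCoord, Matrix.cons_val, Pi.smul_apply, smul_eq_mul,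
      Fin.mk_one]
    field_simp
    ring
  · refine ((h2.const_sub 1).div h2 (by rwa [e2])).congr_deriv ?_
    rw [e2]
    simp only [hv, jordanField, localField, localCoord, Matrix.cons_val, Pi.smul_apply, smul_eq_mul,
      Fin.reduceFinMk]
    field_simp
    ring

/-! ### The blow-up map -/

lemma blowUpMap_eq_zero_iff {q : Fin 4 → ℝ} (hq : q ∈ blowUpSpace) :
    blowUpMap q = 0 ↔ q 3 = 0 := by
  constructor
  · intro h
    by_contra hu
    have h0 := congrFun h 0
    have h1 := congrFun h 1
    have h2 := congrFun h 2
    simp [blowUpMap, hu] at h0 h1 h2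
    have := hq.1
    rw [h0, h1, h2] at this
    norm_num at this
  · intro h
    ext i; fin_cases i <;> simp [blowUpMap, h]

lemma bijOn_blowUpMap :
    BijOn blowUpMap {q ∈ blowUpRegion | 0 < q 3} (localRegion \ {0}) := by
  refine ⟨?_, ?_, ?_⟩
  · rintro q ⟨⟨h1, h2, h3⟩, h4⟩
    refine ⟨⟨?_, ?_⟩, fun h => h4.ne' ((blowUpMap_eq_zero_iff h1).1 h)⟩
    · simp only [blowUpMap, Matrix.cons_val]
      nlinarith [mul_nonneg (sq_nonneg (q 3)) h2]
    · simp only [blowUpMap, Matrix.cons_val]; positivity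
  · rintro p ⟨⟨⟨hp1, -⟩, -, -⟩, hp⟩ q ⟨⟨⟨hq1, -⟩, -, -⟩, hq⟩ h
    have h0 := congrFun h 0
    have h1 := congrFun h 1
    have h2 := congrFun h 2
    simp only [blowUpMap, Matrix.cons_val] at h0 h1 h2
    -- on a weighted half-line from the origin the weighted norm determines `u`
    have key : ∀ a b x y z x' y' z' : ℝ, 0 < a → 0 < b → x ^ 2 + y ^ 2 + z ^ 2 = 1 →
        x' ^ 2 + y' ^ 2 + z' ^ 2 = 1 → a ^ 2 * x = b ^ 2 * x' → a * y = b * y' → a * z = b * z' →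
        a ≤ b := by
      intro a b x y z x' y' z' ha hb h h' hx hy hz
      by_contra hab
      push Not at hab
      have hk : 0 < b / a ∧ b / a < 1 := ⟨by positivity, by rwa [div_lt_one ha]⟩
      set k := b / a with hkd
      have ex : x = k ^ 2 * x' := by rw [hkd]; field_simp; linarith
      have ey : y = k * y' := by rw [hkd]; field_simp; linarith
      have ez : z = k * z' := by rw [hkd]; field_simp; linarith
      have hk2 : k ^ 2 < 1 := by nlinarith [hk.1, hk.2]
      have : x ^ 2 + y ^ 2 + z ^ 2 ≤ k ^ 2 * (x' ^ 2 + y' ^ 2 + z' ^ 2) := by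
        rw [ex, ey, ez]
        nlinarith [mul_nonneg (mul_nonneg (sq_nonneg k) (sub_nonneg.2 hk2.le)) (sq_nonneg x')]
      rw [h, h'] at this
      linarith
    have hu : p 3 = q 3 := le_antisymm (key _ _ _ _ _ _ _ _ hp hq hp1 hq1 h0 h1 h2)
      (key _ _ _ _ _ _ _ _ hq hp hq1 hp1 h0.symm h1.symm h2.symm)
    rw [hu] at h0 h1 h2
    have h0' := mul_left_cancel₀ (pow_ne_zero 2 hq.ne') h0
    have h1' := mul_left_cancel₀ hq.ne' h1
    have h2' := mul_left_cancel₀ hq.ne' h2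
    ext i
    fin_cases i
    exacts [h0', h1', h2', hu]
  · rintro p ⟨⟨h1, h2⟩, hp⟩
    have hp' : ¬ (p 0 = 0 ∧ p 1 = 0 ∧ p 2 = 0) := fun h => hp <| by
      rw [mem_singleton_iff]; ext i; fin_cases i
      exacts [h.1, h.2.1, h.2.2]
    set B := p 1 ^ 2 + p 2 ^ 2 with hB
    set R := √(B ^ 2 + 4 * p 0 ^ 2) with hR
    have hR2 : R ^ 2 = B ^ 2 + 4 * p 0 ^ 2 := Real.sq_sqrt (by positivity)
    have hR0 : 0 ≤ R := Real.sqrt_nonneg _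
    have hB0 : 0 ≤ B := by positivity
    -- `m = u ^ 2` solves `m ^ 2 - B m - (p 0) ^ 2 = 0`
    set m := (B + R) / 2 with hm
    have hmeq : m ^ 2 = B * m + p 0 ^ 2 := by rw [hm]; nlinarith
    have hm0 : 0 < m := by
      rcases (by positivity : 0 ≤ m).eq_or_lt with h | h
      · exfalso
        apply hp'
        have hx : p 0 = 0 := by rw [← h] at hmeq; simpa using hmeq.symm
        have hBz : B = 0 := by linarith
        exact ⟨hx, by nlinarith [sq_nonneg (p 2)], by nlinarith [sq_nonneg (p 1)]⟩
      · exact h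
    have hu := Real.sqrt_pos.2 hm0
    have hu2 : √m ^ 2 = m := Real.sq_sqrt hm0.le
    refine ⟨![p 0 / m, p 1 / √m, p 2 / √m, √m], ⟨⟨⟨?_, ?_⟩, ?_, ?_⟩, ?_⟩, ?_⟩
    · simp only [Matrix.cons_val, div_pow, hu2]
      field_simp
      linarith
    · simp only [Matrix.cons_val]; positivity
    · simp only [Matrix.cons_val, div_pow, hu2]
      have : p 0 / m * (2 - m * (p 0 / m)) - p 1 ^ 2 / m = (p 0 * (2 - p 0) - p 1 ^ 2) / m := by
        field_simp
      rw [this]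
      exact div_nonneg h1 hm0.le
    · simp only [Matrix.cons_val]; positivity
    · simpa using hu
    · ext i
      fin_cases i <;> simp [blowUpMap, hu2] <;> field_simp

lemma denom_pos {q : Fin 4 → ℝ} (h : q 0 ^ 2 + q 1 ^ 2 + q 2 ^ 2 = 1) :
    0 < 2 * q 0 ^ 2 + q 1 ^ 2 + q 2 ^ 2 := by
  linarith [sq_nonneg (q 0)]

/-- The desingularised field is tangent to all the cylinders `x² + y² + z² = const`. -/
lemma blowUpField_tangent (g : ℝ) (q : Fin 4 → ℝ) :
    q 0 * blowUpField g q 0 + q 1 * blowUpField g q 1 + q 2 * blowUpField g q 2 = 0 := by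
  by_cases h : 2 * q 0 ^ 2 + q 1 ^ 2 + q 2 ^ 2 = 0
  · have h0 : q 0 = 0 := by nlinarith [sq_nonneg (q 0), sq_nonneg (q 1), sq_nonneg (q 2)]
    have h1 : q 1 = 0 := by nlinarith [sq_nonneg (q 0), sq_nonneg (q 1), sq_nonneg (q 2)]
    have h2 : q 2 = 0 := by nlinarith [sq_nonneg (q 0), sq_nonneg (q 1), sq_nonneg (q 2)]
    simp [h0, h1, h2]
  · have : radialRate g q * (2 * q 0 ^ 2 + q 1 ^ 2 + q 2 ^ 2)
        = q 0 * rescaledField g q 0 + q 1 * rescaledField g q 1 + q 2 * rescaledField g q 2 :=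
      div_mul_cancel₀ _ h
    simp only [blowUpField, Matrix.cons_val]
    linarith

lemma localField_blowUpMap (g : ℝ) (q : Fin 4 → ℝ) :
    localField g (blowUpMap q) = q 3 • fderiv ℝ blowUpMap q (blowUpField g q) := by
  have hd : fderiv ℝ blowUpMap q (blowUpField g q) =
      ![q 3 ^ 2 * rescaledField g q 0, q 3 * rescaledField g q 1, q 3 * rescaledField g q 2] := by
    have hdiff : DifferentiableAt ℝ blowUpMap q := by
      rw [differentiableAt_pi]
      intro i
      fin_cases i <;>
        simp only [blowUpMap, Matrix.cons_val, Fin.reduceFinMk, Fin.zero_eta, Fin.mk_one] <;>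
        fun_prop
    refine fderiv_eq_of_hasDerivAt hdiff fun i => ?_
    set v := blowUpField g q with hv
    have h0 := hasDerivAt_line q v 0
    have h1 := hasDerivAt_line q v 1
    have h2 := hasDerivAt_line q v 2
    have h3 := hasDerivAt_line q v 3
    fin_cases i
    · refine ((h3.pow 2).mul h0).congr_deriv ?_
      simp [hv, blowUpField]; ring
    · refine (h3.mul h1).congr_deriv ?_
      simp [hv, blowUpField]; ring
    · refine (h3.mul h2).congr_deriv ?_
      simp [hv, blowUpField]; ring
  rw [hd]
  ext i
  fin_cases i <;>
    simp only [localField, blowUpMap, rescaledField, Matrix.cons_val, Pi.smul_apply, smul_eq_mul,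
      Fin.reduceFinMk, Fin.zero_eta, Fin.mk_one] <;> ring

/-! ### The directional charts -/

lemma chartZ_field (g : ℝ) {q : Fin 4 → ℝ} (hz : 0 < q 2) :
    DifferentiableAt ℝ chartZ q ∧
      fderiv ℝ chartZ q (blowUpField g q) = q 2 • fieldZ g (chartZ q) := by
  have hz' := hz.ne'
  have hz2 := pow_ne_zero 2 hz'
  have hdiff : DifferentiableAt ℝ chartZ q := by
    rw [differentiableAt_pi]
    intro i
    fin_cases i <;>
      simp only [chartZ, Matrix.cons_val, Fin.reduceFinMk, Fin.zero_eta, Fin.mk_one] <;>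
      fun_prop (disch := assumption)
  refine ⟨hdiff, fderiv_eq_of_hasDerivAt hdiff fun i => ?_⟩
  set v := blowUpField g q with hv
  have h0 := hasDerivAt_line q v 0
  have h1 := hasDerivAt_line q v 1
  have h2 := hasDerivAt_line q v 2
  have h3 := hasDerivAt_line q v 3
  have e (i : Fin 4) : (q + (0 : ℝ) • v) i = q i := by simp
  fin_cases i
  · refine (h0.div (h2.pow 2) (by simpa [e] using hz')).congr_deriv ?_
    simp only [Pi.pow_apply, e]
    simp only [hv, blowUpField, rescaledField, fieldZ, chartZ, Matrix.cons_val,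
      Pi.smul_apply, smul_eq_mul, Fin.zero_eta]
    field_simp
    ring
  · refine (h1.div h2 (by simpa [e] using hz')).congr_deriv ?_
    simp only [e]
    simp only [hv, blowUpField, rescaledField, fieldZ, chartZ, Matrix.cons_val,
      Pi.smul_apply, smul_eq_mul, Fin.mk_one]
    field_simp
    ring
  · refine (h3.mul h2).congr_deriv ?_
    simp only [e]
    simp only [hv, blowUpField, rescaledField, fieldZ, chartZ, Matrix.cons_val,
      Pi.smul_apply, smul_eq_mul, Fin.reduceFinMk]
    field_simp
    ring

lemma chartX_field (g : ℝ) {q : Fin 4 → ℝ} (hx : 0 < q 0) :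
    DifferentiableAt ℝ chartX q ∧
      fderiv ℝ chartX q (blowUpField g q) = √(q 0) • fieldX g (chartX q) := by
  have hx' := hx.ne'
  have hs := Real.sqrt_pos.2 hx
  have hs' := hs.ne'
  have hdiff : DifferentiableAt ℝ chartX q := by
    rw [differentiableAt_pi]
    intro i
    fin_cases i <;>
      simp only [chartX, Matrix.cons_val, Fin.reduceFinMk, Fin.zero_eta, Fin.mk_one] <;>
      fun_prop (disch := assumption)
  refine ⟨hdiff, fderiv_eq_of_hasDerivAt hdiff fun i => ?_⟩
  set v := blowUpField g q with hv
  have h0 := hasDerivAt_line q v 0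
  have h1 := hasDerivAt_line q v 1
  have h2 := hasDerivAt_line q v 2
  have h3 := hasDerivAt_line q v 3
  have e (i : Fin 4) : (q + (0 : ℝ) • v) i = q i := by simp
  have h0s := h0.sqrt (by simpa [e] using hx')
  have hsq : q 0 = √(q 0) ^ 2 := (Real.sq_sqrt hx.le).symm
  fin_cases i
  · refine (h3.mul h0s).congr_deriv ?_
    simp only [e]
    simp only [hv, blowUpField, rescaledField, fieldX, chartX, Matrix.cons_val,
      Pi.smul_apply, smul_eq_mul, Fin.zero_eta]
    generalize √(q 0) = r at *
    rw [hsq]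
    field_simp
    ring
  · refine (h1.div h0s (by simpa [e] using hs')).congr_deriv ?_
    simp only [e]
    simp only [hv, blowUpField, rescaledField, fieldX, chartX, Matrix.cons_val,
      Pi.smul_apply, smul_eq_mul, Fin.mk_one]
    generalize √(q 0) = r at *
    rw [hsq]
    field_simp
    ring
  · refine (h2.div h0s (by simpa [e] using hs')).congr_deriv ?_
    simp only [e]
    simp only [hv, blowUpField, rescaledField, fieldX, chartX, Matrix.cons_val,
      Pi.smul_apply, smul_eq_mul, Fin.reduceFinMk]
    generalize √(q 0) = r at *
    rw [hsq]
    field_simp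
    ring

/-! ### The linearisations at the fixed points on the sphere -/

/-- A linearisation read off from a matrix `J` of directional derivatives. -/
lemma hasLinearisation_of_jacobian {V : (Fin 3 → ℝ) → Fin 3 → ℝ} {p : Fin 3 → ℝ}
    {l : Fin 3 → ℝ} {v : Fin 3 → Fin 3 → ℝ} (J : Matrix (Fin 3) (Fin 3) ℝ)
    (hV : DifferentiableAt ℝ V p)
    (hJ : ∀ w i, HasDerivAt (fun s : ℝ => V (p + s • w) i) (J.mulVec w i) 0)
    (hv : ∀ i, v i ≠ 0 ∧ J.mulVec (v i) = l i • v i)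
    (hc : J.charpoly = ∏ i, (Polynomial.X - Polynomial.C (l i))) : HasLinearisation V p l v := by
  have h : ∀ w, fderiv ℝ V p w = J.mulVec w := fun w => fderiv_eq_of_hasDerivAt hV (hJ w)
  refine ⟨hV, fun i => ⟨(hv i).1, by rw [h, (hv i).2]⟩, ?_⟩
  have : ((fderiv ℝ V p : (Fin 3 → ℝ) →L[ℝ] (Fin 3 → ℝ)) : (Fin 3 → ℝ) →ₗ[ℝ] (Fin 3 → ℝ))
      = Matrix.toLin' J := by
    ext1 w
    ext1
    simp [h]
  rw [this, Matrix.charpoly_toLin', hc]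

lemma charpoly_fin_three {a b c d e l₀ l₁ l₂ : ℝ} (h1 : a + d = l₀ + l₁)
    (h2 : a * d - b * c = l₀ * l₁) (h3 : e = l₂) :
    (!![a, b, 0; c, d, 0; 0, 0, e] : Matrix (Fin 3) (Fin 3) ℝ).charpoly
      = ∏ i, (Polynomial.X - Polynomial.C ((![l₀, l₁, l₂] : Fin 3 → ℝ) i)) := by
  subst h3
  have h1' : (Polynomial.C a + Polynomial.C d : Polynomial ℝ) = .C l₀ + .C l₁ := by
    rw [← Polynomial.C_add, h1, Polynomial.C_add]
  have h2' : (Polynomial.C a * Polynomial.C d - Polynomial.C b * Polynomial.C c : Polynomial ℝ)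
      = .C l₀ * .C l₁ := by
    rw [← Polynomial.C_mul, ← Polynomial.C_mul, ← Polynomial.C_sub, h2, Polynomial.C_mul]
  rw [Matrix.charpoly, Matrix.det_fin_three, Fin.prod_univ_three]
  simp [Matrix.charmatrix, Matrix.scalar_apply]
  linear_combination (-Polynomial.X * (Polynomial.X - Polynomial.C e)) * h1'
    + (Polynomial.X - Polynomial.C e) * h2'

lemma differentiable_fieldZ (g : ℝ) : Differentiable ℝ (fieldZ g) := by
  rw [differentiable_pi]
  intro i
  fin_cases i <;>
    simp only [fieldZ, Matrix.cons_val, Fin.reduceFinMk, Fin.zero_eta, Fin.mk_one] <;> fun_prop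

lemma differentiable_fieldX (g : ℝ) : Differentiable ℝ (fieldX g) := by
  rw [differentiable_pi]
  intro i
  fin_cases i <;>
    simp only [fieldX, Matrix.cons_val, Fin.reduceFinMk, Fin.zero_eta, Fin.mk_one] <;> fun_prop

/-- The Jacobian of `fieldZ` at a point of the sphere. -/
lemma hasDerivAt_fieldZ (g x y : ℝ) (v : Fin 3 → ℝ) (i : Fin 3) :
    HasDerivAt (fun s : ℝ => fieldZ g (![x, y, 0] + s • v) i)
      ((!![3 * (y + 4) + 4 * (1 - 3 / 2 * g), 3 * x - 4 * (1 - 3 / 2 * g) * y, 0;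
          -1, 4 * y + 6, 0; 0, 0, -(y + 4)] : Matrix (Fin 3) (Fin 3) ℝ).mulVec v i) 0 := by
  have h0 := hasDerivAt_line ![x, y, 0] v 0
  have h1 := hasDerivAt_line ![x, y, 0] v 1
  have h2 := hasDerivAt_line ![x, y, 0] v 2
  have e (i : Fin 3) : ((![x, y, 0] : Fin 3 → ℝ) + (0 : ℝ) • v) i = (![x, y, 0] : Fin 3 → ℝ) i := by
    simp
  have ha := (h2.pow 2).mul h0
  have hw := (h0.mul (ha.const_sub 2)).sub (h1.pow 2)
  have hcw := hw.const_mul (1 - 3 / 2 * g)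
  fin_cases i
  · refine (((h0.const_mul 3).mul (h1.add ((ha.const_sub 2).pow 2))).add
      (hcw.mul ((((h2.pow 2).const_mul 3).mul h0).const_sub 2))).congr_deriv ?_
    simp only [Pi.pow_apply, Pi.mul_apply, Pi.add_apply, Pi.sub_apply, e]
    simp [Matrix.mulVec, dotProduct, Fin.sum_univ_three]
    ring
  · refine ((h0.neg.add ((h1.pow 2).const_mul 2)).add (h1.mul (((ha.const_sub 2).mul
      ((((h2.pow 2).const_mul 2).mul h0).const_sub 3)).sub
      (((hw.const_mul (2 * (1 - 3 / 2 * g))).mul (h2.pow 2)))))).congr_deriv ?_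
    simp only [Pi.pow_apply, Pi.mul_apply, Pi.add_apply, Pi.sub_apply, e]
    simp [Matrix.mulVec, dotProduct, Fin.sum_univ_three]
    ring
  · refine (h2.neg.mul ((h1.add ((ha.const_sub 2).pow 2)).sub (hcw.mul (h2.pow 2)))).congr_deriv ?_
    simp only [Pi.pow_apply, Pi.mul_apply, Pi.add_apply, Pi.sub_apply, Pi.neg_apply, e]
    simp [Matrix.mulVec, dotProduct, Fin.sum_univ_three]
    ring

/-- The Jacobian of `fieldX` at a point with `u₁ = z₁ = 0` and `y₁² = 2`. -/
lemma hasDerivAt_fieldX (g : ℝ) {y : ℝ} (hy : y ^ 2 = 2) (v : Fin 3 → ℝ) (i : Fin 3) :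
    HasDerivAt (fun s : ℝ => fieldX g (![0, y, 0] + s • v) i)
      ((!![y / 2, 0, 0; 0, y, 0; 0, 0, -(3 / 2 * y)] : Matrix (Fin 3) (Fin 3) ℝ).mulVec v i) 0 := by
  have h0 := hasDerivAt_line ![0, y, 0] v 0
  have h1 := hasDerivAt_line ![0, y, 0] v 1
  have h2 := hasDerivAt_line ![0, y, 0] v 2
  have e (i : Fin 3) : ((![0, y, 0] : Fin 3 → ℝ) + (0 : ℝ) • v) i = (![0, y, 0] : Fin 3 → ℝ) i := by
    simp
  have hu := h0.pow 2
  have hw := (hu.const_sub 2).sub (h1.pow 2)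
  have hcw := hw.const_mul (1 - 3 / 2 * g)
  fin_cases i
  · refine ((h0.div_const 2).mul (h1.add ((h2.mul (hu.const_sub 2)).mul
      ((hu.const_sub 2).add hcw)))).congr_deriv ?_
    simp only [Pi.pow_apply, Pi.mul_apply, Pi.add_apply, Pi.sub_apply, e]
    simp [Matrix.mulVec, dotProduct, Fin.sum_univ_three]
    ring
  · refine ((((h1.pow 2).const_add (-2)).sub ((h1.mul h2).mul ((hu.mul (hu.const_sub 2)).add
      (hcw.mul (hu.const_add 2))))).const_mul (1 / 2)).congr_deriv ?_
    simp only [Pi.pow_apply, Pi.mul_apply, Pi.add_apply, Pi.sub_apply, e]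
    simp [Matrix.mulVec, dotProduct, Fin.sum_univ_three, hy]
    ring
  · refine ((h2.const_mul (-(1 / 2))).mul ((h1.const_mul 3).add (h2.mul
      ((((hu.const_sub 2).pow 2).const_mul 3).add
        (hcw.mul ((hu.const_mul 3).const_sub 2)))))).congr_deriv ?_
    simp only [Pi.pow_apply, Pi.mul_apply, Pi.add_apply, Pi.sub_apply, e]
    simp [Matrix.mulVec, dotProduct, Fin.sum_univ_three]
    ring

lemma vec_one_ne_zero (a b : ℝ) : (![a, 1, b] : Fin 3 → ℝ) ≠ 0 := fun h => by
  simpa using congrFun h 1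

lemma hasLinearisation_pointR1 (g : ℝ) :
    HasLinearisation (fieldZ g) ![0, 0, 0] ![-2 * (3 * g - 8), 6, -4]
      ![![2 * (3 * g - 5), 1, 0], ![0, 1, 0], ![0, 0, 1]] := by
  refine hasLinearisation_of_jacobian _ (differentiable_fieldZ g _) (hasDerivAt_fieldZ g 0 0)
    (fun i => ?_) ?_
  · fin_cases i
    · refine ⟨vec_one_ne_zero _ _, ?_⟩
      ext j
      fin_cases j <;> simp [Matrix.mulVec, dotProduct, Fin.sum_univ_three] <;> ring
    · refine ⟨vec_one_ne_zero _ _, ?_⟩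
      ext j
      fin_cases j <;> simp [Matrix.mulVec, dotProduct, Fin.sum_univ_three]
    · refine ⟨fun h => by simpa using congrFun h 2, ?_⟩
      ext j
      fin_cases j <;> simp [Matrix.mulVec, dotProduct, Fin.sum_univ_three]
  · exact charpoly_fin_three (by ring) (by ring) (by ring)

lemma hasLinearisation_pointDS1 (g : ℝ) :
    HasLinearisation (fieldZ g) ![8, -4, 0] ![-6, -6 * g, 0]
      ![![-4, 1, 0], ![2 * (3 * g - 5), 1, 0], ![0, 0, 1]] := by
  refine hasLinearisation_of_jacobian _ (differentiable_fieldZ g _) (hasDerivAt_fieldZ g 8 (-4))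
    (fun i => ?_) ?_
  · fin_cases i
    · refine ⟨vec_one_ne_zero _ _, ?_⟩
      ext j
      fin_cases j <;> simp [Matrix.mulVec, dotProduct, Fin.sum_univ_three] <;> ring
    · refine ⟨vec_one_ne_zero _ _, ?_⟩
      ext j
      fin_cases j <;> simp [Matrix.mulVec, dotProduct, Fin.sum_univ_three] <;> ring
    · refine ⟨fun h => by simpa using congrFun h 2, ?_⟩
      ext j
      fin_cases j <;> simp [Matrix.mulVec, dotProduct, Fin.sum_univ_three]
  · exact charpoly_fin_three (by ring) (by ring) (by ring)

lemma hasLinearisation_fieldX (g : ℝ) {y : ℝ} (hy : y ^ 2 = 2) :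
    HasLinearisation (fieldX g) ![0, y, 0] ![y / 2, y, -(3 / 2 * y)]
      ![![1, 0, 0], ![0, 1, 0], ![0, 0, 1]] := by
  refine hasLinearisation_of_jacobian _ (differentiable_fieldX g _) (hasDerivAt_fieldX g hy)
    (fun i => ?_) ?_
  · fin_cases i
    · refine ⟨fun h => by simpa using congrFun h 0, ?_⟩
      ext j
      fin_cases j <;> simp [Matrix.mulVec, dotProduct, Fin.sum_univ_three]
    · refine ⟨vec_one_ne_zero _ _, ?_⟩
      ext j
      fin_cases j <;> simp [Matrix.mulVec, dotProduct, Fin.sum_univ_three]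
    · refine ⟨fun h => by simpa using congrFun h 2, ?_⟩
      ext j
      fin_cases j <;> simp [Matrix.mulVec, dotProduct, Fin.sum_univ_three]
  · exact charpoly_fin_three rfl (by ring) rfl

lemma sqrt_two_div_two : √2 / 2 = 1 / √2 := by
  have := Real.sq_sqrt (zero_le_two (α := ℝ))
  field_simp
  linarith

lemma hasLinearisation_pointWplus (g : ℝ) :
    HasLinearisation (fieldX g) ![0, √2, 0] ![1 / √2, √2, -(3 / √2)]
      ![![1, 0, 0], ![0, 1, 0], ![0, 0, 1]] := by
  have e : (![1 / √2, √2, -(3 / √2)] : Fin 3 → ℝ) = ![√2 / 2, √2, -(3 / 2 * √2)] := by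
    rw [← sqrt_two_div_two, show 3 / √2 = 3 / 2 * √2 by
      linear_combination -3 * sqrt_two_div_two]
  rw [e]
  exact hasLinearisation_fieldX g (Real.sq_sqrt zero_le_two)

lemma hasLinearisation_pointWminus (g : ℝ) :
    HasLinearisation (fieldX g) ![0, -√2, 0] ![-(1 / √2), -√2, 3 / √2]
      ![![1, 0, 0], ![0, 1, 0], ![0, 0, 1]] := by
  have e : (![-(1 / √2), -√2, 3 / √2] : Fin 3 → ℝ) = ![-√2 / 2, -√2, -(3 / 2 * -√2)] := by
    rw [← sqrt_two_div_two, show 3 / √2 = -(3 / 2 * -√2) by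
      linear_combination -3 * sqrt_two_div_two, neg_div]
  rw [e]
  exact hasLinearisation_fieldX g (by simp)

/-! ### The fixed points -/

/-- `u⁻² Ω`, whose sign is the sign of `Ω` off the sphere; it vanishes on the vacuum boundary. -/
def omegaRed (q : Fin 4 → ℝ) : ℝ := q 0 * (2 - q 3 ^ 2 * q 0) - q 1 ^ 2

/-- `u⁻¹ (S + T̄ (1 - X)²)`, which together with `omegaRed` vanishes on the de Sitter line. -/
def deSitterRed (q : Fin 4 → ℝ) : ℝ := q 1 + q 2 * (2 - q 3 ^ 2 * q 0) ^ 2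

lemma continuous_omegaRed : Continuous omegaRed := by unfold omegaRed; fun_prop

lemma continuous_deSitterRed : Continuous deSitterRed := by unfold deSitterRed; fun_prop

lemma isClosed_blowUpRegion : IsClosed blowUpRegion := by
  have h1 : Continuous fun q : Fin 4 → ℝ => q 0 ^ 2 + q 1 ^ 2 + q 2 ^ 2 := by fun_prop
  have h3 : Continuous fun q : Fin 4 → ℝ => q 3 := by fun_prop
  have h2 : Continuous fun q : Fin 4 → ℝ => q 2 := by fun_prop
  exact ((isClosed_eq h1 continuous_const).inter (isClosed_le continuous_const h3)).inter
    ((isClosed_le continuous_const continuous_omegaRed).inter (isClosed_le continuous_const h2))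

lemma blowUpRegion_x_nonneg {q : Fin 4 → ℝ} (hq : q ∈ blowUpRegion) : 0 ≤ q 0 := by
  have := hq.2.1
  by_contra h
  push Not at h
  nlinarith [sq_nonneg (q 1), mul_nonneg (sq_nonneg (q 3)) (sq_nonneg (q 0))]

lemma blowUpRegion_y_eq_zero {q : Fin 4 → ℝ} (hq : q ∈ blowUpRegion) (hx : q 0 = 0) :
    q 1 = 0 := by
  have := hq.2.1
  rw [hx] at this
  nlinarith [sq_nonneg (q 1)]

lemma heightDS1_pos : 0 < heightDS1 := by
  refine Real.sqrt_pos.2 (div_pos ?_ (by norm_num))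
  have : (17 : ℝ) < √545 := by
    rw [Real.lt_sqrt (by norm_num)]; norm_num
  linarith

lemma sq_heightDS1 : heightDS1 ^ 2 = (√545 - 17) / 128 := by
  refine Real.sq_sqrt (div_nonneg ?_ (by norm_num))
  have : (17 : ℝ) ≤ √545 := by
    rw [Real.le_sqrt (by norm_num) (by norm_num)]; norm_num
  linarith

/-- The height of `dS₁` is determined by the norm of `(8v², -4v, v)`. -/
lemma heightDS1_eq : 64 * heightDS1 ^ 4 + 17 * heightDS1 ^ 2 = 1 := by
  have h : heightDS1 ^ 4 = ((√545 - 17) / 128) ^ 2 := by rw [← sq_heightDS1]; ring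
  have h5 : √545 ^ 2 = 545 := Real.sq_sqrt (by norm_num)
  rw [h, sq_heightDS1]
  nlinarith

lemma heightDS1_unique {z : ℝ} (hz : 0 ≤ z) (h : 64 * z ^ 4 + 17 * z ^ 2 = 1) :
    z = heightDS1 := by
  have h' := heightDS1_eq
  have hv := heightDS1_pos
  have h2 : z ^ 2 = heightDS1 ^ 2 := by
    have : (z ^ 2 - heightDS1 ^ 2) * (64 * (z ^ 2 + heightDS1 ^ 2) + 17) = 0 := by
      linear_combination h - h'
    rcases mul_eq_zero.1 this with h | h
    · linarith
    · nlinarith [sq_nonneg z, sq_nonneg heightDS1]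
  exact (pow_left_inj₀ hz hv.le two_ne_zero).1 h2

lemma sq_sqrt_wHeight : √(2 * (√2 - 1)) ^ 2 = 2 * (√2 - 1) :=
  Real.sq_sqrt (by have : (1 : ℝ) ≤ √2 := by { rw [Real.le_sqrt] <;> norm_num }
                   linarith)

lemma sqrt_two_gt_one : (1 : ℝ) < √2 := by rw [Real.lt_sqrt] <;> norm_num

lemma pointR1_mem : pointR1 ∈ sphereRegion := by
  refine ⟨⟨⟨?_, ?_⟩, ?_, ?_⟩, ?_⟩ <;> simp [pointR1]

lemma pointDS1_mem : pointDS1 ∈ sphereRegion := by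
  have := heightDS1_eq
  have hv := heightDS1_pos
  refine ⟨⟨⟨?_, ?_⟩, ?_, ?_⟩, ?_⟩ <;> simp only [pointDS1, Matrix.cons_val]
  · linear_combination this
  · exact le_rfl
  · nlinarith
  · exact hv.le

lemma pointWplus_mem : pointWplus ∈ sphereRegion := by
  have h := sq_sqrt_wHeight
  have h2 := Real.sq_sqrt (zero_le_two (α := ℝ))
  refine ⟨⟨⟨?_, ?_⟩, ?_, ?_⟩, ?_⟩ <;> simp only [pointWplus, Matrix.cons_val, h]
  · linear_combination h2
  · exact le_rfl
  · linarith
  · exact le_rfl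

lemma pointWminus_mem : pointWminus ∈ sphereRegion := by
  have h := sq_sqrt_wHeight
  have h2 := Real.sq_sqrt (zero_le_two (α := ℝ))
  refine ⟨⟨⟨?_, ?_⟩, ?_, ?_⟩, ?_⟩ <;> simp only [pointWminus, Matrix.cons_val, neg_sq, h]
  · linear_combination h2
  · exact le_rfl
  · linarith
  · exact le_rfl

lemma eq_pointR1 {q : Fin 4 → ℝ} (hq : q ∈ sphereRegion) (hx : q 0 = 0) : q = pointR1 := by
  have hy := blowUpRegion_y_eq_zero hq.1 hx
  have h1 := hq.1.1.1
  have hz := hq.1.2.2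
  rw [hx, hy] at h1
  have : q 2 = 1 := by nlinarith
  ext i
  fin_cases i
  exacts [hx, hy, this, hq.2]

lemma eq_pointDS1 {q : Fin 4 → ℝ} (hq : q ∈ sphereRegion) (hw : q 1 ^ 2 = 2 * q 0)
    (hD : q 1 = -4 * q 2) : q = pointDS1 := by
  have h1 := hq.1.1.1
  have hx : q 0 = 8 * q 2 ^ 2 := by rw [hD] at hw; linarith
  have hz : q 2 = heightDS1 := heightDS1_unique hq.1.2.2 (by rw [hx, hD] at h1; linarith)
  rw [hz] at hx hD
  ext i
  fin_cases i
  exacts [hx, hD, hz, hq.2]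

lemma eq_sqrt_two_sub_one {q : Fin 4 → ℝ} (hq : q ∈ blowUpRegion) (hw : q 1 ^ 2 = 2 * q 0)
    (hz : q 2 = 0) : q 0 = √2 - 1 := by
  have h1 := hq.1.1
  have hx := blowUpRegion_x_nonneg hq
  have : (q 0 + 1) ^ 2 = 2 := by rw [hw, hz] at h1; linarith
  have : q 0 + 1 = √2 := by
    rw [← this, Real.sqrt_sq (by linarith)]
  linarith

lemma eq_pointWplus {q : Fin 4 → ℝ} (hq : q ∈ sphereRegion) (hw : q 1 ^ 2 = 2 * q 0)
    (hz : q 2 = 0) (hy : 0 ≤ q 1) : q = pointWplus := by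
  have hx := eq_sqrt_two_sub_one hq.1 hw hz
  have : q 1 = √(2 * (√2 - 1)) := by rw [← hx, ← hw, Real.sqrt_sq hy]
  ext i
  fin_cases i
  exacts [hx, this, hz, hq.2]

lemma eq_pointWminus {q : Fin 4 → ℝ} (hq : q ∈ sphereRegion) (hw : q 1 ^ 2 = 2 * q 0)
    (hz : q 2 = 0) (hy : q 1 ≤ 0) : q = pointWminus := by
  have hx := eq_sqrt_two_sub_one hq.1 hw hz
  have : q 1 = -√(2 * (√2 - 1)) := by
    rw [← hx, ← hw, ← neg_sq, Real.sqrt_sq (by linarith), neg_neg]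
  ext i
  fin_cases i
  exacts [hx, this, hz, hq.2]

/-- The field vanishes where the rescaled field is radial for the weights `(2, 1, 1)` (and `u` is
constant). -/
lemma blowUpField_eq_zero {g r : ℝ} {q : Fin 4 → ℝ} (hq : q ∈ blowUpSpace)
    (h0 : rescaledField g q 0 = 2 * r * q 0) (h1 : rescaledField g q 1 = r * q 1)
    (h2 : rescaledField g q 2 = r * q 2) (h3 : r * q 3 = 0) : blowUpField g q = 0 := by
  have hr : radialRate g q = r := by
    rw [radialRate, h0, h1, h2, div_eq_iff (denom_pos hq.1).ne']; ring
  ext i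
  fin_cases i <;> simp [blowUpField, hr, h0, h1, h2, h3]

lemma rescaledField_eq_zero_of_localField {g : ℝ} {q : Fin 4 → ℝ} (hu : q 3 ≠ 0)
    (h : localField g (blowUpMap q) = 0) : rescaledField g q = 0 := by
  have h0 := congrFun h 0
  have h1 := congrFun h 1
  have h2 := congrFun h 2
  simp only [localField, blowUpMap, Matrix.cons_val, Pi.zero_apply] at h0 h1 h2
  ext i
  fin_cases i <;>
    simp only [rescaledField, Matrix.cons_val, Pi.zero_apply, Fin.reduceFinMk, Fin.zero_eta,
      Fin.mk_one]
  · refine (mul_eq_zero.1 (?_ : q 3 ^ 3 * _ = 0)).resolve_left (pow_ne_zero 3 hu)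
    rw [← h0]; ring
  · refine (mul_eq_zero.1 (?_ : q 3 ^ 2 * _ = 0)).resolve_left (pow_ne_zero 2 hu)
    rw [← h1]; ring
  · refine (mul_eq_zero.1 (?_ : q 3 ^ 2 * _ = 0)).resolve_left (pow_ne_zero 2 hu)
    rw [← h2]; ring

/-- The de Sitter line in the local coordinates: the curve `s = -t (2 - x)²` on the boundary `Ω = 0`
(with `0 < x < 2`). -/
lemma mem_image_lineDS_iff {p : Fin 3 → ℝ} (ht : 0 ≤ p 2) :
    p ∈ localCoord '' lineDS ↔ 0 < p 0 ∧ p 0 < 2 ∧ p 0 * (2 - p 0) - p 1 ^ 2 = 0 ∧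
      p 1 + p 2 * (2 - p 0) ^ 2 = 0 := by
  constructor
  · rintro ⟨_, ⟨X, hX1, hX2, rfl⟩, rfl⟩
    have hX : 0 ≤ 1 - X ^ 2 := by nlinarith
    have hA : 0 < (1 - X) ^ 2 := by have : 0 < 1 - X := by linarith
                                    positivity
    have hR := Real.sqrt_nonneg (1 - X ^ 2)
    have hsq := Real.sq_sqrt hX
    simp only [localCoord, Matrix.cons_val]
    refine ⟨by linarith, by linarith, by rw [neg_sq, hsq]; ring, ?_⟩
    have h2 : (2 - (1 + X)) ^ 2 = (1 - X) ^ 2 := by ring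
    rw [h2]
    generalize (1 - X) ^ 2 = A at *
    have : A + √(1 - X ^ 2) ≠ 0 := by positivity
    field_simp
    ring
  · rintro ⟨h0, h2, hW, hD⟩
    have hs : p 1 ≤ 0 := by nlinarith [mul_nonneg ht (sq_nonneg (2 - p 0))]
    have hsq : √(1 - (p 0 - 1) ^ 2) = -p 1 := by
      rw [show 1 - (p 0 - 1) ^ 2 = (-p 1) ^ 2 by linarith, Real.sqrt_sq (by linarith)]
    refine ⟨_, ⟨p 0 - 1, by linarith, by linarith, rfl⟩, ?_⟩
    rw [hsq]
    have hA : 0 < (2 - p 0) ^ 2 := by have : 0 < 2 - p 0 := by linarith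
                                      positivity
    have h1 : (1 - (p 0 - 1)) ^ 2 = (2 - p 0) ^ 2 := by ring
    have h3 : (2 - p 0) ^ 2 + -p 1 ≠ 0 := by linarith
    ext i
    fin_cases i
    · simp [localCoord]
    · simp [localCoord]
    · simp only [localCoord, Matrix.cons_val, Fin.reduceFinMk, h1]
      generalize (2 - p 0) ^ 2 = A at *
      field_simp
      linarith

lemma mem_liftedLineDS_iff {q : Fin 4 → ℝ} :
    q ∈ liftedLineDS ↔ q ∈ blowUpRegion ∧ 0 < q 3 ∧ omegaRed q = 0 ∧ deSitterRed q = 0 ∧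
      q 3 ^ 2 * q 0 < 2 := by
  constructor
  · rintro ⟨hq, hu, h⟩
    rw [mem_image_lineDS_iff (by simpa [blowUpMap] using mul_nonneg hu.le hq.2.2)] at h
    obtain ⟨h0, h2, hW, hD⟩ := h
    simp only [blowUpMap, Matrix.cons_val] at h0 h2 hW hD
    refine ⟨hq, hu, ?_, ?_, h2⟩
    · refine (mul_eq_zero.1 (?_ : q 3 ^ 2 * _ = 0)).resolve_left (pow_ne_zero 2 hu.ne')
      rw [omegaRed]; linarith
    · refine (mul_eq_zero.1 (?_ : q 3 * _ = 0)).resolve_left hu.ne'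
      rw [deSitterRed]; linarith
  · rintro ⟨hq, hu, hW, hD, h2⟩
    refine ⟨hq, hu, ?_⟩
    rw [mem_image_lineDS_iff (by simpa [blowUpMap] using mul_nonneg hu.le hq.2.2)]
    simp only [blowUpMap, Matrix.cons_val]
    rw [omegaRed] at hW
    rw [deSitterRed] at hD
    have hx : 0 < q 0 := by
      refine (blowUpRegion_x_nonneg hq).lt_of_ne fun hx => ?_
      have hy := blowUpRegion_y_eq_zero hq hx.symm
      have h1 := hq.1.1
      rw [← hx, hy] at hD h1
      have : q 2 = 0 := by linarith
      rw [this] at h1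
      norm_num at h1
    refine ⟨by positivity, h2, ?_, ?_⟩
    · linear_combination q 3 ^ 2 * hW
    · linear_combination q 3 * hD

/-- If `t > 0`, stationarity of `t` determines `s`, and then stationarity of `x` forces `Ω = 0`. -/
lemma mem_lineDS_of_localField_eq_zero {g : ℝ} (hg : 2 / 3 < g) {p : Fin 3 → ℝ}
    (hp : p ∈ localRegion) (hp0 : p ≠ 0) (h : localField g p = 0) : p ∈ localCoord '' lineDS := by
  obtain ⟨hW, ht⟩ := hp
  rw [mem_image_lineDS_iff ht]
  have h0 := congrFun h 0
  have h1 := congrFun h 1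
  have h2 := congrFun h 2
  simp only [localField, Pi.zero_apply] at h0 h1 h2
  simp only [Matrix.cons_val] at h0 h1 h2
  have hc : 1 - 3 / 2 * g < 0 := by linarith
  set c := 1 - 3 / 2 * g
  set x := p 0
  set s := p 1
  set t := p 2
  rcases ht.eq_or_lt with ht0 | ht0
  · exfalso
    apply hp0
    have hx : x * s = 0 := by rw [← ht0] at h0; linarith
    have hs : x = s ^ 2 := by rw [← ht0] at h1; linarith
    have hs0 : s = 0 := by
      rw [hs] at hx
      exact pow_eq_zero_iff (n := 3) three_ne_zero |>.1 (by linarith)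
    ext i
    fin_cases i
    · change x = 0; rw [hs, hs0]; ring
    · exact hs0
    · exact ht0.symm
  · have hs : s = -t * ((2 - x) ^ 2 - c * (x * (2 - x) - s ^ 2)) := by
      have := (mul_eq_zero.1 h2).resolve_left (by linarith)
      linarith
    have hx2 : x ≤ 2 := by nlinarith [sq_nonneg s, sq_nonneg (x - 2)]
    have hW0 : x * (2 - x) - s ^ 2 = 0 := by
      have : 2 * t * c * (x * (2 - x) - s ^ 2) = 0 := by
        rw [← h0]
        linear_combination -x * hs
      exact (mul_eq_zero.1 this).resolve_left (by nlinarith [mul_pos ht0 (neg_pos.2 hc)])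
    rw [hW0] at hs h1
    have hD : s + t * (2 - x) ^ 2 = 0 := by linarith
    have hx0 : 0 ≤ x := by nlinarith [sq_nonneg s, sq_nonneg x]
    refine ⟨hx0.lt_of_ne fun hx => ?_, hx2.lt_of_ne fun hx => ?_, hW0, hD⟩
    · rw [← hx] at hW0 hD
      have : s = 0 := by nlinarith [sq_nonneg s]
      rw [this] at hD
      linarith
    · rw [hx] at hW0
      have : s = 0 := by nlinarith [sq_nonneg s]
      rw [this, hx] at h1
      linarith

lemma fixed_on_sphere {g : ℝ} (hg : 2 / 3 < g) (hg' : g < 2) {q : Fin 4 → ℝ}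
    (hq : q ∈ sphereRegion) (h : blowUpField g q = 0) :
    q = pointR1 ∨ q = pointDS1 ∨ q = pointWplus ∨ q = pointWminus := by
  have hu : q 3 = 0 := hq.2
  have h0 := congrFun h 0
  have h1 := congrFun h 1
  have h2 := congrFun h 2
  have hN := hq.1.1.1
  have hz := hq.1.2.2
  have hw := hq.1.2.1
  have hx := blowUpRegion_x_nonneg hq.1
  simp only [blowUpField, Matrix.cons_val, Pi.zero_apply] at h0 h1 h2
  generalize radialRate g q = r at *
  simp only [rescaledField, Matrix.cons_val, hu] at h0 h1 h2
  rw [hu] at hw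
  rcases hx.eq_or_lt with hx0 | hx0
  · exact Or.inl (eq_pointR1 hq hx0.symm)
  rcases hz.eq_or_lt with hz0 | hz0
  · rw [← hz0] at h0 h1 h2
    have hr : q 1 = 2 * r := by
      have : q 0 * (q 1 - 2 * r) = 0 := by linarith
      have := (mul_eq_zero.1 this).resolve_left hx0.ne'
      linarith
    have hw0 : q 1 ^ 2 = 2 * q 0 := by rw [show r = q 1 / 2 by linarith] at h1; linarith
    rcases le_total 0 (q 1) with hy | hy
    · exact Or.inr (Or.inr (Or.inl (eq_pointWplus hq hw0 hz0.symm hy)))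
    · exact Or.inr (Or.inr (Or.inr (eq_pointWminus hq hw0 hz0.symm hy)))
  · have hr : r = -(q 1 + 4 * q 2) := by
      have : q 2 * (r + (q 1 + 4 * q 2)) = 0 := by linarith
      have := (mul_eq_zero.1 this).resolve_left hz0.ne'
      linarith
    rw [hr] at h0 h1
    have hx1 : q 0 = 2 * q 1 ^ 2 + 6 * q 1 * q 2 := by linarith
    have hww : 2 * q 0 - q 1 ^ 2 = 3 * q 1 * (q 1 + 4 * q 2) := by rw [hx1]; ring
    have key : (q 1 + 4 * q 2) * (q 1 * (q 1 + (3 + (1 - 3 / 2 * g)) * q 2)) = 0 := by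
      have : q 0 * (3 * q 1 + 12 * q 2)
          + 2 * (1 - 3 / 2 * g) * q 2 * (2 * q 0 - q 1 ^ 2) = 0 := by linarith
      rw [hww] at this
      rw [hx1] at this
      linarith
    rcases mul_eq_zero.1 key with h | h
    · have hy : q 1 = -4 * q 2 := by linarith
      refine Or.inr (Or.inl (eq_pointDS1 hq ?_ hy))
      rw [h] at hww
      linarith
    rcases mul_eq_zero.1 h with h | h
    · rw [h] at hx1
      linarith
    · exfalso
      have hy : q 1 = -(4 - 3 / 2 * g) * q 2 := by linarith
      have : 2 * q 0 - q 1 ^ 2 < 0 := by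
        rw [hww, hy]
        have e1 : 0 < (4 - 3 / 2 * g) * (3 / 2 * g) := mul_pos (by linarith) (by linarith)
        have e2 : 0 < q 2 ^ 2 := by positivity
        nlinarith [mul_pos e1 e2]
      linarith

lemma blowUpField_pointR1 (g : ℝ) : blowUpField g pointR1 = 0 := by
  refine blowUpField_eq_zero (r := -4) pointR1_mem.1.1 ?_ ?_ ?_ ?_ <;>
    simp [rescaledField, pointR1]
  norm_num

lemma blowUpField_pointDS1 (g : ℝ) : blowUpField g pointDS1 = 0 := by
  refine blowUpField_eq_zero (r := 0) pointDS1_mem.1.1 ?_ ?_ ?_ ?_ <;>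
    simp only [rescaledField, pointDS1, Matrix.cons_val] <;> ring

lemma blowUpField_pointWplus (g : ℝ) : blowUpField g pointWplus = 0 := by
  have h := sq_sqrt_wHeight
  refine blowUpField_eq_zero (r := √(2 * (√2 - 1)) / 2) pointWplus_mem.1.1 ?_ ?_ ?_ ?_ <;>
    simp only [rescaledField, pointWplus, Matrix.cons_val]
  · ring
  · linear_combination (1 / 2) * h
  · ring
  · ring

lemma blowUpField_pointWminus (g : ℝ) : blowUpField g pointWminus = 0 := by
  have h := sq_sqrt_wHeight
  refine blowUpField_eq_zero (r := -√(2 * (√2 - 1)) / 2) pointWminus_mem.1.1 ?_ ?_ ?_ ?_ <;>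
    simp only [rescaledField, pointWminus, Matrix.cons_val]
  · ring
  · linear_combination (1 / 2) * h
  · ring
  · ring

lemma localField_eq_zero_of_mem_lineDS {g : ℝ} {p : Fin 3 → ℝ} (ht : 0 ≤ p 2)
    (hp : p ∈ localCoord '' lineDS) : localField g p = 0 := by
  obtain ⟨h0, h2, hW, hD⟩ := (mem_image_lineDS_iff ht).1 hp
  have h2' : 2 - p 0 ≠ 0 := by linarith
  ext i
  fin_cases i <;>
    simp only [localField, Matrix.cons_val, Pi.zero_apply, Fin.reduceFinMk, Fin.zero_eta,
      Fin.mk_one]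
  · linear_combination p 0 * hD + (1 - 3 / 2 * g) * p 2 * (2 - p 0) * hW
  · refine (mul_eq_zero.1 (?_ : (2 - p 0) * _ = 0)).resolve_left h2'
    linear_combination p 1 * (1 - p 0) * hD
      + (-1 - (1 - 3 / 2 * g) * p 1 * p 2 * (2 - p 0)) * hW
  · linear_combination -p 2 * hD + p 2 ^ 2 * (1 - 3 / 2 * g) * hW

lemma fixedPoints_eq {g : ℝ} (hg : 2 / 3 < g) (hg' : g < 2) :
    {q ∈ blowUpRegion | blowUpField g q = 0}
      = {pointR1, pointDS1, pointWplus, pointWminus} ∪ liftedLineDS := by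
  ext q
  constructor
  · rintro ⟨hq, h⟩
    rcases hq.1.2.eq_or_lt with hu | hu
    · exact Or.inl (fixed_on_sphere hg hg' ⟨hq, hu.symm⟩ h)
    · refine Or.inr ⟨hq, hu, ?_⟩
      have hmem := bijOn_blowUpMap.mapsTo ⟨hq, hu⟩
      exact mem_lineDS_of_localField_eq_zero hg hmem.1 hmem.2
        (by rw [localField_blowUpMap, h, map_zero, smul_zero])
  · rintro (h | ⟨hq, hu, h⟩)
    · rcases h with rfl | rfl | rfl | rfl
      exacts [⟨pointR1_mem.1, blowUpField_pointR1 g⟩, ⟨pointDS1_mem.1, blowUpField_pointDS1 g⟩,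
        ⟨pointWplus_mem.1, blowUpField_pointWplus g⟩,
        ⟨pointWminus_mem.1, blowUpField_pointWminus g⟩]
    · have hr := rescaledField_eq_zero_of_localField (g := g) hu.ne'
        (localField_eq_zero_of_mem_lineDS
          (by simpa [blowUpMap] using mul_nonneg hu.le hq.2.2) h)
      exact ⟨hq, blowUpField_eq_zero (r := 0) hq.1 (by simp [hr]) (by simp [hr]) (by simp [hr])
        (by simp)⟩

lemma points_subset : ({pointR1, pointDS1, pointWplus, pointWminus} : Set (Fin 4 → ℝ))
    ⊆ sphereRegion := by
  rintro q (rfl | rfl | rfl | rfl)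
  exacts [pointR1_mem, pointDS1_mem, pointWplus_mem, pointWminus_mem]

/-- The square of the height `z` of the point of the lifted de Sitter line with `u² x = a`. -/
noncomputable def heightSq (a : ℝ) : ℝ :=
  2 / ((2 - a) ^ 4 + 1 + √(((2 - a) ^ 4 + 1) ^ 2 + 4 * (2 - a) ^ 6))

lemma heightSq_pos (a : ℝ) : 0 < heightSq a := by unfold heightSq; positivity

lemma heightSq_eq (a : ℝ) :
    heightSq a ^ 2 * (2 - a) ^ 6 + heightSq a * ((2 - a) ^ 4 + 1) = 1 := by
  have hR := Real.sqrt_nonneg (((2 - a) ^ 4 + 1) ^ 2 + 4 * (2 - a) ^ 6)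
  have hR2 : √(((2 - a) ^ 4 + 1) ^ 2 + 4 * (2 - a) ^ 6) ^ 2 = _ := Real.sq_sqrt (by positivity)
  unfold heightSq
  set R := √(((2 - a) ^ 4 + 1) ^ 2 + 4 * (2 - a) ^ 6)
  have : 0 < (2 - a) ^ 4 + 1 + R := by positivity
  field_simp
  linear_combination -hR2

lemma continuous_heightSq : Continuous heightSq := by
  unfold heightSq
  refine continuous_const.div (by fun_prop) fun a => ?_
  positivity

lemma closure_liftedLineDS : {q ∈ closure liftedLineDS | q 3 = 0} = {pointDS1} := by
  apply Subset.antisymm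
  · rintro q ⟨hq, hu⟩
    have hsub : liftedLineDS ⊆ {q | q ∈ blowUpRegion ∧ omegaRed q = 0 ∧ deSitterRed q = 0} :=
      fun p hp => by
        obtain ⟨h1, -, h2, h3, -⟩ := mem_liftedLineDS_iff.1 hp
        exact ⟨h1, h2, h3⟩
    have hcl : IsClosed {q | q ∈ blowUpRegion ∧ omegaRed q = 0 ∧ deSitterRed q = 0} :=
      isClosed_blowUpRegion.inter ((isClosed_eq continuous_omegaRed continuous_const).inter
        (isClosed_eq continuous_deSitterRed continuous_const))
    obtain ⟨h1, h2, h3⟩ := closure_minimal hsub hcl hq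
    rw [omegaRed, hu] at h2
    rw [deSitterRed, hu] at h3
    exact eq_pointDS1 ⟨h1, hu⟩ (by linarith) (by linarith)
  · rintro _ rfl
    refine ⟨?_, pointDS1_mem.2⟩
    -- the lifted line, parametrised by `a = u² x`, which tends to zero at `dS₁`
    set q : ℝ → Fin 4 → ℝ := fun a => ![heightSq a * (2 - a) ^ 3, -√(heightSq a) * (2 - a) ^ 2,
      √(heightSq a), √(a / (heightSq a * (2 - a) ^ 3))] with hqd
    have h0 : q 0 = pointDS1 := by
      have hz : √(heightSq 0) = heightDS1 := by
        refine heightDS1_unique (Real.sqrt_nonneg _) ?_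
        have h := heightSq_eq 0
        have h2 := Real.sq_sqrt (heightSq_pos 0).le
        rw [show √(heightSq 0) ^ 4 = (√(heightSq 0) ^ 2) ^ 2 by ring, h2]
        linarith
      have hz2 : heightSq 0 = heightDS1 ^ 2 := by
        rw [← hz, Real.sq_sqrt (heightSq_pos 0).le]
      ext i
      fin_cases i <;> simp only [hqd, pointDS1, hz, Matrix.cons_val, Fin.reduceFinMk, Fin.zero_eta,
        Fin.mk_one]
      · rw [hz2]; ring
      · ring
      · simp
    have hcont : ContinuousAt q 0 := by
      have hc := continuous_heightSq
      refine continuousAt_pi.2 fun i => ?_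
      fin_cases i <;> simp only [hqd, Matrix.cons_val, Fin.reduceFinMk, Fin.zero_eta, Fin.mk_one]
      · fun_prop
      · fun_prop
      · fun_prop
      · refine ContinuousAt.sqrt (ContinuousAt.div (by fun_prop) (by fun_prop) ?_)
        have := heightSq_pos 0
        positivity
    have htend : Tendsto q (𝓝[>] 0) (𝓝 pointDS1) := h0 ▸ hcont.tendsto.mono_left nhdsWithin_le_nhds
    refine mem_closure_of_tendsto htend ?_
    filter_upwards [Ioo_mem_nhdsGT (zero_lt_one (α := ℝ))] with a ha
    have hm := heightSq_pos a
    have ha2 : 0 < 2 - a := by linarith [ha.2]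
    have hx : 0 < heightSq a * (2 - a) ^ 3 := by positivity
    have hz2 := Real.sq_sqrt hm.le
    have hau : √(a / (heightSq a * (2 - a) ^ 3)) ^ 2 * (heightSq a * (2 - a) ^ 3) = a := by
      rw [Real.sq_sqrt (div_nonneg ha.1.le hx.le), div_mul_cancel₀ _ hx.ne']
    have hw : omegaRed (q a) = 0 := by
      simp only [omegaRed, hqd, Matrix.cons_val, hau, mul_pow, neg_sq, hz2]
      ring
    rw [mem_liftedLineDS_iff]
    refine ⟨⟨⟨?_, ?_⟩, hw.ge, ?_⟩, ?_, hw, ?_, ?_⟩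
    · simp only [hqd, Matrix.cons_val, mul_pow, neg_sq, hz2]
      linear_combination heightSq_eq a
    · exact Real.sqrt_nonneg _
    · exact Real.sqrt_nonneg _
    · exact Real.sqrt_pos.2 (div_pos ha.1 hx)
    · simp only [deSitterRed, hqd, Matrix.cons_val, hau]
      ring
    · simp only [hqd, Matrix.cons_val, hau]
      linarith [ha.2]

lemma chartZ_pointR1 : chartZ pointR1 = ![0, 0, 0] := by
  ext i; fin_cases i <;> simp [chartZ, pointR1]

lemma chartZ_pointDS1 : chartZ pointDS1 = ![8, -4, 0] := by
  have := heightDS1_pos.ne'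
  ext i; fin_cases i <;>
    simp only [chartZ, pointDS1, Matrix.cons_val, Fin.reduceFinMk, Fin.zero_eta, Fin.mk_one]
  · field_simp
  · field_simp
  · simp

lemma sqrt_div_sqrt_wHeight : √(2 * (√2 - 1)) / √(√2 - 1) = √2 := by
  have := sqrt_two_gt_one
  rw [Real.sqrt_mul zero_le_two, mul_div_assoc,
    div_self (Real.sqrt_pos.2 (by linarith)).ne', mul_one]

lemma chartX_pointWplus : chartX pointWplus = ![0, √2, 0] := by
  have := sqrt_div_sqrt_wHeight
  ext i; fin_cases i
  · simp [chartX, pointWplus]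
  · simpa only [chartX, pointWplus, Matrix.cons_val, Fin.mk_one] using this
  · simp [chartX, pointWplus]

lemma chartX_pointWminus : chartX pointWminus = ![0, -√2, 0] := by
  have := sqrt_div_sqrt_wHeight
  ext i; fin_cases i
  · simp [chartX, pointWminus]
  · simpa only [chartX, pointWminus, Matrix.cons_val, Fin.mk_one, neg_div, neg_inj] using this
  · simp [chartX, pointWminus]

/-! ### Orbits of the desingularised field -/

lemma contDiffOn_blowUpField (g : ℝ) :
    ContDiffOn ℝ 1 (blowUpField g) {q | 2 * q 0 ^ 2 + q 1 ^ 2 + q 2 ^ 2 ≠ 0} := by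
  intro q hq
  refine ContDiffAt.contDiffWithinAt ?_
  have hq' : 2 * q 0 ^ 2 + q 1 ^ 2 + q 2 ^ 2 ≠ 0 := hq
  rw [contDiffAt_pi]
  intro i
  fin_cases i <;>
    simp only [blowUpField, radialRate, rescaledField, Matrix.cons_val, Fin.reduceFinMk,
      Fin.zero_eta, Fin.mk_one] <;>
    fun_prop (disch := assumption)

lemma continuousAt_radialRate (g : ℝ) {q : Fin 4 → ℝ} (hq : q 0 ^ 2 + q 1 ^ 2 + q 2 ^ 2 = 1) :
    ContinuousAt (radialRate g) q := by
  have hq' := (denom_pos hq).ne'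
  unfold radialRate
  refine ContinuousAt.div ?_ (by fun_prop) hq'
  simp only [rescaledField, Matrix.cons_val]
  fun_prop

/-- The logarithmic derivative of `omegaRed` along the desingularised field. -/
noncomputable def omegaRate (g : ℝ) (q : Fin 4 → ℝ) : ℝ :=
  2 * q 1 + 2 * q 2 * ((1 - q 3 ^ 2 * q 0) * (2 - q 3 ^ 2 * q 0))
    + 2 * (1 - 3 / 2 * g) * q 2 *
      ((1 - q 3 ^ 2 * q 0) * (2 - q 3 ^ 2 * q 0) + q 3 ^ 2 * q 1 ^ 2) - 2 * radialRate g q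

lemma hasDerivAt_omegaRed {g κ t : ℝ} {γ : ℝ → Fin 4 → ℝ}
    (h : HasDerivAt γ (κ • blowUpField g (γ t)) t) :
    HasDerivAt (fun s => omegaRed (γ s)) (κ * omegaRate g (γ t) * omegaRed (γ t)) t := by
  have hp := hasDerivAt_pi.1 h
  refine (((hp 0).mul ((((hp 3).pow 2).mul (hp 0)).const_sub 2)).sub ((hp 1).pow 2)).congr_deriv ?_
  simp only [Pi.pow_apply, Pi.mul_apply, Pi.smul_apply, smul_eq_mul, omegaRed, omegaRate,
    blowUpField, rescaledField, Matrix.cons_val]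
  ring

/-- The physical region is invariant under the desingularised field multiplied by a continuous
function, and so are its faces. -/
lemma blowUpRegion_invariant {g : ℝ} {χ : (Fin 4 → ℝ) → ℝ} {γ : ℝ → Fin 4 → ℝ}
    (hχ : Continuous χ) (hγ : ∀ t, HasDerivAt γ (χ (γ t) • blowUpField g (γ t)) t)
    (h0 : γ 0 ∈ blowUpRegion) (t : ℝ) :
    γ t ∈ blowUpRegion ∧ (∃ k, 0 < k ∧ γ t 3 = k * γ 0 3) ∧ (∃ k, 0 < k ∧ γ t 2 = k * γ 0 2) ∧
      ∃ k, 0 < k ∧ omegaRed (γ t) = k * omegaRed (γ 0) := by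
  have hc : Continuous γ := continuous_iff_continuousAt.2 fun t => (hγ t).continuousAt
  have hp := fun t => hasDerivAt_pi.1 (hγ t)
  have hN : ∀ t, γ t 0 ^ 2 + γ t 1 ^ 2 + γ t 2 ^ 2 = 1 := by
    have hd : ∀ t, HasDerivAt (fun s => γ s 0 ^ 2 + γ s 1 ^ 2 + γ s 2 ^ 2) 0 t := by
      intro t
      refine ((((hp t 0).pow 2).add ((hp t 1).pow 2)).add ((hp t 2).pow 2)).congr_deriv ?_
      have := blowUpField_tangent g (γ t)
      simp only [Pi.smul_apply, smul_eq_mul]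
      linear_combination 2 * χ (γ t) * this
    intro t
    have := is_const_of_deriv_eq_zero (fun t => (hd t).differentiableAt) (fun t => (hd t).deriv) t 0
    rw [this]
    exact h0.1.1
  have hχc : Continuous fun t => χ (γ t) := hχ.comp hc
  have hρ : Continuous fun t => radialRate g (γ t) := continuous_iff_continuousAt.2 fun t =>
    (continuousAt_radialRate g (hN t)).comp hc.continuousAt
  have hu : ∃ k, 0 < k ∧ γ t 3 = k * γ 0 3 := by
    refine exists_pos_mul_of_linear ordConnected_univ (f := fun t => γ t 3)
      (a := fun t => χ (γ t) * radialRate g (γ t)) (fun τ _ => ?_) (by fun_prop)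
      (mem_univ 0) (mem_univ t)
    refine ((hp τ 3).congr_deriv ?_).hasDerivWithinAt
    simp [blowUpField]; ring
  have hz : ∃ k, 0 < k ∧ γ t 2 = k * γ 0 2 := by
    refine exists_pos_mul_of_linear ordConnected_univ (f := fun t => γ t 2)
      (a := fun t => χ (γ t) * (-(γ t 1 + γ t 2 * ((2 - γ t 3 ^ 2 * γ t 0) ^ 2
        - (1 - 3 / 2 * g) * γ t 3 ^ 2 * omegaRed (γ t))) - radialRate g (γ t)))
      (fun τ _ => ?_) ?_ (mem_univ 0) (mem_univ t)
    · refine ((hp τ 2).congr_deriv ?_).hasDerivWithinAt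
      simp [blowUpField, rescaledField, omegaRed]; ring
    · have := continuous_omegaRed.comp hc
      simp only [Function.comp_def] at this
      fun_prop
  have hw : ∃ k, 0 < k ∧ omegaRed (γ t) = k * omegaRed (γ 0) := by
    refine exists_pos_mul_of_linear ordConnected_univ (f := fun t => omegaRed (γ t))
      (a := fun t => χ (γ t) * omegaRate g (γ t))
      (fun τ _ => (hasDerivAt_omegaRed (hγ τ)).hasDerivWithinAt) ?_ (mem_univ 0) (mem_univ t)
    unfold omegaRate
    fun_prop
  refine ⟨⟨⟨hN t, ?_⟩, ?_, ?_⟩, hu, hz, hw⟩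
  · obtain ⟨k, hk, e⟩ := hu; rw [e]; exact mul_nonneg hk.le h0.1.2
  · obtain ⟨k, hk, e⟩ := hw
    change 0 ≤ omegaRed (γ t)
    rw [e]; exact mul_nonneg hk.le h0.2.1
  · obtain ⟨k, hk, e⟩ := hz; rw [e]; exact mul_nonneg hk.le h0.2.2

/-- If the faces through a point confine its orbit to a compact set, the orbit is complete. -/
lemma exists_orbit (g : ℝ) {q : Fin 4 → ℝ} (hq : q ∈ blowUpRegion) {K : Set (Fin 4 → ℝ)}
    (hK : IsCompact K) (hKR : K ⊆ blowUpRegion)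
    (hqK : ∀ p ∈ blowUpRegion, (q 3 = 0 → p 3 = 0) → (q 2 = 0 → p 2 = 0) → p ∈ K) :
    ∃ γ : ℝ → Fin 4 → ℝ, γ 0 = q ∧ (∀ t, HasDerivAt γ (blowUpField g (γ t)) t) ∧
      (∀ t, γ t ∈ K) ∧ (∃ C, LipschitzWith C γ) ∧
      (∀ t, ∃ k, 0 < k ∧ γ t 2 = k * q 2) ∧
      (∀ t, ∃ k, 0 < k ∧ omegaRed (γ t) = k * omegaRed q) := by
  have hO : IsOpen {q : Fin 4 → ℝ | 2 * q 0 ^ 2 + q 1 ^ 2 + q 2 ^ 2 ≠ 0} :=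
    isOpen_ne_fun (by fun_prop) continuous_const
  have hKO : K ⊆ {q : Fin 4 → ℝ | 2 * q 0 ^ 2 + q 1 ^ 2 + q 2 ^ 2 ≠ 0} :=
    fun p hp => (denom_pos (hKR hp).1.1).ne'
  obtain ⟨χ, hχ, hχ1, γ, hγ0, hγ⟩ :=
    exists_global_solution_cutoff hO (contDiffOn_blowUpField g) hK hKO q
  have hinv := blowUpRegion_invariant hχ hγ (by rwa [hγ0])
  rw [hγ0] at hinv
  have hmem : ∀ t, γ t ∈ K := by
    intro t
    obtain ⟨h1, ⟨k, -, hk⟩, ⟨l, -, hl⟩, -⟩ := hinv t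
    exact hqK _ h1 (fun h => by rw [hk, h, mul_zero]) (fun h => by rw [hl, h, mul_zero])
  have hγ' : ∀ t, HasDerivAt γ (blowUpField g (γ t)) t := fun t => by
    simpa [hχ1 _ (hmem t)] using hγ t
  refine ⟨γ, hγ0, hγ', hmem, ?_, fun t => (hinv t).2.2.1, fun t => (hinv t).2.2.2⟩
  obtain ⟨C, hC⟩ := hK.exists_bound_of_continuousOn
    ((contDiffOn_blowUpField g).continuousOn.mono hKO)
  refine ⟨C.toNNReal, lipschitzWith_of_nnnorm_deriv_le (fun t => (hγ' t).differentiableAt)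
    fun t => ?_⟩
  rw [(hγ' t).deriv, ← NNReal.coe_le_coe, coe_nnnorm]
  exact (hC _ (hmem t)).trans (Real.le_coe_toNNReal C)

lemma isCompact_of_bounded {K : Set (Fin 4 → ℝ)} (hcl : IsClosed K)
    (hK : ∀ q ∈ K, q ∈ blowUpRegion ∧ q 3 ≤ 3) : IsCompact K := by
  refine Metric.isCompact_of_isClosed_isBounded hcl
    ((Metric.isBounded_closedBall (x := 0) (r := 3)).subset fun q hq => ?_)
  obtain ⟨h1, h2⟩ := hK q hq
  rw [mem_closedBall_zero_iff, pi_norm_le_iff_of_nonneg (by norm_num)]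
  have hN := h1.1.1
  intro i
  rw [Real.norm_eq_abs, abs_le]
  fin_cases i
  · simp only [Fin.zero_eta]
    constructor <;> nlinarith [sq_nonneg (q 0), sq_nonneg (q 1), sq_nonneg (q 2)]
  · simp only [Fin.mk_one]
    constructor <;> nlinarith [sq_nonneg (q 0), sq_nonneg (q 1), sq_nonneg (q 2)]
  · simp only [Fin.reduceFinMk]
    constructor <;> nlinarith [sq_nonneg (q 0), sq_nonneg (q 1), sq_nonneg (q 2)]
  · have := h1.1.2
    simp only [Fin.reduceFinMk]
    exact ⟨by linarith, h2⟩

lemma isClosed_sphereRegion : IsClosed sphereRegion :=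
  isClosed_blowUpRegion.inter (isClosed_eq (by fun_prop) continuous_const)

lemma isCompact_sphereRegion : IsCompact sphereRegion :=
  isCompact_of_bounded isClosed_sphereRegion fun q hq => ⟨hq.1, by rw [hq.2]; norm_num⟩

lemma isSolutionOn_univ {g : ℝ} {γ : ℝ → Fin 4 → ℝ}
    (hγ : ∀ t, HasDerivAt γ (blowUpField g (γ t)) t) : IsSolutionOn (blowUpField g) univ γ :=
  fun t _ => (hγ t).hasDerivWithinAt

/-! ### Orbits with `z = 0` -/

/-- `y / √x` along the desingularised field on the faces `z = 0` and `u = 0`. -/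
lemma hasDerivAt_y_div_sqrt {g t : ℝ} {γ : ℝ → Fin 4 → ℝ}
    (h : HasDerivAt γ (blowUpField g (γ t)) t) (hx : 0 < γ t 0) (hzu : γ t 2 = 0 ∨ γ t 3 = 0) :
    HasDerivAt (fun s => γ s 1 / √(γ s 0)) (-((2 * γ t 0 - γ t 1 ^ 2) / (2 * √(γ t 0)) *
      (1 + 2 * (1 - 3 / 2 * g) * (γ t 1 * γ t 2 / γ t 0)))) t := by
  have hp := hasDerivAt_pi.1 h
  have hs := Real.sqrt_pos.2 hx
  refine ((hp 1).div ((hp 0).sqrt hx.ne') hs.ne').congr_deriv ?_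
  have hsq : γ t 0 = √(γ t 0) ^ 2 := (Real.sq_sqrt hx.le).symm
  simp only [blowUpField, rescaledField, Matrix.cons_val]
  generalize √(γ t 0) = r at *
  rw [hsq]
  rcases hzu with h | h <;> rw [h] <;> field_simp <;> ring

/-- If `z = 0`, then `1 = x² + y² ≤ x² + 2x` bounds `x` from below, and hence `u` from above. -/
lemma x_ge_of_z_eq_zero {q : Fin 4 → ℝ} (hq : q ∈ blowUpRegion) (hz : q 2 = 0) :
    2 / 5 ≤ q 0 := by
  have h1 := hq.1.1
  have h2 := hq.2.1
  have hx := blowUpRegion_x_nonneg hq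
  rw [hz] at h1
  by_contra h
  push Not at h
  nlinarith [mul_nonneg (sq_nonneg (q 3)) (sq_nonneg (q 0))]

lemma sqrt_x_le_one {q : Fin 4 → ℝ} (hq : q ∈ blowUpRegion) : √(q 0) ≤ 1 := by
  rw [Real.sqrt_le_left (by norm_num)]
  nlinarith [hq.1.1, sq_nonneg (q 1), sq_nonneg (q 2)]

lemma isCompact_faceZ : IsCompact {q ∈ blowUpRegion | q 2 = 0} := by
  refine isCompact_of_bounded (isClosed_blowUpRegion.inter
    (isClosed_eq (by fun_prop) continuous_const)) fun q hq => ⟨hq.1, ?_⟩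
  have hx := x_ge_of_z_eq_zero hq.1 hq.2
  have h2 := hq.1.2.1
  have h3 := hq.1.1.2
  have : q 3 ^ 2 * q 0 ≤ 2 := by
    have : q 0 * (q 3 ^ 2 * q 0) ≤ q 0 * 2 := by nlinarith [sq_nonneg (q 1)]
    exact le_of_mul_le_mul_left this (by linarith)
  by_contra h
  push Not at h
  have : 9 ≤ q 3 ^ 2 := by nlinarith
  nlinarith

lemma y_sq_le {q : Fin 4 → ℝ} (hq : q ∈ blowUpRegion) : q 1 ^ 2 ≤ 2 * q 0 := by
  have := hq.2.1
  nlinarith [mul_nonneg (sq_nonneg (q 3)) (sq_nonneg (q 0))]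

lemma abs_y_div_sqrt_le {q : Fin 4 → ℝ} (hq : q ∈ blowUpRegion) (hx : 0 < q 0) :
    |q 1 / √(q 0)| ≤ √2 := by
  rw [abs_div, abs_of_pos (Real.sqrt_pos.2 hx), div_le_iff₀ (Real.sqrt_pos.2 hx),
    ← Real.sqrt_mul zero_le_two, ← Real.sqrt_sq_eq_abs]
  exact Real.sqrt_le_sqrt (y_sq_le hq)

/-- On the face `z = 0` points with `y² = 2x` lie on the sphere. -/
lemma faceZ_mem_sphere {q : Fin 4 → ℝ} (hq : q ∈ blowUpRegion) (hz : q 2 = 0)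
    (hw : q 1 ^ 2 = 2 * q 0) : q ∈ sphereRegion := by
  refine ⟨hq, ?_⟩
  have hx := x_ge_of_z_eq_zero hq hz
  have h2 := hq.2.1
  have : q 3 ^ 2 * q 0 ^ 2 ≤ 0 := by nlinarith
  have h3 : q 3 ^ 2 * q 0 ^ 2 = 0 := le_antisymm this (by positivity)
  have h4 := (mul_eq_zero.1 h3).resolve_right (by positivity)
  exact pow_eq_zero_iff two_ne_zero |>.1 h4

lemma faceZ_eq_W {q : Fin 4 → ℝ} (hq : q ∈ blowUpRegion) (hz : q 2 = 0)
    (hw : q 1 ^ 2 = 2 * q 0) : q = pointWplus ∨ q = pointWminus := by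
  have hs := faceZ_mem_sphere hq hz hw
  rcases le_total 0 (q 1) with hy | hy
  · exact Or.inl (eq_pointWplus hs hw hz hy)
  · exact Or.inr (eq_pointWminus hs hw hz hy)

/-- If a limit point set is contained in a single point, the curve converges. -/
lemma tendsto_of_mapClusterPt {γ : ℝ → Fin 4 → ℝ} {l : Filter ℝ} {K : Set (Fin 4 → ℝ)}
    {a : Fin 4 → ℝ} (hK : IsCompact K) (hmem : ∀ t, γ t ∈ K)
    (h : ∀ p ∈ K, MapClusterPt p l γ → p = a) : Tendsto γ l (𝓝 a) :=
  hK.tendsto_nhds_of_unique_mapClusterPt (Eventually.of_forall hmem) h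

lemma pointWplus_y_div : pointWplus 1 = √2 * √(pointWplus 0) := by
  have := sqrt_two_gt_one
  simp [pointWplus]

lemma pointWminus_y_div : pointWminus 1 = -√2 * √(pointWminus 0) := by
  have := sqrt_two_gt_one
  simp [pointWminus]

lemma sqrt_pointW_pos : 0 < √(√2 - 1) := Real.sqrt_pos.2 (by linarith [sqrt_two_gt_one])

/-- On the equator and on the boundary `T = 1` the ratio `y / √x` decreases, from `√2` to `-√2`. -/
lemma connects_faceZ (g : ℝ) {q : Fin 4 → ℝ} (hq : q ∈ blowUpRegion) (hz : q 2 = 0)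
    (hp : q ≠ pointWplus) (hm : q ≠ pointWminus) :
    Connects (blowUpField g) pointWplus pointWminus q := by
  obtain ⟨γ, h0, hγ, hK, ⟨C, hC⟩, -, -⟩ := exists_orbit g hq isCompact_faceZ (fun p h => h.1)
    (fun p h _ h2 => ⟨h, h2 hz⟩)
  have hx : ∀ t, 0 < γ t 0 := fun t => by linarith [x_ge_of_z_eq_zero (hK t).1 (hK t).2]
  have hd : ∀ t, HasDerivAt (fun s => γ s 1 / √(γ s 0))
      (-((2 * γ t 0 - γ t 1 ^ 2) / (2 * √(γ t 0)))) t := fun t =>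
    (hasDerivAt_y_div_sqrt (hγ t) (hx t) (Or.inl (hK t).2)).congr_deriv (by rw [(hK t).2]; simp)
  have hH0 : ∀ t, 0 ≤ (2 * γ t 0 - γ t 1 ^ 2) / 2 := fun t => by
    linarith [y_sq_le (hK t).1]
  have hH : ∀ t, (2 * γ t 0 - γ t 1 ^ 2) / 2 ≤ (2 * γ t 0 - γ t 1 ^ 2) / (2 * √(γ t 0)) := by
    intro t
    have h1 := Real.sqrt_pos.2 (hx t)
    have h2 := sqrt_x_le_one (hK t).1
    exact div_le_div_of_nonneg_left (by linarith [hH0 t]) (by linarith) (by linarith)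
  have hanti : Antitone fun s => γ s 1 / √(γ s 0) := by
    have := antitoneOn_of_deriv_nonpos' convex_univ (fun t _ => (hd t).hasDerivWithinAt)
      (fun t _ => by have := hH t; have := hH0 t; linarith)
    exact fun s t hst => this (mem_univ s) (mem_univ t) hst
  have hHc : Continuous fun p : Fin 4 → ℝ => (2 * p 0 - p 1 ^ 2) / 2 := by fun_prop
  -- the ratio at the given point is neither `√2` nor `-√2`
  have hne : (q 1 / √(q 0)) ^ 2 ≠ 2 := by
    have hx0 := hx 0
    rw [h0] at hx0
    intro h
    rw [div_pow, Real.sq_sqrt hx0.le, div_eq_iff hx0.ne'] at h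
    rcases faceZ_eq_W hq hz h with h | h
    exacts [hp h, hm h]
  have habs := abs_le.1 (abs_y_div_sqrt_le hq (h0 ▸ hx 0))
  have hlt : q 1 / √(q 0) < √2 := habs.2.lt_of_ne fun h => hne (by rw [h]; simp)
  have hgt : -√2 < q 1 / √(q 0) := habs.1.lt_of_ne fun h => hne (by rw [← h]; simp)
  refine ⟨γ, isSolutionOn_univ hγ, h0, ?_, ?_⟩
  · refine tendsto_of_mapClusterPt isCompact_faceZ hK fun p hpK hcl => ?_
    have h1 : (2 * p 0 - p 1 ^ 2) / 2 = 0 := by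
      refine eq_zero_of_mapClusterPt_atBot (a := 0) (M := -√2) hC isCompact_faceZ hHc
        (fun t _ => hK t) (fun t _ => (hd t).neg) (fun t _ => ?_) (fun t _ => hH0 t)
        (fun t _ => by rw [neg_neg]; exact hH t) hcl
      have := (abs_le.1 (abs_y_div_sqrt_le (hK t).1 (hx t))).2
      simpa using this
    have hcl2 : IsClosed {p : Fin 4 → ℝ | q 1 / √(q 0) * √(p 0) ≤ p 1} :=
      isClosed_le (by fun_prop) (by fun_prop)
    have h2 := mem_of_mapClusterPt hcl2 (by
      filter_upwards [eventually_le_atBot 0] with t ht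
      have := hanti ht
      simp only [h0] at this
      exact (le_div_iff₀ (Real.sqrt_pos.2 (hx t))).1 this) hcl
    refine (faceZ_eq_W hpK.1 hpK.2 (by linarith)).resolve_right fun h => ?_
    rw [h] at h2
    have h3 : q 1 / √(q 0) * √(pointWminus 0) ≤ pointWminus 1 := h2
    rw [pointWminus_y_div] at h3
    exact absurd (le_of_mul_le_mul_right h3 sqrt_pointW_pos) (not_le.2 hgt)
  · refine tendsto_of_mapClusterPt isCompact_faceZ hK fun p hpK hcl => ?_
    have h1 : (2 * p 0 - p 1 ^ 2) / 2 = 0 := by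
      refine eq_zero_of_mapClusterPt_atTop (a := 0) (M := √2) hC isCompact_faceZ hHc
        (fun t _ => hK t) (fun t _ => (hd t).neg) (fun t _ => ?_) (fun t _ => hH0 t)
        (fun t _ => by rw [neg_neg]; exact hH t) hcl
      have := (abs_le.1 (abs_y_div_sqrt_le (hK t).1 (hx t))).1
      simp only [Pi.neg_apply]
      linarith
    have hcl2 : IsClosed {p : Fin 4 → ℝ | p 1 ≤ q 1 / √(q 0) * √(p 0)} :=
      isClosed_le (by fun_prop) (by fun_prop)
    have h2 := mem_of_mapClusterPt hcl2 (by
      filter_upwards [eventually_ge_atTop 0] with t ht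
      have := hanti ht
      simp only [h0] at this
      exact (div_le_iff₀ (Real.sqrt_pos.2 (hx t))).1 this) hcl
    refine (faceZ_eq_W hpK.1 hpK.2 (by linarith)).resolve_left fun h => ?_
    rw [h] at h2
    have h3 : pointWplus 1 ≤ q 1 / √(q 0) * √(pointWplus 0) := h2
    rw [pointWplus_y_div] at h3
    exact absurd (le_of_mul_le_mul_right h3 sqrt_pointW_pos) (not_le.2 hlt)

/-- The half-line `x = y = 0`, on which the desingularised field is `-4u ∂/∂u`. -/
lemma stable_line_pointR1 (g : ℝ) {u : ℝ} (hu : 0 < u) :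
    ∃ γ : ℝ → Fin 4 → ℝ, IsSolutionOn (blowUpField g) (Ici 0) γ ∧ γ 0 = ![0, 0, 1, u] ∧
      (∀ t ∈ Ici (0 : ℝ), γ t 0 = 0 ∧ γ t 1 = 0 ∧ γ t 2 = 1 ∧ 0 < γ t 3) ∧
      Tendsto γ atTop (𝓝 pointR1) := by
  refine ⟨fun t => ![0, 0, 1, u * Real.exp (-4 * t)], fun t _ => ?_, by simp, fun t _ => ?_, ?_⟩
  · refine HasDerivAt.hasDerivWithinAt (hasDerivAt_pi.2 fun i => ?_)
    have he : HasDerivAt (fun t => u * Real.exp (-4 * t)) (u * (Real.exp (-4 * t) * (-4))) t := by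
      simpa using (((hasDerivAt_id t).const_mul (-4)).exp).const_mul u
    fin_cases i
    · refine (hasDerivAt_const t (0 : ℝ)).congr_deriv ?_
      simp [blowUpField, rescaledField]
    · refine (hasDerivAt_const t (0 : ℝ)).congr_deriv ?_
      simp [blowUpField, rescaledField]
    · refine (hasDerivAt_const t (1 : ℝ)).congr_deriv ?_
      simp [blowUpField, rescaledField, radialRate]
    · refine he.congr_deriv ?_
      simp [blowUpField, rescaledField, radialRate]
      ring
  · exact ⟨rfl, rfl, rfl, mul_pos hu (Real.exp_pos _)⟩
  · refine tendsto_pi_nhds.2 fun i => ?_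
    fin_cases i
    · exact tendsto_const_nhds
    · exact tendsto_const_nhds
    · exact tendsto_const_nhds
    · have h : Tendsto (fun t : ℝ => -4 * t) atTop atBot :=
        tendsto_id.const_mul_atTop_of_neg (by norm_num)
      simpa [pointR1] using (Real.tendsto_exp_atBot.comp h).const_mul u

/-! ### The flow on the sphere -/

/-- An orbit on the sphere, off the equator. -/
structure IsSphereOrbit (g : ℝ) (γ : ℝ → Fin 4 → ℝ) : Prop where
  deriv : ∀ t, HasDerivAt γ (blowUpField g (γ t)) t
  mem : ∀ t, γ t ∈ sphereRegion
  lip : ∃ C, LipschitzWith C γ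
  z_pos : ∀ t, 0 < γ t 2

lemma exists_sphereOrbit (g : ℝ) {q : Fin 4 → ℝ} (hq : q ∈ sphereRegion) (hz : 0 < q 2) :
    ∃ γ : ℝ → Fin 4 → ℝ, γ 0 = q ∧ IsSphereOrbit g γ ∧
      ∀ t, ∃ k, 0 < k ∧ 2 * γ t 0 - γ t 1 ^ 2 = k * (2 * q 0 - q 1 ^ 2) := by
  obtain ⟨γ, h0, hγ, hK, hC, hz', hw⟩ := exists_orbit g hq.1 isCompact_sphereRegion
    (fun p h => h.1) (fun p h h3 _ => ⟨h, h3 hq.2⟩)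
  refine ⟨γ, h0, ⟨hγ, hK, hC, fun t => ?_⟩, fun t => ?_⟩
  · obtain ⟨k, hk, e⟩ := hz' t
    rw [e]
    exact mul_pos hk hz
  · obtain ⟨k, hk, e⟩ := hw t
    refine ⟨k, hk, ?_⟩
    have h1 : γ t 3 = 0 := (hK t).2
    have h2 : q 3 = 0 := hq.2
    simp only [omegaRed, h1, h2] at e
    linarith

namespace IsSphereOrbit

variable {g : ℝ} {γ : ℝ → Fin 4 → ℝ} (h : IsSphereOrbit g γ)
include h

lemma u_eq (t : ℝ) : γ t 3 = 0 := (h.mem t).2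

lemma continuous : Continuous γ := continuous_iff_continuousAt.2 fun t => (h.deriv t).continuousAt

lemma w_nonneg (t : ℝ) : 0 ≤ 2 * γ t 0 - γ t 1 ^ 2 := by linarith [y_sq_le (h.mem t).1]

lemma continuous_radialRate : Continuous fun t => radialRate g (γ t) :=
  continuous_iff_continuousAt.2 fun t =>
    (continuousAt_radialRate g (h.mem t).1.1.1).comp h.continuous.continuousAt

lemma hasDerivAt_eta (t : ℝ) : HasDerivAt (fun s => γ s 1 / γ s 2)
    ((-((2 * γ t 0 - γ t 1 ^ 2) / 2) + 3 / 2 * (γ t 1 * (γ t 1 + 4 * γ t 2))) / γ t 2) t := by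
  have hp := hasDerivAt_pi.1 (h.deriv t)
  have hz := h.z_pos t
  refine ((hp 1).div (hp 2) hz.ne').congr_deriv ?_
  simp only [blowUpField, rescaledField, Matrix.cons_val, h.u_eq t]
  field_simp
  ring

/-- The bounded function `arctan η` of `η = y / z`, as `η` need not be bounded. -/
lemma hasDerivAt_arctan (t : ℝ) : HasDerivAt (fun s => Real.arctan (γ s 1 / γ s 2))
    (γ t 2 * (-((2 * γ t 0 - γ t 1 ^ 2) / 2) + 3 / 2 * (γ t 1 * (γ t 1 + 4 * γ t 2)))
      / (γ t 1 ^ 2 + γ t 2 ^ 2)) t := by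
  have hz := h.z_pos t
  refine (h.hasDerivAt_eta t).arctan.congr_deriv ?_
  have : γ t 1 ^ 2 + γ t 2 ^ 2 ≠ 0 := by positivity
  field_simp
  ring

lemma yz_le_one (t : ℝ) : γ t 1 ^ 2 + γ t 2 ^ 2 ≤ 1 := by
  linarith [(h.mem t).1.1.1, sq_nonneg (γ t 0)]

lemma le_div_yz (t : ℝ) {a : ℝ} (ha : 0 ≤ a) : a ≤ a / (γ t 1 ^ 2 + γ t 2 ^ 2) := by
  have hz := h.z_pos t
  rw [le_div_iff₀ (by positivity)]
  nlinarith [h.yz_le_one t]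

lemma hasDerivAt_y1 (t : ℝ) (hx : 0 < γ t 0) : HasDerivAt (fun s => γ s 1 / √(γ s 0))
    (-((2 * γ t 0 - γ t 1 ^ 2) / (2 * √(γ t 0)) *
      (1 + 2 * (1 - 3 / 2 * g) * (γ t 1 * γ t 2 / γ t 0)))) t :=
  hasDerivAt_y_div_sqrt (h.deriv t) hx (Or.inr (h.u_eq t))

lemma w_div_sqrt_ge (t : ℝ) (hx : 0 < γ t 0) :
    (2 * γ t 0 - γ t 1 ^ 2) / 2 ≤ (2 * γ t 0 - γ t 1 ^ 2) / (2 * √(γ t 0)) := by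
  have h1 := Real.sqrt_pos.2 hx
  have h2 := sqrt_x_le_one (h.mem t).1
  exact div_le_div_of_nonneg_left (h.w_nonneg t) (by linarith) (by linarith)

/-- Orbits cross `y = 0` only downwards. -/
lemma y_nonpos_of_le (hx : ∀ t, 0 < γ t 0) {s t : ℝ} (hst : s ≤ t) (hs : γ s 1 ≤ 0) :
    γ t 1 ≤ 0 := by
  refine nonpos_of_deriv_neg_of_eq_zero ordConnected_univ (f := fun t => γ t 1)
    (fun t _ => (hasDerivAt_pi.1 (h.deriv t) 1).hasDerivWithinAt) (fun t _ ht => ?_)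
    (mem_univ s) (mem_univ t) hst hs
  have ht' : γ t 1 = 0 := ht
  simp only [blowUpField, rescaledField, Matrix.cons_val, ht']
  linarith [hx t]

lemma mem_of_cluster {l : Filter ℝ} {p : Fin 4 → ℝ} (hp : MapClusterPt p l γ) :
    p ∈ sphereRegion :=
  mem_of_mapClusterPt isClosed_sphereRegion (Eventually.of_forall h.mem) hp

lemma tendsto_of_cluster {l : Filter ℝ} {a : Fin 4 → ℝ} (ha : ∀ p, MapClusterPt p l γ → p = a) :
    Tendsto γ l (𝓝 a) :=
  tendsto_of_mapClusterPt isCompact_sphereRegion h.mem fun p _ hp => ha p hp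

lemma isSolutionOn : IsSolutionOn (blowUpField g) univ γ := isSolutionOn_univ h.deriv

end IsSphereOrbit

/-! ### The vacuum edge of the sphere

On the edge the ratio `η = y / z` satisfies an autonomous equation with right-hand side a positive
multiple of `η (η + 4)`. -/

/-- An orbit on the vacuum edge `y² = 2x` of the sphere. -/
structure IsEdgeOrbit (g : ℝ) (γ : ℝ → Fin 4 → ℝ) : Prop extends IsSphereOrbit g γ where
  edge : ∀ t, γ t 1 ^ 2 = 2 * γ t 0

lemma exists_edgeOrbit (g : ℝ) {q : Fin 4 → ℝ} (hq : q ∈ sphereRegion) (hz : 0 < q 2)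
    (hw : q 1 ^ 2 = 2 * q 0) : ∃ γ : ℝ → Fin 4 → ℝ, γ 0 = q ∧ IsEdgeOrbit g γ := by
  obtain ⟨γ, h0, hγ, hw'⟩ := exists_sphereOrbit g hq hz
  refine ⟨γ, h0, hγ, fun t => ?_⟩
  obtain ⟨k, -, e⟩ := hw' t
  rw [hw, sub_self, mul_zero] at e
  linarith

namespace IsEdgeOrbit

variable {g : ℝ} {γ : ℝ → Fin 4 → ℝ} (h : IsEdgeOrbit g γ)
include h

/-- The invariant point `η = 0` of the edge. -/
lemma y_sign (t : ℝ) : ∃ k, 0 < k ∧ γ t 1 = k * γ 0 1 := by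
  have hc := h.continuous
  have hρ := h.continuous_radialRate
  refine exists_pos_mul_of_linear ordConnected_univ (f := fun t => γ t 1)
    (a := fun t => γ t 1 / 2 + 2 * γ t 2 - radialRate g (γ t))
    (fun τ _ => ?_) (by fun_prop) (mem_univ 0) (mem_univ t)
  refine ((hasDerivAt_pi.1 (h.deriv τ) 1).congr_deriv ?_).hasDerivWithinAt
  simp only [blowUpField, rescaledField, Matrix.cons_val, h.u_eq τ]
  linear_combination 1 / 2 * h.edge τ

/-- The invariant point `η = -4` of the edge. -/
lemma yz_sign (t : ℝ) : ∃ k, 0 < k ∧ γ t 1 + 4 * γ t 2 = k * (γ 0 1 + 4 * γ 0 2) := by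
  have hc := h.continuous
  have hρ := h.continuous_radialRate
  refine exists_pos_mul_of_linear ordConnected_univ (f := fun t => γ t 1 + 4 * γ t 2)
    (a := fun t => γ t 1 / 2 - 4 * γ t 2 - radialRate g (γ t))
    (fun τ _ => ?_) (by fun_prop) (mem_univ 0) (mem_univ t)
  have hp := hasDerivAt_pi.1 (h.deriv τ)
  refine (((hp 1).add ((hp 2).const_mul 4)).congr_deriv ?_).hasDerivWithinAt
  simp only [blowUpField, rescaledField, Matrix.cons_val, h.u_eq τ]
  linear_combination 1 / 2 * h.edge τ

lemma hasDerivAt_arctan' (t : ℝ) : HasDerivAt (fun s => Real.arctan (γ s 1 / γ s 2))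
    (3 / 2 * (γ t 2 * (γ t 1 * (γ t 1 + 4 * γ t 2))) / (γ t 1 ^ 2 + γ t 2 ^ 2)) t := by
  refine (h.hasDerivAt_arctan t).congr_deriv ?_
  rw [h.edge t]
  ring

lemma edge_of_cluster {l : Filter ℝ} {p : Fin 4 → ℝ} (hp : MapClusterPt p l γ) :
    p 1 ^ 2 = 2 * p 0 := by
  have hcl : IsClosed {p : Fin 4 → ℝ | p 1 ^ 2 = 2 * p 0} := isClosed_eq (by fun_prop) (by fun_prop)
  exact mem_of_mapClusterPt hcl (Eventually.of_forall h.edge) hp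

/-- Where `η (η + 4) ≥ 0`, the limit points satisfy `z = 0`, `η = 0` or `η = -4`, and `η` is
increasing. -/
lemma increasing (hs : ∀ t, 0 ≤ γ t 1 * (γ t 1 + 4 * γ t 2)) :
    (∀ p, MapClusterPt p atTop γ →
      p 2 * (p 1 * (p 1 + 4 * p 2)) = 0 ∧ γ 0 1 / γ 0 2 * p 2 ≤ p 1) ∧
    (∀ p, MapClusterPt p atBot γ →
      p 2 * (p 1 * (p 1 + 4 * p 2)) = 0 ∧ p 1 ≤ γ 0 1 / γ 0 2 * p 2) := by
  obtain ⟨C, hC⟩ := h.lip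
  have hH : Continuous fun p : Fin 4 → ℝ => 3 / 2 * (p 2 * (p 1 * (p 1 + 4 * p 2))) := by fun_prop
  have hH0 : ∀ t, 0 ≤ 3 / 2 * (γ t 2 * (γ t 1 * (γ t 1 + 4 * γ t 2))) := fun t =>
    mul_nonneg (by norm_num) (mul_nonneg (h.z_pos t).le (hs t))
  have hmono : Monotone fun t => γ t 1 / γ t 2 := by
    have := monotoneOn_of_deriv_nonneg' convex_univ
      (fun t _ => (h.hasDerivAt_eta t).hasDerivWithinAt) (fun t _ => by
        refine div_nonneg ?_ (h.z_pos t).le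
        rw [h.edge t]
        linarith [hs t])
    exact fun s t hst => this (mem_univ s) (mem_univ t) hst
  refine ⟨fun p hp => ⟨?_, ?_⟩, fun p hp => ⟨?_, ?_⟩⟩
  · have := eq_zero_of_mapClusterPt_atTop (a := 0) (M := Real.pi / 2) hC isCompact_sphereRegion hH
      (fun t _ => h.mem t) (fun t _ => h.hasDerivAt_arctan' t)
      (fun t _ => (Real.arctan_lt_pi_div_two _).le) (fun t _ => hH0 t)
      (fun t _ => h.le_div_yz t (hH0 t)) hp
    linarith
  · have hcl : IsClosed {p : Fin 4 → ℝ | γ 0 1 / γ 0 2 * p 2 ≤ p 1} :=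
      isClosed_le (by fun_prop) (by fun_prop)
    refine mem_of_mapClusterPt hcl ?_ hp
    filter_upwards [eventually_ge_atTop 0] with t ht
    exact (le_div_iff₀ (h.z_pos t)).1 (hmono ht)
  · have := eq_zero_of_mapClusterPt_atBot (a := 0) (M := -(Real.pi / 2)) hC isCompact_sphereRegion
      hH (fun t _ => h.mem t) (fun t _ => h.hasDerivAt_arctan' t)
      (fun t _ => (Real.neg_pi_div_two_lt_arctan _).le) (fun t _ => hH0 t)
      (fun t _ => h.le_div_yz t (hH0 t)) hp
    linarith
  · have hcl : IsClosed {p : Fin 4 → ℝ | p 1 ≤ γ 0 1 / γ 0 2 * p 2} :=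
      isClosed_le (by fun_prop) (by fun_prop)
    refine mem_of_mapClusterPt hcl ?_ hp
    filter_upwards [eventually_le_atBot 0] with t ht
    exact (div_le_iff₀ (h.z_pos t)).1 (hmono ht)

/-- Where `η (η + 4) ≤ 0`, the limit points satisfy `z = 0`, `η = 0` or `η = -4`, and `η` is
decreasing. -/
lemma decreasing (hs : ∀ t, γ t 1 * (γ t 1 + 4 * γ t 2) ≤ 0) :
    (∀ p, MapClusterPt p atTop γ →
      p 2 * (p 1 * (p 1 + 4 * p 2)) = 0 ∧ p 1 ≤ γ 0 1 / γ 0 2 * p 2) ∧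
    (∀ p, MapClusterPt p atBot γ →
      p 2 * (p 1 * (p 1 + 4 * p 2)) = 0 ∧ γ 0 1 / γ 0 2 * p 2 ≤ p 1) := by
  obtain ⟨C, hC⟩ := h.lip
  have hH : Continuous fun p : Fin 4 → ℝ => -(3 / 2 * (p 2 * (p 1 * (p 1 + 4 * p 2)))) := by
    fun_prop
  have hH0 : ∀ t, 0 ≤ -(3 / 2 * (γ t 2 * (γ t 1 * (γ t 1 + 4 * γ t 2)))) := fun t => by
    have := mul_nonneg (h.z_pos t).le (neg_nonneg.2 (hs t))
    linarith
  have hle : ∀ t, -(3 / 2 * (γ t 2 * (γ t 1 * (γ t 1 + 4 * γ t 2)))) ≤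
      -(3 / 2 * (γ t 2 * (γ t 1 * (γ t 1 + 4 * γ t 2))) / (γ t 1 ^ 2 + γ t 2 ^ 2)) := fun t => by
    rw [← neg_div]
    exact h.le_div_yz t (hH0 t)
  have hanti : Antitone fun t => γ t 1 / γ t 2 := by
    have := antitoneOn_of_deriv_nonpos' convex_univ
      (fun t _ => (h.hasDerivAt_eta t).hasDerivWithinAt) (fun t _ => by
        refine div_nonpos_of_nonpos_of_nonneg ?_ (h.z_pos t).le
        rw [h.edge t]
        linarith [hs t])
    exact fun s t hst => this (mem_univ s) (mem_univ t) hst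
  refine ⟨fun p hp => ⟨?_, ?_⟩, fun p hp => ⟨?_, ?_⟩⟩
  · have := eq_zero_of_mapClusterPt_atTop (a := 0) (M := Real.pi / 2) hC isCompact_sphereRegion hH
      (fun t _ => h.mem t) (fun t _ => (h.hasDerivAt_arctan' t).neg)
      (fun t _ => by
        have := Real.neg_pi_div_two_lt_arctan (γ t 1 / γ t 2)
        simp only [Pi.neg_apply]
        linarith) (fun t _ => hH0 t) (fun t _ => hle t) hp
    linarith
  · have hcl : IsClosed {p : Fin 4 → ℝ | p 1 ≤ γ 0 1 / γ 0 2 * p 2} :=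
      isClosed_le (by fun_prop) (by fun_prop)
    refine mem_of_mapClusterPt hcl ?_ hp
    filter_upwards [eventually_ge_atTop 0] with t ht
    exact (div_le_iff₀ (h.z_pos t)).1 (hanti ht)
  · have := eq_zero_of_mapClusterPt_atBot (a := 0) (M := -(Real.pi / 2)) hC isCompact_sphereRegion
      hH (fun t _ => h.mem t) (fun t _ => (h.hasDerivAt_arctan' t).neg)
      (fun t _ => by
        have := Real.arctan_lt_pi_div_two (γ t 1 / γ t 2)
        simp only [Pi.neg_apply]
        linarith) (fun t _ => hH0 t) (fun t _ => hle t) hp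
    linarith
  · have hcl : IsClosed {p : Fin 4 → ℝ | γ 0 1 / γ 0 2 * p 2 ≤ p 1} :=
      isClosed_le (by fun_prop) (by fun_prop)
    refine mem_of_mapClusterPt hcl ?_ hp
    filter_upwards [eventually_le_atBot 0] with t ht
    exact (le_div_iff₀ (h.z_pos t)).1 (hanti ht)

end IsEdgeOrbit

/-- On the vacuum edge of the sphere `y` and `z` do not vanish simultaneously. -/
lemma edge_ne_zero {p : Fin 4 → ℝ} (hp : p ∈ sphereRegion) (hw : p 1 ^ 2 = 2 * p 0)
    (hy : p 1 = 0) (hz : p 2 = 0) : False := by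
  have h1 := hp.1.1.1
  rw [hy] at hw h1
  rw [hz, show p 0 = 0 by linarith] at h1
  norm_num at h1

lemma edge_eq_pointR1 {p : Fin 4 → ℝ} (hp : p ∈ sphereRegion) (hw : p 1 ^ 2 = 2 * p 0)
    (hy : p 1 = 0) : p = pointR1 :=
  eq_pointR1 hp (by rw [hy] at hw; linarith)

/-- If `η > 0`, then `η` increases from `0` to `∞`. -/
lemma connects_edge_pos (g : ℝ) {q : Fin 4 → ℝ} (hq : q ∈ sphereRegion) (hz : 0 < q 2)
    (hw : q 1 ^ 2 = 2 * q 0) (hy : 0 < q 1) :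
    Connects (blowUpField g) pointR1 pointWplus q := by
  obtain ⟨γ, h0, h⟩ := exists_edgeOrbit g hq hz hw
  have hyt : ∀ t, 0 < γ t 1 := fun t => by
    obtain ⟨k, hk, e⟩ := h.y_sign t
    rw [e, h0]
    exact mul_pos hk hy
  obtain ⟨hT, hB⟩ := h.increasing fun t => by
    have := hyt t; have := h.z_pos t; positivity
  rw [h0] at hT hB
  have hη : 0 < q 1 / q 2 := div_pos hy hz
  have hy0 : ∀ {l p}, MapClusterPt p l γ → 0 ≤ p 1 := fun hp =>
    mem_of_mapClusterPt (C := {p : Fin 4 → ℝ | 0 ≤ p 1})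
      (isClosed_le continuous_const (by fun_prop)) (Eventually.of_forall fun t => (hyt t).le) hp
  refine ⟨γ, h.isSolutionOn, h0, h.tendsto_of_cluster fun p hp => ?_,
    h.tendsto_of_cluster fun p hp => ?_⟩
  · have hm := h.mem_of_cluster hp
    have he := h.edge_of_cluster hp
    have hz0 := hm.1.2.2
    obtain ⟨h1, h2⟩ := hB p hp
    have hyp := hy0 hp
    rcases mul_eq_zero.1 h1 with hz | h1
    · rw [hz, mul_zero] at h2
      exact (edge_ne_zero hm he (le_antisymm h2 hyp) hz).elim
    rcases mul_eq_zero.1 h1 with hy | h1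
    · exact edge_eq_pointR1 hm he hy
    · exact (edge_ne_zero hm he (by linarith) (by linarith)).elim
  · have hm := h.mem_of_cluster hp
    have he := h.edge_of_cluster hp
    have hz0 := hm.1.2.2
    obtain ⟨h1, h2⟩ := hT p hp
    have hyp := hy0 hp
    rcases mul_eq_zero.1 h1 with hz | h1
    · exact eq_pointWplus hm he hz hyp
    have hz : p 2 = 0 := by
      rcases mul_eq_zero.1 h1 with hy | h1
      · rw [hy] at h2
        nlinarith
      · linarith
    exact eq_pointWplus hm he hz hyp

/-- If `-4 < η < 0`, then `η` decreases from `0` to `-4`. -/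
lemma connects_edge_mid (g : ℝ) {q : Fin 4 → ℝ} (hq : q ∈ sphereRegion) (hz : 0 < q 2)
    (hw : q 1 ^ 2 = 2 * q 0) (hy : -4 * q 2 < q 1) (hy' : q 1 < 0) :
    Connects (blowUpField g) pointR1 pointDS1 q := by
  obtain ⟨γ, h0, h⟩ := exists_edgeOrbit g hq hz hw
  have hyt : ∀ t, γ t 1 < 0 := fun t => by
    obtain ⟨k, hk, e⟩ := h.y_sign t
    rw [e, h0]
    exact mul_neg_of_pos_of_neg hk hy'
  have hyz : ∀ t, 0 < γ t 1 + 4 * γ t 2 := fun t => by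
    obtain ⟨k, hk, e⟩ := h.yz_sign t
    rw [e, h0]
    exact mul_pos hk (by linarith)
  obtain ⟨hT, hB⟩ := h.decreasing fun t => (mul_neg_of_neg_of_pos (hyt t) (hyz t)).le
  rw [h0] at hT hB
  have hη : q 1 / q 2 < 0 := div_neg_of_neg_of_pos hy' hz
  have hη4 : -4 < q 1 / q 2 := by rwa [lt_div_iff₀ hz]
  have hy0 : ∀ {l p}, MapClusterPt p l γ → p 1 ≤ 0 := fun hp =>
    mem_of_mapClusterPt (C := {p : Fin 4 → ℝ | p 1 ≤ 0})
      (isClosed_le (by fun_prop) continuous_const) (Eventually.of_forall fun t => (hyt t).le) hp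
  have hyz0 : ∀ {l p}, MapClusterPt p l γ → 0 ≤ p 1 + 4 * p 2 := fun hp =>
    mem_of_mapClusterPt (C := {p : Fin 4 → ℝ | 0 ≤ p 1 + 4 * p 2})
      (isClosed_le continuous_const (by fun_prop)) (Eventually.of_forall fun t => (hyz t).le) hp
  refine ⟨γ, h.isSolutionOn, h0, h.tendsto_of_cluster fun p hp => ?_,
    h.tendsto_of_cluster fun p hp => ?_⟩
  · have hm := h.mem_of_cluster hp
    have he := h.edge_of_cluster hp
    have hz0 := hm.1.2.2
    obtain ⟨h1, h2⟩ := hB p hp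
    have hyp := hy0 hp
    have hyzp := hyz0 hp
    rcases mul_eq_zero.1 h1 with hz | h1
    · exact (edge_ne_zero hm he (by linarith) hz).elim
    rcases mul_eq_zero.1 h1 with hy | h1
    · exact edge_eq_pointR1 hm he hy
    · have hz : p 2 = 0 := by nlinarith
      exact (edge_ne_zero hm he (by linarith) hz).elim
  · have hm := h.mem_of_cluster hp
    have he := h.edge_of_cluster hp
    have hz0 := hm.1.2.2
    obtain ⟨h1, h2⟩ := hT p hp
    have hyp := hy0 hp
    have hyzp := hyz0 hp
    rcases mul_eq_zero.1 h1 with hz | h1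
    · exact (edge_ne_zero hm he (by linarith) hz).elim
    rcases mul_eq_zero.1 h1 with hy | h1
    · rw [hy] at h2
      exact (edge_ne_zero hm he hy (by nlinarith)).elim
    · exact eq_pointDS1 hm he (by linarith)

/-- If `η < -4`, then `η` increases from `-∞` to `-4`. -/
lemma connects_edge_neg (g : ℝ) {q : Fin 4 → ℝ} (hq : q ∈ sphereRegion) (hz : 0 < q 2)
    (hw : q 1 ^ 2 = 2 * q 0) (hy : q 1 < -4 * q 2) :
    Connects (blowUpField g) pointWminus pointDS1 q := by
  obtain ⟨γ, h0, h⟩ := exists_edgeOrbit g hq hz hw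
  have hyz : ∀ t, γ t 1 + 4 * γ t 2 < 0 := fun t => by
    obtain ⟨k, hk, e⟩ := h.yz_sign t
    rw [e, h0]
    exact mul_neg_of_pos_of_neg hk (by linarith)
  have hyt : ∀ t, γ t 1 < 0 := fun t => by linarith [hyz t, h.z_pos t]
  obtain ⟨hT, hB⟩ := h.increasing fun t => (mul_pos_of_neg_of_neg (hyt t) (hyz t)).le
  rw [h0] at hT hB
  have hη4 : q 1 / q 2 < -4 := by rwa [div_lt_iff₀ hz]
  have hyz0 : ∀ {l p}, MapClusterPt p l γ → p 1 + 4 * p 2 ≤ 0 := fun hp =>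
    mem_of_mapClusterPt (C := {p : Fin 4 → ℝ | p 1 + 4 * p 2 ≤ 0})
      (isClosed_le (by fun_prop) continuous_const) (Eventually.of_forall fun t => (hyz t).le) hp
  refine ⟨γ, h.isSolutionOn, h0, h.tendsto_of_cluster fun p hp => ?_,
    h.tendsto_of_cluster fun p hp => ?_⟩
  · have hm := h.mem_of_cluster hp
    have he := h.edge_of_cluster hp
    have hz0 := hm.1.2.2
    obtain ⟨h1, h2⟩ := hB p hp
    have hyzp := hyz0 hp
    rcases mul_eq_zero.1 h1 with hz | h1
    · exact eq_pointWminus hm he hz (by linarith)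
    rcases mul_eq_zero.1 h1 with hy | h1
    · exact (edge_ne_zero hm he hy (by linarith)).elim
    · exact (edge_ne_zero hm he (by nlinarith) (by nlinarith)).elim
  · have hm := h.mem_of_cluster hp
    have he := h.edge_of_cluster hp
    have hz0 := hm.1.2.2
    obtain ⟨h1, h2⟩ := hT p hp
    have hyzp := hyz0 hp
    rcases mul_eq_zero.1 h1 with hz | h1
    · rw [hz, mul_zero] at h2
      exact (edge_ne_zero hm he (by linarith) hz).elim
    rcases mul_eq_zero.1 h1 with hy | h1
    · exact (edge_ne_zero hm he hy (by linarith)).elim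
    · exact eq_pointDS1 hm he (by linarith)

/-! ### The interior of the sphere -/

/-- An orbit in the interior of the physical part of the sphere. -/
structure IsInteriorOrbit (g : ℝ) (γ : ℝ → Fin 4 → ℝ) : Prop extends IsSphereOrbit g γ where
  w_pos : ∀ t, 0 < 2 * γ t 0 - γ t 1 ^ 2

namespace IsInteriorOrbit

variable {g : ℝ} {γ : ℝ → Fin 4 → ℝ} (h : IsInteriorOrbit g γ)
include h

lemma x_pos (t : ℝ) : 0 < γ t 0 := by nlinarith [h.w_pos t, sq_nonneg (γ t 1)]

lemma hasDerivAt_x3 (t : ℝ) : HasDerivAt (fun s => γ s 0 / γ s 2 ^ 2)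
    ((3 * γ t 0 * γ t 1 + 12 * γ t 0 * γ t 2
      + 2 * (1 - 3 / 2 * g) * γ t 2 * (2 * γ t 0 - γ t 1 ^ 2)) / γ t 2 ^ 2) t := by
  have hp := hasDerivAt_pi.1 (h.deriv t)
  have hz := h.z_pos t
  refine ((hp 0).div ((hp 2).pow 2) (pow_ne_zero 2 hz.ne')).congr_deriv ?_
  simp only [blowUpField, rescaledField, Matrix.cons_val, h.u_eq t, Pi.pow_apply]
  field_simp
  ring

lemma hasDerivAt_w3 (t : ℝ) : HasDerivAt (fun s => (2 * γ s 0 - γ s 1 ^ 2) / γ s 2 ^ 2)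
    (4 * (2 * γ t 0 - γ t 1 ^ 2) * (γ t 1 + (4 - 3 / 2 * g) * γ t 2) / γ t 2 ^ 2) t := by
  have hp := hasDerivAt_pi.1 (h.deriv t)
  have hz := h.z_pos t
  refine ((((hp 0).const_mul 2).sub ((hp 1).pow 2)).div ((hp 2).pow 2)
    (pow_ne_zero 2 hz.ne')).congr_deriv ?_
  simp only [blowUpField, rescaledField, Matrix.cons_val, h.u_eq t, Pi.pow_apply, Pi.sub_apply]
  field_simp
  ring

/-- Where `y ≥ 0`, the ratio `x / z²` increases, for the equations of state with `g < 2`. -/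
lemma x3_deriv_ge (hg' : g < 2) {t : ℝ} (hy : 0 ≤ γ t 1) :
    4 * γ t 0 * γ t 2 ≤ 3 * γ t 0 * γ t 1 + 12 * γ t 0 * γ t 2
      + 2 * (1 - 3 / 2 * g) * γ t 2 * (2 * γ t 0 - γ t 1 ^ 2) := by
  have hx := h.x_pos t
  have hz := h.z_pos t
  have h1 : 0 ≤ γ t 0 * γ t 1 := by positivity
  have h2 : γ t 2 * (2 * γ t 0 - γ t 1 ^ 2) ≤ γ t 2 * (2 * γ t 0) := by
    have := sq_nonneg (γ t 1)
    exact mul_le_mul_of_nonneg_left (by linarith) hz.le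
  have h3 : 0 ≤ γ t 2 * (2 * γ t 0 - γ t 1 ^ 2) := mul_nonneg hz.le (h.w_pos t).le
  nlinarith

/-- Where `y ≤ 0`, the ratio `y / √x` decreases at a rate of at least `(2x - y²) / 2`. -/
lemma y1_deriv_le_of_nonpos (hg : 2 / 3 < g) {t : ℝ} (hy : γ t 1 ≤ 0) :
    (2 * γ t 0 - γ t 1 ^ 2) / 2 ≤ (2 * γ t 0 - γ t 1 ^ 2) / (2 * √(γ t 0)) *
      (1 + 2 * (1 - 3 / 2 * g) * (γ t 1 * γ t 2 / γ t 0)) := by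
  have hx := h.x_pos t
  have hz := h.z_pos t
  have h1 := h.w_div_sqrt_ge t hx
  have h2 : 0 ≤ 2 * (1 - 3 / 2 * g) * (γ t 1 * γ t 2 / γ t 0) := by
    refine mul_nonneg_of_nonpos_of_nonpos (by linarith) ?_
    exact div_nonpos_of_nonpos_of_nonneg (mul_nonpos_of_nonpos_of_nonneg hy hz.le) hx.le
  have h3 := h.w_pos t
  nlinarith

/-- No orbit stays in `y ≥ 0`: it would approach the equator, where `y / √x` decreases, and converge
to the upper end of the range of this ratio. -/
lemma exists_y_neg (hg : 2 / 3 < g) (hg' : g < 2) : ∃ t, γ t 1 < 0 := by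
  by_contra! hy
  obtain ⟨C, hC⟩ := h.lip
  -- `z² / x` decreases, so that `x` is bounded below and `z` tends to zero
  have hx3 : Monotone fun t => γ t 0 / γ t 2 ^ 2 := by
    have := monotoneOn_of_deriv_nonneg' convex_univ
      (fun t _ => (h.hasDerivAt_x3 t).hasDerivWithinAt) (fun t _ => by
        have h1 := h.x3_deriv_ge hg' (hy t)
        have h2 := h.x_pos t
        have h3 := h.z_pos t
        exact div_nonneg (le_trans (by positivity) h1) (by positivity))
    exact fun s t hst => this (mem_univ s) (mem_univ t) hst
  set k := γ 0 0 / γ 0 2 ^ 2 with hk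
  have hk0 : 0 < k := div_pos (h.x_pos 0) (pow_pos (h.z_pos 0) 2)
  set ε := 1 / (3 + 1 / k) with hε
  have hε0 : 0 < ε := by positivity
  have hxε : ∀ t ≥ 0, ε ≤ γ t 0 := by
    intro t ht
    have h1 : k * γ t 2 ^ 2 ≤ γ t 0 := (le_div_iff₀ (pow_pos (h.z_pos t) 2)).1 (hx3 ht)
    have h2 : γ t 2 ^ 2 ≤ 1 / k * γ t 0 := by
      rw [div_mul_eq_mul_div, le_div_iff₀ hk0]; linarith
    have hx1 : γ t 0 ≤ 1 := by
      nlinarith [(h.mem t).1.1.1, sq_nonneg (γ t 1), sq_nonneg (γ t 2)]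
    have hN := (h.mem t).1.1.1
    have hw := h.w_pos t
    have hx := h.x_pos t
    rw [hε, div_le_iff₀ (by positivity)]
    nlinarith
  have hz0 : Tendsto (fun t => 4 * γ t 2 ^ 3) atTop (𝓝 0) := by
    refine tendsto_zero_comp (H := fun p : Fin 4 → ℝ => 4 * p 2 ^ 3) (a := 0) (M := 0) hC
      isCompact_sphereRegion (by fun_prop) (fun t _ => h.mem t)
      (f := fun t => -(γ t 0 / γ t 2 ^ 2)⁻¹)
      (fun t _ => ((h.hasDerivAt_x3 t).inv
        (div_pos (h.x_pos t) (pow_pos (h.z_pos t) 2)).ne').neg) (fun t _ => ?_)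
      (fun t _ => ?_) (fun t _ => ?_)
    · have h2 := h.x_pos t
      have h3 := h.z_pos t
      rw [neg_nonpos]
      positivity
    · have h3 := h.z_pos t
      positivity
    · have h1 := h.x3_deriv_ge hg' (hy t)
      have h2 := h.x_pos t
      have h3 := h.z_pos t
      have hx1 : γ t 0 ≤ 1 := by
        nlinarith [(h.mem t).1.1.1, sq_nonneg (γ t 1), sq_nonneg (γ t 2)]
      rw [neg_div, neg_neg, div_div, le_div_iff₀ (by positivity)]
      refine le_trans ?_ h1
      field_simp
      nlinarith
  obtain ⟨t₁, ht₁⟩ := ((hz0.eventually (gt_mem_nhds (by positivity : 0 < 4 * (ε / 8) ^ 3))).and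
    (eventually_ge_atTop 0)).exists_forall_of_atTop
  have hbound : ∀ t ≥ t₁, 1 / 2 ≤ 1 + 2 * (1 - 3 / 2 * g) * (γ t 1 * γ t 2 / γ t 0) := by
    intro t ht
    obtain ⟨h1, h2⟩ := ht₁ t ht
    have hz : γ t 2 < ε / 8 := by
      by_contra! hcon
      have := pow_le_pow_left₀ (by positivity) hcon 3
      linarith
    have hx := hxε t h2
    have hy1 : γ t 1 ≤ 1 := by
      nlinarith [(h.mem t).1.1.1, sq_nonneg (γ t 0), sq_nonneg (γ t 2)]
    have hyt := hy t
    have hzt := h.z_pos t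
    have hxt := h.x_pos t
    have h3 : γ t 1 * γ t 2 / γ t 0 ≤ 1 / 8 := by
      rw [div_le_iff₀ hxt]
      nlinarith
    have h4 : 0 ≤ γ t 1 * γ t 2 / γ t 0 := by positivity
    nlinarith
  have hle : ∀ t ≥ t₁, (2 * γ t 0 - γ t 1 ^ 2) / 4 ≤ (2 * γ t 0 - γ t 1 ^ 2) / (2 * √(γ t 0)) *
      (1 + 2 * (1 - 3 / 2 * g) * (γ t 1 * γ t 2 / γ t 0)) := by
    intro t ht
    have h1 := h.w_div_sqrt_ge t (h.x_pos t)
    have h2 := hbound t ht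
    have h3 := h.w_pos t
    nlinarith
  have hanti : AntitoneOn (fun t => γ t 1 / √(γ t 0)) (Ici t₁) :=
    antitoneOn_of_deriv_nonpos' (convex_Ici _)
      (fun t _ => (h.hasDerivAt_y1 t (h.x_pos t)).hasDerivWithinAt)
      (fun t ht => by have := hle t ht; have := h.w_pos t; linarith)
  obtain ⟨p, hpK, hp⟩ := isCompact_sphereRegion.exists_mapClusterPt_of_frequently
    (Eventually.of_forall h.mem : ∀ᶠ t in atTop, γ t ∈ sphereRegion).frequently
  have hpz : p 2 = 0 := by
    have hH : Continuous fun p : Fin 4 → ℝ => 4 * p 2 ^ 3 := by fun_prop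
    have h2 : MapClusterPt (4 * p 2 ^ 3) atTop ((fun p : Fin 4 → ℝ => 4 * p 2 ^ 3) ∘ γ) :=
      hp.tendsto_comp (hH.tendsto p)
    have : 4 * p 2 ^ 3 = 0 := eq_of_nhds_neBot (ClusterPt.mono h2 hz0)
    exact pow_eq_zero_iff three_ne_zero |>.1 (by linarith)
  have hpw : (2 * p 0 - p 1 ^ 2) / 4 = 0 :=
    eq_zero_of_mapClusterPt_atTop (H := fun p : Fin 4 → ℝ => (2 * p 0 - p 1 ^ 2) / 4) (a := t₁)
      (M := 0) hC isCompact_sphereRegion (by fun_prop) (fun t _ => h.mem t)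
      (fun t _ => (h.hasDerivAt_y1 t (h.x_pos t)).neg)
      (fun t _ => neg_nonpos.2 (div_nonneg (hy t) (Real.sqrt_nonneg _)))
      (fun t _ => by have := h.w_pos t; linarith)
      (fun t ht => by rw [neg_neg]; exact hle t ht) hp
  have hpy : 0 ≤ p 1 := mem_of_mapClusterPt (C := {p : Fin 4 → ℝ | 0 ≤ p 1})
    (isClosed_le continuous_const (by fun_prop)) (Eventually.of_forall hy) hp
  have hW := eq_pointWplus hpK (by linarith) hpz hpy
  have hcl : IsClosed {p : Fin 4 → ℝ | p 1 ≤ γ t₁ 1 / √(γ t₁ 0) * √(p 0)} :=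
    isClosed_le (by fun_prop) (by fun_prop)
  have h2 := mem_of_mapClusterPt hcl (by
    filter_upwards [eventually_ge_atTop t₁] with t ht
    exact (div_le_iff₀ (Real.sqrt_pos.2 (h.x_pos t))).1 (hanti self_mem_Ici ht ht)) hp
  rw [hW] at h2
  have h3 : pointWplus 1 ≤ γ t₁ 1 / √(γ t₁ 0) * √(pointWplus 0) := h2
  rw [pointWplus_y_div] at h3
  have h4 := le_of_mul_le_mul_right h3 sqrt_pointW_pos
  rw [le_div_iff₀ (Real.sqrt_pos.2 (h.x_pos t₁)), ← Real.sqrt_mul zero_le_two] at h4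
  have h5 := Real.sqrt_le_left (hy t₁) |>.1 h4
  linarith [h.w_pos t₁]

/-- Once `y ≤ 0`, the limit points lie on the vacuum edge. Either `η = y / z` stays above `-4` and
decreases, or it stays below `-4`, where it increases up to a correction by `Ω`. Both cases leave
only the limit point `η = -4`. -/
lemma tendsto_pointDS1 (hg : 2 / 3 < g) (hg' : g < 2) : Tendsto γ atTop (𝓝 pointDS1) := by
  obtain ⟨C, hC⟩ := h.lip
  obtain ⟨t₀, ht₀⟩ := h.exists_y_neg hg hg'
  have hy : ∀ t ≥ t₀, γ t 1 ≤ 0 := fun t ht => h.y_nonpos_of_le h.x_pos ht ht₀.le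
  -- limit points lie on the vacuum edge, as `y / √x` decreases
  have hw : ∀ p, MapClusterPt p atTop γ → p 1 ^ 2 = 2 * p 0 := by
    intro p hp
    have := eq_zero_of_mapClusterPt_atTop (H := fun p : Fin 4 → ℝ => (2 * p 0 - p 1 ^ 2) / 2)
      (a := t₀) (M := √2) hC isCompact_sphereRegion (by fun_prop) (fun t _ => h.mem t)
      (fun t _ => (h.hasDerivAt_y1 t (h.x_pos t)).neg)
      (fun t _ => by
        have := (abs_le.1 (abs_y_div_sqrt_le (h.mem t).1 (h.x_pos t))).1
        simp only [Pi.neg_apply]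
        linarith)
      (fun t _ => by have := h.w_pos t; linarith)
      (fun t ht => by rw [neg_neg]; exact h.y1_deriv_le_of_nonpos hg (hy t ht)) hp
    linarith
  have hbarrier : ∀ s t, s ≤ t → γ s 1 / γ s 2 + 4 ≤ 0 → γ t 1 / γ t 2 + 4 ≤ 0 := by
    intro s t hst hs
    refine nonpos_of_deriv_neg_of_eq_zero ordConnected_univ (f := fun t => γ t 1 / γ t 2 + 4)
      (fun t _ => ((h.hasDerivAt_eta t).add_const 4).hasDerivWithinAt) (fun t _ ht => ?_)
      (mem_univ s) (mem_univ t) hst hs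
    have hz := h.z_pos t
    have h1 : γ t 1 + 4 * γ t 2 = 0 := by
      have : (γ t 1 / γ t 2 + 4) * γ t 2 = 0 := by rw [ht, zero_mul]
      rwa [add_mul, div_mul_cancel₀ _ hz.ne'] at this
    rw [h1, mul_zero, mul_zero, add_zero]
    exact div_neg_of_neg_of_pos (by linarith [h.w_pos t]) hz
  by_cases hcase : ∃ t₁ ≥ t₀, γ t₁ 1 / γ t₁ 2 + 4 ≤ 0
  · obtain ⟨t₁, ht₁, h1⟩ := hcase
    have hyz : ∀ t ≥ t₁, γ t 1 + 4 * γ t 2 ≤ 0 := by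
      intro t ht
      have hz := h.z_pos t
      have := mul_nonpos_of_nonpos_of_nonneg (hbarrier t₁ t ht h1) hz.le
      rwa [add_mul, div_mul_cancel₀ _ hz.ne'] at this
    -- below `η = -4` the combination `η - w / (8 z²)` is increasing and bounded
    have hd := fun t => (h.hasDerivAt_eta t).sub ((h.hasDerivAt_w3 t).const_mul (1 / 8))
    have hle : ∀ t ≥ t₁, 3 / 2 * (γ t 1 * (γ t 1 + 4 * γ t 2)) ≤
        (-((2 * γ t 0 - γ t 1 ^ 2) / 2) + 3 / 2 * (γ t 1 * (γ t 1 + 4 * γ t 2))) / γ t 2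
        - 1 / 8 * (4 * (2 * γ t 0 - γ t 1 ^ 2) * (γ t 1 + (4 - 3 / 2 * g) * γ t 2)
          / γ t 2 ^ 2) := by
      intro t ht
      have hz := h.z_pos t
      have hwt := h.w_pos t
      have h1 := hyz t ht
      have h2 : 0 ≤ 3 / 2 * (γ t 1 * (γ t 1 + 4 * γ t 2)) :=
        mul_nonneg (by norm_num) (mul_nonneg_of_nonpos_of_nonpos (by linarith) h1)
      have hz1 : γ t 2 ≤ 1 := by nlinarith [h.yz_le_one t, sq_nonneg (γ t 1)]
      have e : (-((2 * γ t 0 - γ t 1 ^ 2) / 2) + 3 / 2 * (γ t 1 * (γ t 1 + 4 * γ t 2))) / γ t 2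
        - 1 / 8 * (4 * (2 * γ t 0 - γ t 1 ^ 2) * (γ t 1 + (4 - 3 / 2 * g) * γ t 2) / γ t 2 ^ 2)
        = 3 / 2 * (γ t 1 * (γ t 1 + 4 * γ t 2)) / γ t 2
          + (2 * γ t 0 - γ t 1 ^ 2) * -(γ t 1 + (5 - 3 / 2 * g) * γ t 2) / (2 * γ t 2 ^ 2) := by
        field_simp
        ring
      rw [e]
      have h3 : 3 / 2 * (γ t 1 * (γ t 1 + 4 * γ t 2))
          ≤ 3 / 2 * (γ t 1 * (γ t 1 + 4 * γ t 2)) / γ t 2 := by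
        rw [le_div_iff₀ hz]; nlinarith
      have h4 : 0 ≤ (2 * γ t 0 - γ t 1 ^ 2) * -(γ t 1 + (5 - 3 / 2 * g) * γ t 2)
          / (2 * γ t 2 ^ 2) := by
        refine div_nonneg (mul_nonneg hwt.le ?_) (by positivity)
        nlinarith
      linarith
    have hH0 : ∀ t ≥ t₁, 0 ≤ 3 / 2 * (γ t 1 * (γ t 1 + 4 * γ t 2)) := fun t ht => by
      have := hyz t ht
      have := h.z_pos t
      exact mul_nonneg (by norm_num) (mul_nonneg_of_nonpos_of_nonpos (by linarith) (by linarith))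
    have hw3 : ∀ t, 0 ≤ 1 / 8 * ((2 * γ t 0 - γ t 1 ^ 2) / γ t 2 ^ 2) := fun t => by
      have := h.w_pos t
      positivity
    set m := γ t₁ 1 / γ t₁ 2 - 1 / 8 * ((2 * γ t₁ 0 - γ t₁ 1 ^ 2) / γ t₁ 2 ^ 2) with hm
    have hmono := monotoneOn_of_deriv_nonneg' (convex_Ici t₁)
      (fun t _ => (hd t).hasDerivWithinAt) (fun t ht => (hH0 t ht).trans (hle t ht))
    refine h.tendsto_of_cluster fun p hp => ?_
    have hpm := h.mem_of_cluster hp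
    have hpw := hw p hp
    have h5 := eq_zero_of_mapClusterPt_atTop
      (H := fun p : Fin 4 → ℝ => 3 / 2 * (p 1 * (p 1 + 4 * p 2))) (a := t₁) (M := 0) hC
      isCompact_sphereRegion (by fun_prop) (fun t _ => h.mem t) (fun t _ => hd t)
      (fun t ht => by
        have h1 := hbarrier t₁ t ht h1
        have h2 := hw3 t
        simp only [Pi.sub_apply]
        linarith) hH0 hle hp
    have h6 : p 1 + 4 * p 2 ≤ 0 := mem_of_mapClusterPt (C := {p : Fin 4 → ℝ | p 1 + 4 * p 2 ≤ 0})
      (isClosed_le (by fun_prop) continuous_const)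
      (by filter_upwards [eventually_ge_atTop t₁] with t ht using hyz t ht) hp
    have h7 : m * p 2 ≤ p 1 := mem_of_mapClusterPt (C := {p : Fin 4 → ℝ | m * p 2 ≤ p 1})
      (isClosed_le (by fun_prop) (by fun_prop)) (by
        filter_upwards [eventually_ge_atTop t₁] with t ht
        have h2 := hmono self_mem_Ici ht ht
        have h3 := hw3 t
        simp only [Pi.sub_apply] at h2
        exact (le_div_iff₀ (h.z_pos t)).1 (by linarith)) hp
    have hz0 := hpm.1.2.2
    rcases mul_eq_zero.1 h5 with h5 | h5
    · norm_num at h5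
    rcases mul_eq_zero.1 h5 with hy | h5
    · exact (edge_ne_zero hpm hpw hy (by linarith)).elim
    · exact eq_pointDS1 hpm hpw (by linarith)
  · push Not at hcase
    have hyz : ∀ t ≥ t₀, 0 ≤ γ t 1 + 4 * γ t 2 := by
      intro t ht
      have hz := h.z_pos t
      have := mul_pos (hcase t ht) hz
      rw [add_mul, div_mul_cancel₀ _ hz.ne'] at this
      exact this.le
    have hH0 : ∀ t ≥ t₀, 0 ≤ -(3 / 2 * (γ t 2 * (γ t 1 * (γ t 1 + 4 * γ t 2)))) := fun t ht => by
      have := mul_nonneg (h.z_pos t).le (mul_nonneg (neg_nonneg.2 (hy t ht)) (hyz t ht))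
      linarith
    have hanti := antitoneOn_of_deriv_nonpos' (convex_Ici t₀)
      (fun t _ => (h.hasDerivAt_eta t).hasDerivWithinAt) (fun t ht => by
        refine div_nonpos_of_nonpos_of_nonneg ?_ (h.z_pos t).le
        have := mul_nonneg (neg_nonneg.2 (hy t ht)) (hyz t ht)
        linarith [h.w_pos t])
    refine h.tendsto_of_cluster fun p hp => ?_
    have hpm := h.mem_of_cluster hp
    have hpw := hw p hp
    have h5 := eq_zero_of_mapClusterPt_atTop
      (H := fun p : Fin 4 → ℝ => -(3 / 2 * (p 2 * (p 1 * (p 1 + 4 * p 2))))) (a := t₀)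
      (M := Real.pi / 2) hC isCompact_sphereRegion (by fun_prop) (fun t _ => h.mem t)
      (fun t _ => (h.hasDerivAt_arctan t).neg)
      (fun t _ => by
        have := Real.neg_pi_div_two_lt_arctan (γ t 1 / γ t 2)
        simp only [Pi.neg_apply]
        linarith) hH0
      (fun t ht => by
        refine (h.le_div_yz t (hH0 t ht)).trans ?_
        rw [← neg_div]
        have hz := h.z_pos t
        refine div_le_div_of_nonneg_right ?_ (by positivity)
        nlinarith [mul_pos hz (h.w_pos t)]) hp
    have h6 : 0 ≤ p 1 + 4 * p 2 := mem_of_mapClusterPt (C := {p : Fin 4 → ℝ | 0 ≤ p 1 + 4 * p 2})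
      (isClosed_le continuous_const (by fun_prop))
      (by filter_upwards [eventually_ge_atTop t₀] with t ht using hyz t ht) hp
    have h7 : p 1 ≤ γ t₀ 1 / γ t₀ 2 * p 2 :=
      mem_of_mapClusterPt (C := {p : Fin 4 → ℝ | p 1 ≤ γ t₀ 1 / γ t₀ 2 * p 2})
      (isClosed_le (by fun_prop) (by fun_prop)) (by
        filter_upwards [eventually_ge_atTop t₀] with t ht
        exact (div_le_iff₀ (h.z_pos t)).1 (hanti self_mem_Ici ht ht)) hp
    have hη : γ t₀ 1 / γ t₀ 2 < 0 := div_neg_of_neg_of_pos ht₀ (h.z_pos t₀)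
    have hz0 := hpm.1.2.2
    have h8 : p 2 * (p 1 * (p 1 + 4 * p 2)) = 0 := by linarith
    rcases mul_eq_zero.1 h8 with hz | h8
    · rw [hz] at h6 h7
      exact (edge_ne_zero hpm hpw (by linarith) hz).elim
    rcases mul_eq_zero.1 h8 with hy | h8
    · rw [hy] at h7
      exact (edge_ne_zero hpm hpw hy (by nlinarith)).elim
    · exact eq_pointDS1 hpm hpw (by linarith)

/-- If `y > 0` at some time, then `y ≥ 0` at all earlier times, and `x / z²` is monotone there.
Otherwise `y ≤ 0` at all times, and the limit points lie on the vacuum edge, where `y / √x = -√2`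
unless `x = 0`; but `y / √x` decreases with time, so that it stays away from `-√2` in the past. -/
lemma tendsto_pointR1 (hg : 2 / 3 < g) (hg' : g < 2) : Tendsto γ atBot (𝓝 pointR1) := by
  obtain ⟨C, hC⟩ := h.lip
  refine h.tendsto_of_cluster fun p hp => eq_pointR1 (h.mem_of_cluster hp) ?_
  by_cases hcase : ∃ t₀, 0 < γ t₀ 1
  · obtain ⟨t₀, ht₀⟩ := hcase
    have hy : ∀ t ≤ t₀, 0 ≤ γ t 1 := by
      intro t ht
      by_contra! hcon
      exact absurd (h.y_nonpos_of_le h.x_pos ht hcon.le) (not_le.2 ht₀)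
    have := eq_zero_of_mapClusterPt_atBot (H := fun p : Fin 4 → ℝ => 4 * p 0) (a := t₀) (M := 0) hC
      isCompact_sphereRegion (by fun_prop) (fun t _ => h.mem t) (fun t _ => h.hasDerivAt_x3 t)
      (fun t _ => div_nonneg (h.x_pos t).le (sq_nonneg _))
      (fun t _ => by have := h.x_pos t; linarith)
      (fun t ht => by
        have h1 := h.x3_deriv_ge hg' (hy t ht)
        have hx := h.x_pos t
        have hz := h.z_pos t
        have hz1 : γ t 2 ≤ 1 := by nlinarith [h.yz_le_one t, sq_nonneg (γ t 1)]
        rw [le_div_iff₀ (by positivity)]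
        refine le_trans ?_ h1
        nlinarith [mul_pos hx hz]) hp
    linarith
  · push Not at hcase
    have h1 := eq_zero_of_mapClusterPt_atBot (H := fun p : Fin 4 → ℝ => (2 * p 0 - p 1 ^ 2) / 2)
      (a := 0) (M := 0) hC isCompact_sphereRegion (by fun_prop) (fun t _ => h.mem t)
      (fun t _ => (h.hasDerivAt_y1 t (h.x_pos t)).neg)
      (fun t _ => neg_nonneg.2 (div_nonpos_of_nonpos_of_nonneg (hcase t) (Real.sqrt_nonneg _)))
      (fun t _ => by have := h.w_pos t; linarith)
      (fun t _ => by rw [neg_neg]; exact h.y1_deriv_le_of_nonpos hg (hcase t)) hp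
    have hanti := antitoneOn_of_deriv_nonpos' convex_univ
      (fun t _ => (h.hasDerivAt_y1 t (h.x_pos t)).hasDerivWithinAt) (fun t _ => by
        have h1 := h.y1_deriv_le_of_nonpos hg (hcase t)
        have := h.w_pos t
        linarith)
    set r := γ 0 1 / √(γ 0 0) with hr
    have hr2 : r ^ 2 < 2 := by
      rw [hr, div_pow, Real.sq_sqrt (h.x_pos 0).le, div_lt_iff₀ (h.x_pos 0)]
      linarith [h.w_pos 0]
    have hcl : IsClosed {p : Fin 4 → ℝ | p 1 ^ 2 ≤ r ^ 2 * p 0} :=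
      isClosed_le (by fun_prop) (by fun_prop)
    have h7 : p 1 ^ 2 ≤ r ^ 2 * p 0 := mem_of_mapClusterPt hcl (by
        filter_upwards [eventually_le_atBot 0] with t ht
        have h2 := hanti (mem_univ t) (mem_univ 0) ht
        have h3 : r * √(γ t 0) ≤ γ t 1 := (le_div_iff₀ (Real.sqrt_pos.2 (h.x_pos t))).1 h2
        have h4 := hcase t
        have h5 := Real.sq_sqrt (h.x_pos t).le
        change γ t 1 ^ 2 ≤ r ^ 2 * γ t 0
        rw [← h5, ← mul_pow]
        nlinarith) hp
    have hx := blowUpRegion_x_nonneg (h.mem_of_cluster hp).1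
    nlinarith

end IsInteriorOrbit

lemma connects_interior {g : ℝ} (hg : 2 / 3 < g) (hg' : g < 2) {q : Fin 4 → ℝ}
    (hq : q ∈ sphereRegion) (hz : 0 < q 2) (hw : q 1 ^ 2 < 2 * q 0) :
    Connects (blowUpField g) pointR1 pointDS1 q := by
  obtain ⟨γ, h0, h, hw'⟩ := exists_sphereOrbit g hq hz
  have hi : IsInteriorOrbit g γ := ⟨h, fun t => by
    obtain ⟨k, hk, e⟩ := hw' t
    rw [e]
    exact mul_pos hk (by linarith)⟩
  exact ⟨γ, h.isSolutionOn, h0, hi.tendsto_pointR1 hg hg', hi.tendsto_pointDS1 hg hg'⟩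

/-! ### Exponentially attracting sets -/

section
variable {E : Type*} [NormedAddCommGroup E] [NormedSpace ℝ E]

lemma norm_sub_le_of_exp_deriv {f f' : ℝ → E} {C μ s t : ℝ} (hμ : 0 < μ) (hst : s ≤ t)
    (hf : ∀ τ ∈ Icc s t, HasDerivAt f (f' τ) τ)
    (hle : ∀ τ ∈ Icc s t, ‖f' τ‖ ≤ C * Real.exp (-(μ * τ))) :
    ‖f t - f s‖ ≤ C / μ * (Real.exp (-(μ * s)) - Real.exp (-(μ * t))) := by
  refine image_norm_le_of_norm_deriv_right_le_deriv_boundary (f := fun τ => f τ - f s) (f' := f')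
    (a := s) (b := t) (B := fun τ => C / μ * (Real.exp (-(μ * s)) - Real.exp (-(μ * τ))))
    (B' := fun τ => C * Real.exp (-(μ * τ)))
    (fun τ hτ => ((hf τ hτ).sub_const _).continuousAt.continuousWithinAt)
    (fun τ hτ => ((hf τ (Ico_subset_Icc_self hτ)).sub_const _).hasDerivWithinAt) (by simp)
    (fun τ => ?_) (fun τ hτ => hle τ (Ico_subset_Icc_self hτ)) (right_mem_Icc.2 hst)
  refine (((((hasDerivAt_id τ).const_mul μ).neg.exp).const_sub _).const_mul (C / μ)).congr_deriv ?_
  simp only [id, mul_one, Pi.neg_apply]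
  field_simp

lemma exists_tendsto_of_exp_deriv [CompleteSpace E] {f f' : ℝ → E} {C μ : ℝ} (hμ : 0 < μ)
    (hf : ∀ t ≥ 0, HasDerivAt f (f' t) t)
    (hle : ∀ t ≥ 0, ‖f' t‖ ≤ C * Real.exp (-(μ * t))) : ∃ e, Tendsto f atTop (𝓝 e) := by
  have hC : 0 ≤ C := by simpa using (norm_nonneg _).trans (hle 0 le_rfl)
  have hcs : CauchySeq fun t => f (max t 0) := by
    refine cauchySeq_of_le_tendsto_0' (fun t => C / μ * Real.exp (-(μ * max t 0)))
      (fun s t hst => ?_) ?_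
    · rw [dist_comm, dist_eq_norm]
      have h0 : 0 ≤ max s 0 := le_max_right _ _
      have := norm_sub_le_of_exp_deriv hμ (max_le_max_right 0 hst)
        (fun τ hτ => hf τ (h0.trans hτ.1)) (fun τ hτ => hle τ (h0.trans hτ.1))
      refine this.trans (mul_le_mul_of_nonneg_left ?_ (by positivity))
      linarith [Real.exp_pos (-(μ * max t 0))]
    · have h1 : Tendsto (fun t : ℝ => μ * max t 0) atTop atTop :=
        (tendsto_atTop_mono (fun t => le_max_left t 0) tendsto_id).const_mul_atTop hμ
      simpa using (Real.tendsto_exp_neg_atTop_nhds_zero.comp h1).const_mul (C / μ)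
  obtain ⟨e, he⟩ := cauchySeq_tendsto_of_complete hcs
  refine ⟨e, he.congr' ?_⟩
  filter_upwards [eventually_ge_atTop 0] with t ht
  rw [max_eq_left ht]

/-- A curve that starts close to `p`, whose speed is controlled by the square root of a function `F`
that decays exponentially near `p`, stays close to `p` and converges if `F` is small initially. -/
theorem converges_of_lyapunov [CompleteSpace E] {γ γ' : ℝ → E} {F F' : ℝ → ℝ} {p : E} {δ l M : ℝ}
    (hl : 0 < l) (hM : 0 ≤ M)
    (hγ : ∀ t, HasDerivAt γ (γ' t) t) (hF0 : ∀ t, 0 ≤ F t)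
    (h : ∀ t, γ t ∈ Metric.closedBall p δ →
      HasDerivAt F (F' t) t ∧ F' t ≤ -l * F t ∧ ‖γ' t‖ ≤ M * √(F t))
    (h0 : dist (γ 0) p < δ / 2) (hs : M * √(F 0) / (l / 2) < δ / 2) :
    (∀ t ≥ 0, γ t ∈ Metric.closedBall p δ) ∧
    (∀ t ≥ 0, √(F t) ≤ √(F 0) * Real.exp (-(l / 2 * t))) ∧ ∃ e, Tendsto γ atTop (𝓝 e) := by
  have hc : Continuous γ := continuous_iff_continuousAt.2 fun t => (hγ t).continuousAt
  have hdecay : ∀ T, (∀ t ∈ Icc 0 T, γ t ∈ Metric.closedBall p δ) →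
      ∀ t ∈ Icc 0 T, √(F t) ≤ √(F 0) * Real.exp (-(l / 2 * t)) := by
    intro T hT t ht
    have hanti := antitoneOn_of_deriv_nonpos' (convex_Icc 0 T)
      (fun t ht => ((h t (hT t ht)).1.mul ((hasDerivAt_id t).const_mul l).exp).hasDerivWithinAt)
      (fun t ht => by
        have := (h t (hT t ht)).2.1
        simp only [id, mul_one]
        have h2 := mul_le_mul_of_nonneg_right this (Real.exp_pos (l * t)).le
        linarith)
    have h1 := hanti ⟨le_rfl, ht.1.trans ht.2⟩ ht ht.1
    simp only [Pi.mul_apply, id, mul_zero, Real.exp_zero, mul_one] at h1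
    have h2 : F t ≤ F 0 * Real.exp (-(l * t)) := by
      rw [Real.exp_neg, ← div_eq_mul_inv, le_div_iff₀ (Real.exp_pos _)]
      exact h1
    have h3 : -(l / 2 * t) = -(l * t) / 2 := by ring
    rw [h3, Real.exp_half, ← Real.sqrt_mul (hF0 0)]
    exact Real.sqrt_le_sqrt h2
  have hspeed : ∀ T, (∀ t ∈ Icc 0 T, γ t ∈ Metric.closedBall p δ) →
      ∀ t ∈ Icc 0 T, ‖γ' t‖ ≤ M * √(F 0) * Real.exp (-(l / 2 * t)) := by
    intro T hT t ht
    have := mul_le_mul_of_nonneg_left (hdecay T hT t ht) hM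
    linarith [(h t (hT t ht)).2.2]
  have hball : ∀ t ≥ 0, γ t ∈ Metric.closedBall p δ := by
    by_contra! hcon
    obtain ⟨t₁, ht₁, hout⟩ := hcon
    rw [Metric.mem_closedBall, not_le] at hout
    -- the first time at which the distance `δ` is reached
    have hcl : IsClosed {t | δ ≤ dist (γ t) p} := isClosed_le continuous_const (by fun_prop)
    obtain ⟨T, ⟨hTI, hTd⟩, hTmin⟩ := (isCompact_Icc.inter_right hcl).exists_isLeast
      (⟨t₁, ⟨ht₁, le_rfl⟩, hout.le⟩ : (Icc 0 t₁ ∩ {t | δ ≤ dist (γ t) p}).Nonempty)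
    have hlt : ∀ t ∈ Ico 0 T, dist (γ t) p < δ := by
      intro t ht
      by_contra! hge
      exact absurd (hTmin ⟨⟨ht.1, ht.2.le.trans hTI.2⟩, hge⟩) (not_le.2 ht.2)
    have hδ : 0 < δ := by linarith [dist_nonneg (x := γ 0) (y := p)]
    have hT0 : 0 < T := by
      refine lt_of_le_of_ne hTI.1 fun e => ?_
      rw [← e] at hTd
      have : δ ≤ dist (γ 0) p := hTd
      linarith
    have hcl' : IsClosed {t | dist (γ t) p ≤ δ} := isClosed_le (by fun_prop) continuous_const
    have hle : ∀ t ∈ Icc 0 T, γ t ∈ Metric.closedBall p δ := by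
      have h1 : closure (Ico 0 T) ⊆ {t | dist (γ t) p ≤ δ} :=
        closure_minimal (fun t ht => (hlt t ht).le) hcl'
      rw [closure_Ico hT0.ne] at h1
      exact h1
    have h1 := norm_sub_le_of_exp_deriv (by linarith : 0 < l / 2) hTI.1 (fun t _ => hγ t)
      (hspeed T hle)
    have h2 : M * √(F 0) / (l / 2) * (Real.exp (-(l / 2 * 0)) - Real.exp (-(l / 2 * T)))
        ≤ M * √(F 0) / (l / 2) := by
      refine mul_le_of_le_one_right (by positivity) ?_
      rw [mul_zero, neg_zero, Real.exp_zero]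
      linarith [Real.exp_pos (-(l / 2 * T))]
    have h3 := dist_triangle (γ T) (γ 0) p
    rw [dist_eq_norm (γ T) (γ 0)] at h3
    have h4 : δ ≤ dist (γ T) p := hTd
    linarith
  exact ⟨hball, fun t ht => hdecay t (fun s hs => hball s hs.1) t ⟨ht, le_rfl⟩,
    exists_tendsto_of_exp_deriv (by linarith : 0 < l / 2) (fun t _ => hγ t)
      fun t ht => hspeed t (fun s hs => hball s hs.1) t ⟨ht, le_rfl⟩⟩

end

/-! ### Attraction to the line of de Sitter points -/

/-- The logarithmic rate of `u` for the field `r`. -/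
noncomputable def radialPart (q : Fin 4 → ℝ) (r : Fin 3 → ℝ) : ℝ :=
  (q 0 * r 0 + q 1 * r 1 + q 2 * r 2) / (2 * q 0 ^ 2 + q 1 ^ 2 + q 2 ^ 2)

/-- The field tangent to the blow-up space that has the same image as `r` under the differential of
the blow-up map. -/
noncomputable def tangentField (q : Fin 4 → ℝ) (r : Fin 3 → ℝ) : Fin 4 → ℝ :=
  ![r 0 - 2 * radialPart q r * q 0, r 1 - radialPart q r * q 1, r 2 - radialPart q r * q 2,
    radialPart q r * q 3]

lemma blowUpField_eq_tangentField (g : ℝ) (q : Fin 4 → ℝ) :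
    blowUpField g q = tangentField q (rescaledField g q) := rfl

lemma radialPart_add_smul (q : Fin 4 → ℝ) (a b : ℝ) (r s : Fin 3 → ℝ) :
    radialPart q (a • r + b • s) = a * radialPart q r + b * radialPart q s := by
  simp only [radialPart, Pi.add_apply, Pi.smul_apply, smul_eq_mul]
  ring

lemma tangentField_add_smul (q : Fin 4 → ℝ) (a b : ℝ) (r s : Fin 3 → ℝ) :
    tangentField q (a • r + b • s) = a • tangentField q r + b • tangentField q s := by
  ext i
  fin_cases i <;>
    simp [tangentField, radialPart_add_smul] <;> ring

/-- The coefficient of `deSitterRed` in the rescaled field. -/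
noncomputable def deSitterCoeff (q : Fin 4 → ℝ) : Fin 3 → ℝ :=
  ![q 0, q 1 * (1 - q 3 ^ 2 * q 0) / (2 - q 3 ^ 2 * q 0), -q 2]

/-- The coefficient of `omegaRed` in the rescaled field. -/
noncomputable def omegaCoeff (g : ℝ) (q : Fin 4 → ℝ) : Fin 3 → ℝ :=
  ![(1 - 3 / 2 * g) * q 2 * (2 - q 3 ^ 2 * q 0),
    -(1 / (2 - q 3 ^ 2 * q 0)) - (1 - 3 / 2 * g) * q 1 * q 2 * q 3 ^ 2,
    (1 - 3 / 2 * g) * q 2 ^ 2 * q 3 ^ 2]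

/-- The field vanishes to first order on the line of de Sitter points, which is the common zero set
of `deSitterRed` and `omegaRed`. -/
lemma rescaledField_eq_add (g : ℝ) {q : Fin 4 → ℝ} (hq : 2 - q 3 ^ 2 * q 0 ≠ 0) :
    rescaledField g q = deSitterRed q • deSitterCoeff q + omegaRed q • omegaCoeff g q := by
  have hi := inv_mul_cancel₀ hq
  ext i
  fin_cases i
  · simp [rescaledField, deSitterRed, omegaRed, deSitterCoeff, omegaCoeff]
    ring
  · simp only [rescaledField, deSitterRed, omegaRed, deSitterCoeff, omegaCoeff, Pi.add_apply,
      Pi.smul_apply, smul_eq_mul, Matrix.cons_val, Fin.mk_one, div_eq_mul_inv]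
    linear_combination (q 0 - q 1 ^ 2
      - q 1 * q 2 * (1 - q 3 ^ 2 * q 0) * (2 - q 3 ^ 2 * q 0)) * hi
  · simp [rescaledField, deSitterRed, omegaRed, deSitterCoeff, omegaCoeff]
    ring

lemma radialRate_eq_add (g : ℝ) {q : Fin 4 → ℝ} (hq : 2 - q 3 ^ 2 * q 0 ≠ 0) :
    radialRate g q = deSitterRed q * radialPart q (deSitterCoeff q)
      + omegaRed q * radialPart q (omegaCoeff g q) := by
  rw [← radialPart_add_smul, ← rescaledField_eq_add g hq]
  rfl

lemma blowUpField_eq_add (g : ℝ) {q : Fin 4 → ℝ} (hq : 2 - q 3 ^ 2 * q 0 ≠ 0) :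
    blowUpField g q = deSitterRed q • tangentField q (deSitterCoeff q)
      + omegaRed q • tangentField q (omegaCoeff g q) := by
  rw [← tangentField_add_smul, ← rescaledField_eq_add g hq, blowUpField_eq_tangentField]

/-- The coefficient of `deSitterRed` in its derivative along the desingularised field. -/
noncomputable def deSitterRate (g : ℝ) (q : Fin 4 → ℝ) : ℝ :=
  q 1 * (1 - q 3 ^ 2 * q 0) / (2 - q 3 ^ 2 * q 0) - q 2 * (2 - q 3 ^ 2 * q 0) ^ 2
    - 2 * q 2 * (2 - q 3 ^ 2 * q 0) * (q 3 ^ 2 * q 0)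
    - (1 - 3 / 2 * g) * q 2 * q 3 ^ 2 * omegaRed q - radialRate g q

lemma hasDerivAt_deSitterRed {g κ t : ℝ} {γ : ℝ → Fin 4 → ℝ}
    (h : HasDerivAt γ (κ • blowUpField g (γ t)) t) (hq : 2 - γ t 3 ^ 2 * γ t 0 ≠ 0) :
    HasDerivAt (fun s => deSitterRed (γ s))
      (κ * (deSitterRate g (γ t) * deSitterRed (γ t)
        - 1 / (2 - γ t 3 ^ 2 * γ t 0) * omegaRed (γ t))) t := by
  have hp := hasDerivAt_pi.1 h
  refine ((hp 1).add ((hp 2).mul (((((hp 3).pow 2).mul (hp 0)).const_sub 2).pow 2))).congr_deriv ?_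
  simp only [Pi.pow_apply, Pi.mul_apply, Pi.smul_apply, smul_eq_mul, deSitterRed, deSitterRate,
    omegaRed, blowUpField, rescaledField, Matrix.cons_val, div_eq_mul_inv]
  linear_combination (κ * (γ t 0 - γ t 1 ^ 2 - γ t 1 * γ t 2 * (1 - γ t 3 ^ 2 * γ t 0)
    * (2 - γ t 3 ^ 2 * γ t 0))) * inv_mul_cancel₀ hq

lemma omegaRed_pointDS1 : omegaRed pointDS1 = 0 := by
  simp [omegaRed, pointDS1]; ring

lemma deSitterRed_pointDS1 : deSitterRed pointDS1 = 0 := by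
  simp [deSitterRed, pointDS1]; ring

lemma radialRate_pointDS1 (g : ℝ) : radialRate g pointDS1 = 0 := by
  rw [radialRate_eq_add g (by simp [pointDS1]), omegaRed_pointDS1, deSitterRed_pointDS1]
  ring

lemma omegaRate_pointDS1 (g : ℝ) : omegaRate g pointDS1 = -6 * g * heightDS1 := by
  rw [omegaRate, radialRate_pointDS1]
  simp [pointDS1]; ring

lemma deSitterRate_pointDS1 (g : ℝ) : deSitterRate g pointDS1 = -6 * heightDS1 := by
  rw [deSitterRate, radialRate_pointDS1, omegaRed_pointDS1]
  simp [pointDS1]; ring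

lemma continuousAt_radialPart {r : (Fin 4 → ℝ) → Fin 3 → ℝ} {p : Fin 4 → ℝ}
    (hr : ContinuousAt r p) (hp : 2 * p 0 ^ 2 + p 1 ^ 2 + p 2 ^ 2 ≠ 0) :
    ContinuousAt (fun q => radialPart q (r q)) p := by
  have h := continuousAt_pi.1 hr
  have hc := fun i : Fin 4 => (continuous_apply i).continuousAt (x := p)
  exact ((((hc 0).mul (h 0)).add ((hc 1).mul (h 1))).add ((hc 2).mul (h 2))).div (by fun_prop) hp

lemma continuousAt_tangentField {r : (Fin 4 → ℝ) → Fin 3 → ℝ} {p : Fin 4 → ℝ}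
    (hr : ContinuousAt r p) (hp : 2 * p 0 ^ 2 + p 1 ^ 2 + p 2 ^ 2 ≠ 0) :
    ContinuousAt (fun q => tangentField q (r q)) p := by
  have h := continuousAt_pi.1 hr
  have hc := fun i : Fin 4 => (continuous_apply i).continuousAt (x := p)
  have hρ := continuousAt_radialPart hr hp
  refine continuousAt_pi.2 fun i => ?_
  fin_cases i
  · exact (h 0).sub ((hρ.const_mul 2).mul (hc 0))
  · exact (h 1).sub (hρ.mul (hc 1))
  · exact (h 2).sub (hρ.mul (hc 2))
  · exact hρ.mul (hc 3)

lemma continuousAt_deSitterCoeff {p : Fin 4 → ℝ} (hp : 2 - p 3 ^ 2 * p 0 ≠ 0) :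
    ContinuousAt deSitterCoeff p := by
  have hc := fun i : Fin 4 => (continuous_apply i).continuousAt (x := p)
  refine continuousAt_pi.2 fun i => ?_
  fin_cases i
  · exact hc 0
  · exact ((hc 1).mul ((((hc 3).pow 2).mul (hc 0)).const_sub 1)).div (by fun_prop) hp
  · exact (hc 2).neg

lemma continuousAt_omegaCoeff (g : ℝ) {p : Fin 4 → ℝ} (hp : 2 - p 3 ^ 2 * p 0 ≠ 0) :
    ContinuousAt (omegaCoeff g) p := by
  refine continuousAt_pi.2 fun i => ?_
  fin_cases i <;>
    simp only [omegaCoeff, Matrix.cons_val, Fin.reduceFinMk, Fin.zero_eta, Fin.mk_one] <;>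
    fun_prop (disch := assumption)

/-- A quadratic measure of the deviation from the line of de Sitter points. The weight of `omegaRed`
absorbs the cross term in the derivative. -/
noncomputable def deSitterEnergy (q : Fin 4 → ℝ) : ℝ :=
  deSitterRed q ^ 2 + omegaRed q ^ 2 / heightDS1 ^ 2

lemma deSitterEnergy_nonneg (q : Fin 4 → ℝ) : 0 ≤ deSitterEnergy q := by
  unfold deSitterEnergy; positivity

lemma continuous_deSitterEnergy : Continuous deSitterEnergy := by
  have := continuous_omegaRed
  have := continuous_deSitterRed
  unfold deSitterEnergy
  fun_prop

lemma abs_deSitterRed_le (q : Fin 4 → ℝ) : |deSitterRed q| ≤ √(deSitterEnergy q) := by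
  refine Real.abs_le_sqrt ?_
  unfold deSitterEnergy
  linarith [show 0 ≤ omegaRed q ^ 2 / heightDS1 ^ 2 by positivity]

lemma abs_omegaRed_le (q : Fin 4 → ℝ) : |omegaRed q| ≤ heightDS1 * √(deSitterEnergy q) := by
  have hv := heightDS1_pos
  rw [← Real.sqrt_sq hv.le, ← Real.sqrt_mul (by positivity)]
  refine Real.abs_le_sqrt ?_
  rw [deSitterEnergy, mul_add, mul_div_cancel₀ _ (by positivity)]
  have := mul_nonneg (sq_nonneg heightDS1) (sq_nonneg (deSitterRed q))
  linarith

/-- A ball around `dS₁` on which the transversal linearisation dominates. -/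
lemma exists_ball_pointDS1 {g : ℝ} (hg : 2 / 3 < g) :
    ∃ δ > 0, ∃ M > 0, ∀ q ∈ Metric.closedBall pointDS1 δ,
      2 * q 0 ^ 2 + q 1 ^ 2 + q 2 ^ 2 ≠ 0 ∧ q 3 ^ 2 * q 0 < 1 ∧
      omegaRate g q ≤ -heightDS1 ∧ deSitterRate g q ≤ -heightDS1 ∧
      ‖blowUpField g q‖ ≤ M * √(deSitterEnergy q) ∧
      |radialRate g q| ≤ M * √(deSitterEnergy q) := by
  have hv := heightDS1_pos
  have hN := pointDS1_mem.1.1.1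
  have hden := (denom_pos hN).ne'
  have ha : 2 - pointDS1 3 ^ 2 * pointDS1 0 ≠ 0 := by simp [pointDS1]
  have hρ := continuousAt_radialRate g hN
  have hw := continuous_omegaRed.continuousAt (x := pointDS1)
  have e1 : ∀ᶠ q in 𝓝 pointDS1, 2 * q 0 ^ 2 + q 1 ^ 2 + q 2 ^ 2 ≠ 0 :=
    ContinuousAt.eventually_ne (g := fun q : Fin 4 → ℝ => 2 * q 0 ^ 2 + q 1 ^ 2 + q 2 ^ 2)
      (by fun_prop) hden
  have e2 : ∀ᶠ q in 𝓝 pointDS1, q 3 ^ 2 * q 0 < 1 :=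
    ContinuousAt.eventually_lt (f := fun q : Fin 4 → ℝ => q 3 ^ 2 * q 0) (g := fun _ => 1)
      (by fun_prop) (by fun_prop) (by simp [pointDS1])
  have e3 : ∀ᶠ q in 𝓝 pointDS1, omegaRate g q < -heightDS1 :=
    ContinuousAt.eventually_lt (g := fun _ => -heightDS1) (by unfold omegaRate; fun_prop)
      (by fun_prop) (by rw [omegaRate_pointDS1]; nlinarith)
  have e4 : ∀ᶠ q in 𝓝 pointDS1, deSitterRate g q < -heightDS1 :=
    ContinuousAt.eventually_lt (g := fun _ => -heightDS1)
      (by unfold deSitterRate; fun_prop (disch := assumption))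
      (by fun_prop) (by rw [deSitterRate_pointDS1]; nlinarith)
  have bd : ∀ f : (Fin 4 → ℝ) → ℝ, ContinuousAt f pointDS1 →
      ∀ᶠ q in 𝓝 pointDS1, f q < f pointDS1 + 1 := fun f hf =>
    hf.eventually_lt (g := fun _ => f pointDS1 + 1) continuousAt_const (by linarith)
  have e5 := bd _ (continuousAt_tangentField (continuousAt_deSitterCoeff ha) hden).norm
  have e6 := bd _ (continuousAt_tangentField (continuousAt_omegaCoeff g ha) hden).norm
  have e7 := bd _ (continuousAt_radialPart (continuousAt_deSitterCoeff ha) hden).abs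
  have e8 := bd _ (continuousAt_radialPart (continuousAt_omegaCoeff g ha) hden).abs
  set m₁ := ‖tangentField pointDS1 (deSitterCoeff pointDS1)‖ + 1
  set m₂ := ‖tangentField pointDS1 (omegaCoeff g pointDS1)‖ + 1
  set m₃ := |radialPart pointDS1 (deSitterCoeff pointDS1)| + 1
  set m₄ := |radialPart pointDS1 (omegaCoeff g pointDS1)| + 1
  have h1 : 0 < m₁ := by positivity
  have h2 : 0 < m₂ := by positivity
  have h3 : 0 < m₃ := by positivity
  have h4 : 0 < m₄ := by positivity
  obtain ⟨δ, hδ, h⟩ := Metric.nhds_basis_closedBall.eventually_iff.1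
    (e1.and (e2.and (e3.and (e4.and (e5.and (e6.and (e7.and e8)))))))
  refine ⟨δ, hδ, (m₁ + m₂ * heightDS1) + (m₃ + m₄ * heightDS1), by positivity, fun q hq => ?_⟩
  obtain ⟨f1, f2, f3, f4, f5, f6, f7, f8⟩ := h hq
  have hD := abs_deSitterRed_le q
  have hW := abs_omegaRed_le q
  have hs := Real.sqrt_nonneg (deSitterEnergy q)
  set s := √(deSitterEnergy q)
  have ha' : 2 - q 3 ^ 2 * q 0 ≠ 0 := by linarith
  refine ⟨f1, f2, f3.le, f4.le, ?_, ?_⟩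
  · rw [blowUpField_eq_add g ha']
    refine (norm_add_le _ _).trans ?_
    rw [norm_smul, norm_smul, Real.norm_eq_abs, Real.norm_eq_abs]
    have k1 := mul_le_mul hD f5.le (norm_nonneg _) hs
    have k2 := mul_le_mul hW f6.le (norm_nonneg _) (by positivity)
    have k3 : 0 ≤ (m₃ + m₄ * heightDS1) * s := by positivity
    linarith
  · rw [radialRate_eq_add g ha']
    refine (abs_add_le _ _).trans ?_
    rw [abs_mul, abs_mul]
    have k1 := mul_le_mul hD f7.le (abs_nonneg _) hs
    have k2 := mul_le_mul hW f8.le (abs_nonneg _) (by positivity)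
    have k3 : 0 ≤ (m₁ + m₂ * heightDS1) * s := by positivity
    linarith

lemma energy_deriv_le {l D w A B W : ℝ} (hl : 0 < l) (hA : A ≤ -l) (hW : W ≤ -l) (hB : |B| ≤ 1) :
    2 * D * (A * D - B * w) + 2 * w * (W * w) / l ^ 2 ≤ -l * (D ^ 2 + w ^ 2 / l ^ 2) := by
  obtain ⟨v, rfl⟩ : ∃ v, w = l * v := ⟨w / l, by field_simp⟩
  have e1 : 2 * (l * v) * (W * (l * v)) / l ^ 2 = 2 * W * v ^ 2 := by field_simp
  have e2 : (l * v) ^ 2 / l ^ 2 = v ^ 2 := by field_simp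
  rw [e1, e2]
  have h1 : -(2 * D * (B * (l * v))) ≤ l * (D ^ 2 + v ^ 2) := by
    have h2 : |2 * D * v * B| ≤ D ^ 2 + v ^ 2 := by
      rw [abs_mul]
      refine (mul_le_of_le_one_right (abs_nonneg _) hB).trans (abs_le.2 ⟨?_, ?_⟩)
      · nlinarith [sq_nonneg (D + v)]
      · nlinarith [sq_nonneg (D - v)]
    nlinarith [(abs_le.1 h2).1]
  nlinarith [sq_nonneg D, sq_nonneg v]

theorem attracting_pointDS1 {g : ℝ} (hg : 2 / 3 < g) :
    ∃ U ∈ 𝓝 pointDS1, ∀ q ∈ U ∩ blowUpRegion, ∃ γ : ℝ → Fin 4 → ℝ,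
      IsSolutionOn (blowUpField g) (Ici 0) γ ∧ γ 0 = q ∧
      (∀ t ∈ Ici (0 : ℝ), γ t ∈ blowUpRegion) ∧
      ∃ e : Fin 4 → ℝ, Tendsto γ atTop (𝓝 e) ∧ (q 3 = 0 → e = pointDS1) ∧
        (0 < q 3 → e ∈ liftedLineDS) := by
  have hv := heightDS1_pos
  obtain ⟨δ, hδ, M, hM, hball⟩ := exists_ball_pointDS1 hg
  refine ⟨{q | dist q pointDS1 < δ / 2 ∧ M * √(deSitterEnergy q) / (heightDS1 / 2) < δ / 2},
    ?_, ?_⟩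
  · have hcE := continuous_deSitterEnergy
    have h1 : Continuous fun q => M * √(deSitterEnergy q) / (heightDS1 / 2) := by fun_prop
    have h2 : Continuous fun q => dist q pointDS1 := by fun_prop
    refine ((isOpen_lt h2 continuous_const).inter (isOpen_lt h1 continuous_const)).mem_nhds
      ⟨?_, ?_⟩
    · simpa using hδ
    · simpa [deSitterEnergy, omegaRed_pointDS1, deSitterRed_pointDS1] using hδ
  rintro q ⟨⟨hq1, hq2⟩, hq⟩
  have hO : IsOpen {q : Fin 4 → ℝ | 2 * q 0 ^ 2 + q 1 ^ 2 + q 2 ^ 2 ≠ 0} :=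
    isOpen_ne_fun (by fun_prop) continuous_const
  obtain ⟨χ, hχ, hχ1, γ, hγ0, hγ⟩ := exists_global_solution_cutoff hO (contDiffOn_blowUpField g)
    (isCompact_closedBall pointDS1 δ) (fun p hp => (hball p hp).1) q
  have hinv := blowUpRegion_invariant hχ hγ (by rwa [hγ0])
  have hlyap : ∀ t, γ t ∈ Metric.closedBall pointDS1 δ →
      HasDerivAt (fun s => deSitterEnergy (γ s))
        (2 * deSitterRed (γ t) * (deSitterRate g (γ t) * deSitterRed (γ t)
          - 1 / (2 - γ t 3 ^ 2 * γ t 0) * omegaRed (γ t))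
          + 2 * omegaRed (γ t) * (omegaRate g (γ t) * omegaRed (γ t)) / heightDS1 ^ 2) t ∧
      2 * deSitterRed (γ t) * (deSitterRate g (γ t) * deSitterRed (γ t)
          - 1 / (2 - γ t 3 ^ 2 * γ t 0) * omegaRed (γ t))
          + 2 * omegaRed (γ t) * (omegaRate g (γ t) * omegaRed (γ t)) / heightDS1 ^ 2
        ≤ -heightDS1 * deSitterEnergy (γ t) ∧
      ‖χ (γ t) • blowUpField g (γ t)‖ ≤ M * √(deSitterEnergy (γ t)) := by
    intro t ht
    obtain ⟨-, h2, h3, h4, h5, -⟩ := hball _ ht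
    have hχt := hχ1 _ ht
    refine ⟨?_, energy_deriv_le hv h4 h3 ?_, by rwa [hχt, one_smul]⟩
    · refine (((hasDerivAt_deSitterRed (hγ t) (by linarith)).pow 2).add
        (((hasDerivAt_omegaRed (hγ t)).pow 2).div_const _)).congr_deriv ?_
      rw [hχt]
      push_cast
      ring
    · rw [abs_of_pos (one_div_pos.2 (by linarith)), div_le_one (by linarith)]
      linarith
  obtain ⟨hin, hdecay, e, he⟩ := converges_of_lyapunov (p := pointDS1) (δ := δ) hv hM.le hγ
    (fun t => deSitterEnergy_nonneg (γ t)) hlyap (by rwa [hγ0]) (by rwa [hγ0])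
  have heR : e ∈ blowUpRegion := isClosed_blowUpRegion.mem_of_tendsto he
    (Eventually.of_forall fun t => (hinv t).1)
  have heB : e ∈ Metric.closedBall pointDS1 δ := Metric.isClosed_closedBall.mem_of_tendsto he
    (by filter_upwards [eventually_ge_atTop 0] with t ht using hin t ht)
  have hexp : Tendsto (fun t => √(deSitterEnergy (γ 0)) * Real.exp (-(heightDS1 / 2 * t)))
      atTop (𝓝 0) := by
    simpa using (Real.tendsto_exp_neg_atTop_nhds_zero.comp
      (tendsto_id.const_mul_atTop (by linarith : 0 < heightDS1 / 2))).const_mul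
      (√(deSitterEnergy (γ 0)))
  have heE : √(deSitterEnergy e) = 0 := by
    have h1 : Tendsto (fun t => √(deSitterEnergy (γ t))) atTop (𝓝 √(deSitterEnergy e)) :=
      ((Real.continuous_sqrt.comp continuous_deSitterEnergy).tendsto e).comp he
    refine le_antisymm (le_of_tendsto_of_tendsto h1 hexp ?_) (Real.sqrt_nonneg _)
    filter_upwards [eventually_ge_atTop 0] with t ht using hdecay t ht
  have heD : deSitterRed e = 0 := by
    simpa [heE] using abs_deSitterRed_le e
  have heW : omegaRed e = 0 := by
    simpa [heE] using abs_omegaRed_le e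
  have hp := fun t => hasDerivAt_pi.1 (hγ t)
  have he3 := (tendsto_pi_nhds.1 he) 3
  refine ⟨γ, fun t ht => ?_, hγ0, fun t _ => (hinv t).1, e, he, fun hu => ?_, fun hu => ?_⟩
  · have := hγ t
    rw [hχ1 _ (hin t ht), one_smul] at this
    exact this.hasDerivWithinAt
  · have h3 : e 3 = 0 := by
      refine tendsto_nhds_unique he3 (tendsto_const_nhds.congr fun t => ?_)
      obtain ⟨k, -, h⟩ := (hinv t).2.1
      rw [h, hγ0, hu, mul_zero]
    simp only [omegaRed, deSitterRed, h3] at heW heD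
    exact eq_pointDS1 ⟨heR, h3⟩ (by linarith) (by linarith)
  · -- `log u` has an integrable derivative, so `u` stays away from zero
    have hpos : ∀ t, 0 < γ t 3 := by
      intro t
      obtain ⟨k, hk, h⟩ := (hinv t).2.1
      rw [h, hγ0]
      exact mul_pos hk hu
    have hlog : ∀ t ≥ 0, HasDerivAt (fun s => Real.log (γ s 3)) (radialRate g (γ t)) t := by
      intro t ht
      refine ((hp t 3).log (hpos t).ne').congr_deriv ?_
      rw [hχ1 _ (hin t ht), one_smul]
      exact mul_div_cancel_right₀ _ (hpos t).ne'
    have hbd : ∀ t ≥ 0, ‖radialRate g (γ t)‖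
        ≤ M * √(deSitterEnergy (γ 0)) * Real.exp (-(heightDS1 / 2 * t)) := by
      intro t ht
      have h1 := (hball _ (hin t ht)).2.2.2.2.2
      have h2 := mul_le_mul_of_nonneg_left (hdecay t ht) hM.le
      rw [Real.norm_eq_abs]
      linarith
    obtain ⟨b, hb⟩ := exists_tendsto_of_exp_deriv (by linarith : 0 < heightDS1 / 2) hlog hbd
    have hpos' : e 3 = Real.exp b := by
      refine tendsto_nhds_unique he3 (((Real.continuous_exp.tendsto b).comp hb).congr fun t => ?_)
      exact Real.exp_log (hpos t)
    refine mem_liftedLineDS_iff.2 ⟨heR, hpos' ▸ Real.exp_pos b, heW, heD, ?_⟩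
    linarith [(hball _ heB).2.1]

/-! ### Orbits close to `N₁` in the local coordinates -/

/-- A curve `(x, s, t)` close to the origin, off the planes `x = 0` and `t = 0`, that solves the
local system in a time with respect to which the local time has the rate `m`. -/
structure IsLocalOrbit (c : ℝ) (I : Set ℝ) (m x s t : ℝ → ℝ) : Prop where
  m_cont : ContinuousOn m I
  m_ge : ∀ τ ∈ I, 1 / 2 ≤ m τ
  x_pos : ∀ τ ∈ I, 0 < x τ
  x_le : ∀ τ ∈ I, x τ ≤ 1 / 100
  abs_s_le : ∀ τ ∈ I, |s τ| ≤ 1 / 100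
  t_pos : ∀ τ ∈ I, 0 < t τ
  t_le : ∀ τ ∈ I, t τ ≤ 1 / 100
  w_sign : (∀ τ ∈ I, 0 < x τ * (2 - x τ) - s τ ^ 2) ∨ ∀ τ ∈ I, x τ * (2 - x τ) - s τ ^ 2 = 0
  dx : ∀ τ ∈ I, HasDerivWithinAt x (m τ * (x τ * s τ + t τ * (2 - x τ) *
    (x τ * (2 - x τ) + c * (x τ * (2 - x τ) - s τ ^ 2)))) I τ
  ds : ∀ τ ∈ I, HasDerivWithinAt s (m τ * (-(x τ - s τ ^ 2) - s τ * t τ *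
    (-(1 - x τ) * (2 - x τ) + c * (x τ * (2 - x τ) - s τ ^ 2)))) I τ
  dt : ∀ τ ∈ I, HasDerivWithinAt t (m τ * (-t τ * (s τ + t τ *
    ((2 - x τ) ^ 2 - c * (x τ * (2 - x τ) - s τ ^ 2))))) I τ

/-- The negative logarithmic rate of `t` in the local system. -/
def decayRate (c x s t : ℝ) : ℝ := s + t * ((2 - x) ^ 2 - c * (x * (2 - x) - s ^ 2))

lemma abs_mul_three_le {a b d p q r : ℝ} (ha : |a| ≤ p) (hb : |b| ≤ q) (hd : |d| ≤ r) :
    |a * b * d| ≤ p * q * r := by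
  rw [abs_mul, abs_mul]
  gcongr
  · exact mul_nonneg ((abs_nonneg a).trans ha) ((abs_nonneg b).trans hb)
  · exact (abs_nonneg a).trans ha

/-- The coefficient of `Ω` in the derivative of `decayRate` is negative close to the origin. -/
lemma decayRate_coeff_neg {c x s t : ℝ} (hc : |c| ≤ 2) (hx : 0 < x) (hx' : x ≤ 1 / 100)
    (hs : |s| ≤ 1 / 100) (ht : 0 < t) (ht' : t ≤ 1 / 100) :
    -(1 + c * s * t) / (2 - x) - 4 * c * t ^ 2 * (2 - x)
      - c * t * (2 * s + 2 * t * ((1 - x) * (2 - x) * (1 + c) + c * s ^ 2)) < 0 := by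
  have ht1 : |t| ≤ 1 / 100 := by rwa [abs_of_pos ht]
  have h1 := abs_mul_three_le hc hs ht1
  have hc' := abs_le.1 hc
  have hs' := abs_le.1 hs
  have h1' := abs_le.1 h1
  have e1 : -(1 + c * s * t) / (2 - x) ≤ -(2 / 5) := by
    rw [div_le_iff₀ (by linarith)]; linarith
  have h2 : |t * (2 - x)| ≤ 1 / 50 := by
    rw [abs_of_pos (mul_pos ht (by linarith))]; nlinarith
  have h3 := abs_le.1 (abs_mul_three_le hc ht1 h2)
  have h4 : |2 * s + 2 * t * ((1 - x) * (2 - x) * (1 + c) + c * s ^ 2)| ≤ 1 := by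
    have k1 : |(1 - x) * (2 - x) * (1 + c)| ≤ 1 * 2 * 3 :=
      abs_mul_three_le (abs_le.2 ⟨by linarith, by linarith⟩) (abs_le.2 ⟨by linarith, by linarith⟩)
        (abs_le.2 ⟨by linarith, by linarith⟩)
    have k2 := abs_mul_three_le hc hs hs
    have k3 : |(1 - x) * (2 - x) * (1 + c) + c * s ^ 2| ≤ 7 := by
      rw [show c * s ^ 2 = c * s * s by ring]
      exact (abs_add_le _ _).trans (by linarith)
    have k4 := abs_mul_three_le (by norm_num : |(2 : ℝ)| ≤ 2) ht1 k3
    refine (abs_add_le _ _).trans ?_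
    rw [abs_mul, abs_two]
    linarith
  have h5 := abs_le.1 (abs_mul_three_le hc ht1 h4)
  have e2 : 4 * c * t ^ 2 * (2 - x) = 4 * (c * t * (t * (2 - x))) := by ring
  rw [e2]
  linarith

namespace IsLocalOrbit

variable {c : ℝ} {I : Set ℝ} {m x s t : ℝ → ℝ} (h : IsLocalOrbit c I m x s t)
include h

lemma w_nonneg {τ : ℝ} (hτ : τ ∈ I) : 0 ≤ x τ * (2 - x τ) - s τ ^ 2 := by
  rcases h.w_sign with h | h
  · exact (h τ hτ).le
  · exact (h τ hτ).ge

/-- The derivative of `decayRate` is a combination of `decayRate` and `Ω`. -/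
lemma hasDeriv_decayRate {τ : ℝ} (hτ : τ ∈ I) :
    HasDerivWithinAt (fun τ => decayRate c (x τ) (s τ) (t τ))
      (m τ * ((s τ * (1 - x τ) / (2 - x τ)
          - t τ * ((2 - x τ) ^ 2 - c * (x τ * (2 - x τ) - s τ ^ 2)) - 2 * t τ * (2 - x τ) * x τ)
          * decayRate c (x τ) (s τ) (t τ)
        + (-(1 + c * s τ * t τ) / (2 - x τ) - 4 * c * t τ ^ 2 * (2 - x τ)
          - c * t τ * (2 * s τ + 2 * t τ * ((1 - x τ) * (2 - x τ) * (1 + c) + c * s τ ^ 2)))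
          * (x τ * (2 - x τ) - s τ ^ 2))) I τ := by
  have hx := h.dx τ hτ
  have hs := h.ds τ hτ
  have ht := h.dt τ hτ
  have h2 : 2 - x τ ≠ 0 := by linarith [h.x_le τ hτ]
  refine (hs.add (ht.mul (((hx.const_sub 2).pow 2).sub
    (((hx.mul (hx.const_sub 2)).sub (hs.pow 2)).const_mul c)))).congr_deriv ?_
  simp only [decayRate, Pi.pow_apply, Pi.mul_apply, Pi.sub_apply]
  field_simp
  ring

lemma continuousOn_x : ContinuousOn x I := fun τ hτ => (h.dx τ hτ).continuousWithinAt

lemma continuousOn_s : ContinuousOn s I := fun τ hτ => (h.ds τ hτ).continuousWithinAt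

lemma continuousOn_t : ContinuousOn t I := fun τ hτ => (h.dt τ hτ).continuousWithinAt

/-- The region `decayRate ≤ 0` is forward invariant. -/
lemma decayRate_nonpos (hI : I.OrdConnected) (hc : |c| ≤ 2) {a b : ℝ} (ha : a ∈ I) (hb : b ∈ I)
    (hab : a ≤ b) (h0 : decayRate c (x a) (s a) (t a) ≤ 0) :
    decayRate c (x b) (s b) (t b) ≤ 0 := by
  rcases h.w_sign with hw | hw
  · refine nonpos_of_deriv_neg_of_eq_zero hI (fun τ hτ => h.hasDeriv_decayRate hτ)
      (fun τ hτ h0 => ?_) ha hb hab h0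
    have h1 := decayRate_coeff_neg hc (h.x_pos τ hτ) (h.x_le τ hτ) (h.abs_s_le τ hτ)
      (h.t_pos τ hτ) (h.t_le τ hτ)
    rw [h0, mul_zero, zero_add]
    exact mul_neg_of_pos_of_neg (by linarith [h.m_ge τ hτ])
      (mul_neg_of_neg_of_pos h1 (hw τ hτ))
  · have hx := h.continuousOn_x
    have hs := h.continuousOn_s
    have ht := h.continuousOn_t
    have hm := h.m_cont
    obtain ⟨k, hk, e⟩ := exists_pos_mul_of_linear hI
      (f := fun τ => decayRate c (x τ) (s τ) (t τ))
      (a := fun τ => m τ * (s τ * (1 - x τ) / (2 - x τ)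
          - t τ * ((2 - x τ) ^ 2 - c * (x τ * (2 - x τ) - s τ ^ 2)) - 2 * t τ * (2 - x τ) * x τ))
      (fun τ hτ => (h.hasDeriv_decayRate hτ).congr_deriv (by rw [hw τ hτ]; ring))
      (by
        refine hm.mul (((ContinuousOn.div (by fun_prop) (by fun_prop) fun τ hτ => ?_).sub
          (by fun_prop)).sub (by fun_prop))
        linarith [h.x_le τ hτ]) ha hb
    rw [e]
    exact mul_nonpos_of_nonneg_of_nonpos hk.le h0

/-- The region `s ≤ 0` is forward invariant. -/
lemma s_nonpos (hI : I.OrdConnected) {a b : ℝ} (ha : a ∈ I) (hb : b ∈ I)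
    (hab : a ≤ b) (h0 : s a ≤ 0) : s b ≤ 0 := by
  refine nonpos_of_deriv_neg_of_eq_zero hI h.ds (fun τ hτ h0 => ?_) ha hb hab h0
  rw [h0]
  have h1 := mul_pos (by linarith [h.m_ge τ hτ] : 0 < m τ) (h.x_pos τ hτ)
  linarith

lemma hasDeriv_x_div_t {τ : ℝ} (hτ : τ ∈ I) :
    HasDerivWithinAt (fun τ => x τ / t τ) (m τ * (2 * (x τ * decayRate c (x τ) (s τ) (t τ)
      + c * t τ * (x τ * (2 - x τ) - s τ ^ 2))) / t τ) I τ := by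
  have ht := (h.t_pos τ hτ).ne'
  refine ((h.dx τ hτ).div (h.dt τ hτ) ht).congr_deriv ?_
  rw [decayRate]
  field_simp
  ring

lemma hasDeriv_s_div_x {τ : ℝ} (hτ : τ ∈ I) :
    HasDerivWithinAt (fun τ => s τ / x τ) (m τ * (-1 - s τ * (t τ / x τ) *
      (2 - x τ + 2 * c * ((x τ * (2 - x τ) - s τ ^ 2) / x τ)))) I τ := by
  have hx := (h.x_pos τ hτ).ne'
  refine ((h.ds τ hτ).div (h.dx τ hτ) hx).congr_deriv ?_
  field_simp
  ring

/-- As long as `t` is controlled by `x`, the ratio `s / x` decreases at a definite rate once `s` is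
small. -/
lemma deriv_s_div_x_le (hc : |c| ≤ 2) {τ C : ℝ} (hτ : τ ∈ I) (hC : t τ / x τ ≤ C)
    (hs : |s τ| * C ≤ 1 / 20) :
    m τ * (-1 - s τ * (t τ / x τ) *
      (2 - x τ + 2 * c * ((x τ * (2 - x τ) - s τ ^ 2) / x τ))) ≤ -(1 / 4) := by
  have hx := h.x_pos τ hτ
  have hx' := h.x_le τ hτ
  have ht := h.t_pos τ hτ
  have hw := h.w_nonneg hτ
  have h1 : |s τ * (t τ / x τ)| ≤ 1 / 20 := by
    rw [abs_mul, abs_of_pos (div_pos ht hx)]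
    exact (mul_le_mul_of_nonneg_left hC (abs_nonneg _)).trans hs
  have h2 : |(x τ * (2 - x τ) - s τ ^ 2) / x τ| ≤ 2 := by
    rw [abs_of_nonneg (div_nonneg hw hx.le), div_le_iff₀ hx]
    nlinarith [sq_nonneg (s τ)]
  have h3 : |2 - x τ + 2 * c * ((x τ * (2 - x τ) - s τ ^ 2) / x τ)| ≤ 10 := by
    have h4 := abs_mul_three_le (by norm_num : |(2 : ℝ)| ≤ 2) hc h2
    refine (abs_add_le _ _).trans ?_
    rw [abs_of_pos (by linarith : 0 < 2 - x τ)]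
    linarith
  have h5 := abs_mul_three_le (by norm_num : |(1 : ℝ)| ≤ 1) h1 h3
  rw [one_mul] at h5
  have h6 := (abs_le.1 h5).1
  nlinarith [h.m_ge τ hτ]

lemma t_anti (hI : Convex ℝ I) (hD : ∀ τ ∈ I, 0 ≤ decayRate c (x τ) (s τ) (t τ)) :
    AntitoneOn t I :=
  antitoneOn_of_deriv_nonpos' hI h.dt fun τ hτ => by
    have := mul_nonneg (by linarith [h.m_ge τ hτ] : 0 ≤ m τ)
      (mul_nonneg (h.t_pos τ hτ).le (hD τ hτ))
    unfold decayRate at this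
    linarith

lemma t_mono (hI : Convex ℝ I) (hD : ∀ τ ∈ I, decayRate c (x τ) (s τ) (t τ) ≤ 0) :
    MonotoneOn t I :=
  monotoneOn_of_deriv_nonneg' hI h.dt fun τ hτ => by
    have := mul_nonneg (by linarith [h.m_ge τ hτ] : 0 ≤ m τ)
      (mul_nonneg (h.t_pos τ hτ).le (neg_nonneg.2 (hD τ hτ)))
    unfold decayRate at this
    linarith

lemma mono {J : Set ℝ} (hJ : J ⊆ I) : IsLocalOrbit c J m x s t where
  m_cont := h.m_cont.mono hJ
  m_ge τ hτ := h.m_ge τ (hJ hτ)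
  x_pos τ hτ := h.x_pos τ (hJ hτ)
  x_le τ hτ := h.x_le τ (hJ hτ)
  abs_s_le τ hτ := h.abs_s_le τ (hJ hτ)
  t_pos τ hτ := h.t_pos τ (hJ hτ)
  t_le τ hτ := h.t_le τ (hJ hτ)
  w_sign := h.w_sign.imp (fun h τ hτ => h τ (hJ hτ)) fun h τ hτ => h τ (hJ hτ)
  dx τ hτ := (h.dx τ (hJ hτ)).mono hJ
  ds τ hτ := (h.ds τ (hJ hτ)).mono hJ
  dt τ hτ := (h.dt τ (hJ hτ)).mono hJ

/-- No orbit with `T < 1` off the vacuum line `x = 0` approaches `N₁` in the past: either `t`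
decreases with time, or `s / x` decreases at a definite rate although `s ≤ 0`. -/
lemma not_tendsto_atBot {a : ℝ} (hI : I = Iic a) (hc : -2 < c) (hc' : c < 0)
    (hs0 : Tendsto s atBot (𝓝 0)) (ht0 : Tendsto t atBot (𝓝 0)) : False := by
  subst hI
  have hc2 : |c| ≤ 2 := abs_le.2 ⟨hc.le, by linarith⟩
  by_cases hD : ∃ b ≤ a, 0 < decayRate c (x b) (s b) (t b)
  · obtain ⟨b, hb, hDb⟩ := hD
    have hsub : Iic b ⊆ Iic a := Iic_subset_Iic.2 hb
    have hanti := (h.mono hsub).t_anti (convex_Iic b) fun τ hτ => by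
      by_contra! hcon
      exact absurd (h.decayRate_nonpos ordConnected_Iic hc2 (hsub hτ) hb hτ hcon.le) (not_le.2 hDb)
    have := ge_of_tendsto ht0 (by
      filter_upwards [eventually_le_atBot b] with τ hτ using hanti hτ self_mem_Iic hτ)
    exact absurd this (not_le.2 (h.t_pos b hb))
  push Not at hD
  have hs : ∀ τ ≤ a, s τ ≤ 0 := by
    intro τ hτ
    have h1 := hD τ hτ
    have h2 := h.w_nonneg hτ
    have h3 : 0 ≤ t τ * ((2 - x τ) ^ 2 - c * (x τ * (2 - x τ) - s τ ^ 2)) := by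
      have := h.t_pos τ hτ
      refine mul_nonneg this.le (by nlinarith [sq_nonneg (2 - x τ)])
    unfold decayRate at h1
    linarith
  have hanti := antitoneOn_of_deriv_nonpos' (convex_Iic a) (fun τ hτ => h.hasDeriv_x_div_t hτ)
    (fun τ hτ => by
      have h1 := mul_nonneg (h.x_pos τ hτ).le (neg_nonneg.2 (hD τ hτ))
      have h2 := mul_nonneg (mul_nonneg (neg_nonneg.2 hc'.le) (h.t_pos τ hτ).le) (h.w_nonneg hτ)
      refine div_nonpos_of_nonpos_of_nonneg ?_ (h.t_pos τ hτ).le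
      exact mul_nonpos_of_nonneg_of_nonpos (by linarith [h.m_ge τ hτ]) (by linarith))
  have hC : ∀ τ ≤ a, t τ / x τ ≤ t a / x a := by
    intro τ hτ
    have h1 := hanti hτ self_mem_Iic hτ
    have := inv_anti₀ (div_pos (h.x_pos a self_mem_Iic) (h.t_pos a self_mem_Iic)) h1
    simpa using this
  have hsC : Tendsto (fun τ => |s τ| * (t a / x a)) atBot (𝓝 0) := by
    simpa using hs0.abs.mul_const (t a / x a)
  obtain ⟨b, hb⟩ := eventually_atBot.1
    ((hsC.eventually (ge_mem_nhds (by norm_num : (0 : ℝ) < 1 / 20))).and (eventually_le_atBot a))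
  have hsub : Iic b ⊆ Iic a := fun τ hτ => (hb τ hτ).2
  have hdec := antitoneOn_of_deriv_nonpos' (convex_Iic b) (f := fun τ => s τ / x τ + 1 / 4 * τ)
    (fun τ hτ => ((h.hasDeriv_s_div_x (hsub hτ)).mono hsub).add
      ((hasDerivAt_id τ).const_mul (1 / 4)).hasDerivWithinAt)
    (fun τ hτ => by
      have := h.deriv_s_div_x_le hc2 (hsub hτ) (hC τ (hsub hτ)) (hb τ hτ).1
      linarith)
  set r := s b / x b
  have h1 := hdec (a := b - 4 * (1 + |r|)) (b := b) (by
    have := abs_nonneg r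
    simp only [mem_Iic]; linarith) self_mem_Iic (by have := abs_nonneg r; linarith)
  have hmem : b - 4 * (1 + |r|) ≤ a := (hb _ (by have := abs_nonneg r; linarith)).2
  have h2 := div_nonpos_of_nonpos_of_nonneg (hs _ hmem) (h.x_pos _ hmem).le
  have h3 := neg_abs_le r
  simp only at h1
  linarith

/-- No orbit with `T < 1` off the vacuum line `x = 0` approaches `N₁` in the future: if `s > 0`
throughout, then `s / x` decreases at a definite rate; if `s ≤ 0` from some time on, then either `t`
increases or `s` decreases. -/
lemma not_tendsto_atTop {a : ℝ} (hI : I = Ici a) (hc : -2 < c) (hc' : c < 0)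
    (hs0 : Tendsto s atTop (𝓝 0)) (ht0 : Tendsto t atTop (𝓝 0)) : False := by
  subst hI
  have hc2 : |c| ≤ 2 := abs_le.2 ⟨hc.le, by linarith⟩
  have hP : ∀ τ ≥ a, 0 ≤ t τ * ((2 - x τ) ^ 2 - c * (x τ * (2 - x τ) - s τ ^ 2)) := by
    intro τ hτ
    have h2 := h.w_nonneg hτ
    have := h.t_pos τ hτ
    exact mul_nonneg this.le (by nlinarith [sq_nonneg (2 - x τ)])
  by_cases hs : ∃ b ≥ a, s b ≤ 0
  · obtain ⟨b, hb, hsb⟩ := hs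
    have hsub : Ici b ⊆ Ici a := Ici_subset_Ici.2 hb
    have hs : ∀ τ ≥ b, s τ ≤ 0 := fun τ hτ => h.s_nonpos ordConnected_Ici hb (hsub hτ) hτ hsb
    by_cases hD : ∃ d ≥ b, decayRate c (x d) (s d) (t d) ≤ 0
    · obtain ⟨d, hd, hDd⟩ := hD
      have hsub' : Ici d ⊆ Ici a := (Ici_subset_Ici.2 hd).trans hsub
      have hmono := (h.mono hsub').t_mono (convex_Ici d) fun τ hτ =>
        h.decayRate_nonpos ordConnected_Ici hc2 (hsub hd) (hsub' hτ) hτ hDd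
      have := ge_of_tendsto ht0 (by
        filter_upwards [eventually_ge_atTop d] with τ hτ using hmono self_mem_Ici hτ hτ)
      exact absurd this (not_le.2 (h.t_pos d (hsub hd)))
    push Not at hD
    -- `s` is nonpositive and strictly decreasing, hence does not tend to zero
    have hanti := strictAntiOn_of_deriv_neg' (convex_Ici b)
      (fun τ hτ => (h.ds τ (hsub hτ)).mono hsub) (fun τ hτ => by
        have hx := h.x_pos τ (hsub hτ)
        have hx' := h.x_le τ (hsub hτ)
        have hw := h.w_nonneg (hsub hτ)
        have h2 : 2 - x τ ≠ 0 := by linarith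
        have hcst : 0 < 1 + c * s τ * t τ := by
          have := h.t_pos τ (hsub hτ)
          have := mul_nonneg (mul_nonneg_of_nonpos_of_nonpos hc'.le (hs τ hτ)) this.le
          linarith
        have e : -(x τ - s τ ^ 2) - s τ * t τ *
            (-(1 - x τ) * (2 - x τ) + c * (x τ * (2 - x τ) - s τ ^ 2))
            = (s τ * ((1 - x τ) * decayRate c (x τ) (s τ) (t τ))
              - (1 + c * s τ * t τ) * (x τ * (2 - x τ) - s τ ^ 2)) / (2 - x τ) := by
          rw [decayRate]
          field_simp
          ring
        rw [e]
        refine mul_neg_of_pos_of_neg (by linarith [h.m_ge τ (hsub hτ)])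
          (div_neg_of_neg_of_pos ?_ (by linarith))
        have h3 : 0 < (1 - x τ) * decayRate c (x τ) (s τ) (t τ) :=
          mul_pos (by linarith) (hD τ hτ)
        rcases (hs τ hτ).lt_or_eq with hneg | h0
        · have := mul_neg_of_neg_of_pos hneg h3
          have := mul_nonneg hcst.le hw
          linarith
        · have : 0 < (1 + c * s τ * t τ) * (x τ * (2 - x τ) - s τ ^ 2) := by
            refine mul_pos hcst ?_
            rw [h0]
            have := mul_pos hx (by linarith : 0 < 2 - x τ)
            linarith
          rw [h0] at this ⊢
          linarith)
    have h1 := hanti self_mem_Ici (show b + 1 ∈ Ici b by simp) (by linarith)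
    have h2 := le_of_tendsto hs0 (by
      filter_upwards [eventually_ge_atTop (b + 1)] with τ hτ using
        hanti.antitoneOn (show b + 1 ∈ Ici b by simp)
          (show τ ∈ Ici b by simp only [mem_Ici]; linarith) hτ)
    linarith
  push Not at hs
  have hmono := monotoneOn_of_deriv_nonneg' (convex_Ici a) (fun τ hτ => h.hasDeriv_x_div_t hτ)
    (fun τ hτ => by
      have hx := h.x_pos τ hτ
      have hx' := h.x_le τ hτ
      have ht := h.t_pos τ hτ
      have hw := h.w_nonneg hτ
      refine div_nonneg (mul_nonneg (by linarith [h.m_ge τ hτ]) (mul_nonneg two_pos.le ?_)) ht.le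
      have hw' : x τ * (2 - x τ) - s τ ^ 2 ≤ x τ * (2 - x τ) := by linarith [sq_nonneg (s τ)]
      have e : x τ * decayRate c (x τ) (s τ) (t τ) + c * t τ * (x τ * (2 - x τ) - s τ ^ 2)
          = x τ * s τ + t τ * (x τ * (2 - x τ) ^ 2
            + c * ((1 - x τ) * (x τ * (2 - x τ) - s τ ^ 2))) := by
        rw [decayRate]; ring
      rw [e]
      have h1 : (1 - x τ) * (x τ * (2 - x τ) - s τ ^ 2) ≤ (1 - x τ) * (x τ * (2 - x τ)) :=
        mul_le_mul_of_nonneg_left hw' (by linarith)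
      have h2 : 0 ≤ (1 - x τ) * (x τ * (2 - x τ) - s τ ^ 2) := mul_nonneg (by linarith) hw
      have h3 : 0 ≤ x τ * (2 - x τ) * x τ :=
        mul_nonneg (mul_nonneg hx.le (by linarith)) hx.le
      have h4 : 0 ≤ x τ * (2 - x τ) ^ 2 + c * ((1 - x τ) * (x τ * (2 - x τ) - s τ ^ 2)) := by
        nlinarith
      have h5 := mul_nonneg ht.le h4
      have h6 := mul_pos hx (hs τ hτ)
      linarith)
  have hC : ∀ τ ≥ a, t τ / x τ ≤ t a / x a := by
    intro τ hτ
    have h1 := hmono self_mem_Ici hτ hτ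
    have := inv_anti₀ (div_pos (h.x_pos a self_mem_Ici) (h.t_pos a self_mem_Ici)) h1
    simpa using this
  have hsC : Tendsto (fun τ => |s τ| * (t a / x a)) atTop (𝓝 0) := by
    simpa using hs0.abs.mul_const (t a / x a)
  obtain ⟨b, hb⟩ := eventually_atTop.1
    ((hsC.eventually (ge_mem_nhds (by norm_num : (0 : ℝ) < 1 / 20))).and (eventually_ge_atTop a))
  have hsub : Ici b ⊆ Ici a := fun τ hτ => (hb τ hτ).2
  have hdec := antitoneOn_of_deriv_nonpos' (convex_Ici b) (f := fun τ => s τ / x τ + 1 / 4 * τ)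
    (fun τ hτ => ((h.hasDeriv_s_div_x (hsub hτ)).mono hsub).add
      ((hasDerivAt_id τ).const_mul (1 / 4)).hasDerivWithinAt)
    (fun τ hτ => by
      have := h.deriv_s_div_x_le hc2 (hsub hτ) (hC τ (hsub hτ)) (hb τ hτ).1
      linarith)
  set r := s b / x b
  have hle : b ≤ b + 4 * (1 + |r|) := by have := abs_nonneg r; linarith
  have h1 := hdec self_mem_Ici (show b + 4 * (1 + |r|) ∈ Ici b from hle) hle
  have hmem := (hb _ hle).2
  have h2 := div_nonneg (hs _ hmem).le (h.x_pos _ hmem).le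
  have h3 := le_abs_self r
  simp only at h1
  linarith

end IsLocalOrbit

/-! ### Orbits of the extended state space -/

/-- A solution of the Jordan system on a time interval containing `0`, with initial point in the
extended state space. -/
structure IsJordanOrbit (g : ℝ) (I : Set ℝ) (γ : ℝ → Fin 3 → ℝ) : Prop where
  conn : I.OrdConnected
  zero_mem : (0 : ℝ) ∈ I
  sol : IsSolutionOn (jordanField g) I γ
  init : γ 0 ∈ jordanClosed

lemma isCompact_jordanClosed : IsCompact jordanClosed := by
  have hcl : IsClosed jordanClosed := by
    have h : IsClosed {p : Fin 3 → ℝ | 0 ≤ omegaPf p} :=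
      isClosed_le continuous_const (by unfold omegaPf; fun_prop)
    exact h.inter ((isClosed_le continuous_const (continuous_apply 2)).inter
      (isClosed_le (continuous_apply 2) continuous_const))
  refine Metric.isCompact_of_isClosed_isBounded hcl
    ((Metric.isBounded_closedBall (x := 0) (r := 1)).subset fun p hp => ?_)
  obtain ⟨h1, h2, h3⟩ := hp
  unfold omegaPf at h1
  rw [mem_closedBall_zero_iff, pi_norm_le_iff_of_nonneg zero_le_one]
  intro i
  rw [Real.norm_eq_abs, abs_le]
  fin_cases i
  · simp only [Fin.zero_eta]
    constructor <;> nlinarith [sq_nonneg (p 1)]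
  · simp only [Fin.mk_one]
    constructor <;> nlinarith [sq_nonneg (p 0)]
  · simp only [Fin.reduceFinMk]
    constructor <;> linarith

/-- In a compact set, a curve converges if and only if it has a single limit point. -/
lemma clusterPts_eq_singleton_iff {X : Type*} [TopologicalSpace X] [T2Space X] {l : Filter ℝ}
    [l.NeBot] {γ : ℝ → X} {K : Set X} (hK : IsCompact K) (hmem : ∀ᶠ t in l, γ t ∈ K) {a : X} :
    {p | MapClusterPt p l γ} = {a} ↔ Tendsto γ l (𝓝 a) := by
  refine ⟨fun h => hK.tendsto_nhds_of_unique_mapClusterPt hmem fun p _ hp => ?_, fun h => ?_⟩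
  · exact (h ▸ hp : p ∈ ({a} : Set X))
  · ext p
    refine ⟨fun hp => eq_of_nhds_neBot (ClusterPt.mono hp h), fun hp => ?_⟩
    rw [mem_singleton_iff.1 hp]
    exact h.mapClusterPt

lemma eventually_small {γ : ℝ → Fin 3 → ℝ} {l : Filter ℝ} (hl : Tendsto γ l (𝓝 pointN1)) :
    (∀ᶠ τ in l, 1 / 2 ≤ γ τ 2 ∧ 1 + γ τ 0 ≤ 1 / 100 ∧ |γ τ 1| ≤ 1 / 100 ∧
      (1 - γ τ 2) / γ τ 2 ≤ 1 / 100) ∧ Tendsto (fun τ => γ τ 1) l (𝓝 0) ∧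
      Tendsto (fun τ => (1 - γ τ 2) / γ τ 2) l (𝓝 0) := by
  have hp := tendsto_pi_nhds.1 hl
  have h0 : Tendsto (fun τ => 1 + γ τ 0) l (𝓝 0) := by
    simpa [pointN1] using (hp 0).const_add 1
  have h1 : Tendsto (fun τ => γ τ 1) l (𝓝 0) := by simpa [pointN1] using hp 1
  have h2 : Tendsto (fun τ => γ τ 2) l (𝓝 1) := by simpa [pointN1] using hp 2
  have h3 : Tendsto (fun τ => (1 - γ τ 2) / γ τ 2) l (𝓝 0) := by
    simpa [Pi.div_def] using (h2.const_sub 1).div h2 one_ne_zero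
  have h1' : Tendsto (fun τ => |γ τ 1|) l (𝓝 0) := by simpa using h1.abs
  refine ⟨?_, h1, h3⟩
  have hε : (0 : ℝ) < 1 / 100 := by norm_num
  filter_upwards [h2.eventually (le_mem_nhds (by norm_num : (1 / 2 : ℝ) < 1)),
    h0.eventually (ge_mem_nhds hε), h1'.eventually (ge_mem_nhds hε),
    h3.eventually (ge_mem_nhds hε)] with τ e1 e2 e3 e4 using ⟨e1, e2, e3, e4⟩

namespace IsJordanOrbit

variable {g : ℝ} {I : Set ℝ} {γ : ℝ → Fin 3 → ℝ} (h : IsJordanOrbit g I γ)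
include h

lemma deriv {t : ℝ} (ht : t ∈ I) (i : Fin 3) :
    HasDerivWithinAt (fun s => γ s i) (jordanField g (γ t) i) I t :=
  hasDerivWithinAt_pi.1 (h.sol t ht) i

lemma continuousOn (i : Fin 3) : ContinuousOn (fun s => γ s i) I :=
  fun _ ht => (h.deriv ht i).continuousWithinAt

lemma omegaPf_eq {s t : ℝ} (hs : s ∈ I) (ht : t ∈ I) :
    ∃ k, 0 < k ∧ omegaPf (γ t) = k * omegaPf (γ s) := by
  have h0 := h.continuousOn 0
  have h1 := h.continuousOn 1
  have h2 := h.continuousOn 2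
  refine exists_pos_mul_of_linear h.conn (f := fun t => omegaPf (γ t))
    (a := fun t => 2 * γ t 2 * γ t 1 + 2 * (1 - γ t 2)
      * (-γ t 0 * (1 - γ t 0) * (2 - 3 / 2 * g) + (1 - 3 / 2 * g) * γ t 1 ^ 2))
    (fun τ hτ => ?_) (by fun_prop) hs ht
  refine ((((h.deriv hτ 0).pow 2).const_sub 1).sub ((h.deriv hτ 1).pow 2)).congr_deriv ?_
  simp only [jordanField, omegaPf, Matrix.cons_val]
  push_cast
  ring

lemma T_eq {t : ℝ} (ht : t ∈ I) : ∃ k, 0 < k ∧ γ t 2 = k * γ 0 2 := by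
  have h0 := h.continuousOn 0
  have h1 := h.continuousOn 1
  have h2 := h.continuousOn 2
  refine exists_pos_mul_of_linear h.conn (f := fun t => γ t 2)
    (a := fun t => (1 - γ t 2) * (γ t 1 * γ t 2 + (1 - γ t 2) * ((1 - γ t 0) ^ 2
      + 3 / 2 * (g - 2 / 3) * (1 - γ t 0 ^ 2 - γ t 1 ^ 2))))
    (fun τ hτ => ?_) (by fun_prop) h.zero_mem ht
  refine (h.deriv hτ 2).congr_deriv ?_
  simp only [jordanField, Matrix.cons_val]
  ring

lemma one_sub_T_eq {t : ℝ} (ht : t ∈ I) : ∃ k, 0 < k ∧ 1 - γ t 2 = k * (1 - γ 0 2) := by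
  have h0 := h.continuousOn 0
  have h1 := h.continuousOn 1
  have h2 := h.continuousOn 2
  refine exists_pos_mul_of_linear h.conn (f := fun t => 1 - γ t 2)
    (a := fun t => -γ t 2 * (γ t 1 * γ t 2 + (1 - γ t 2) * ((1 - γ t 0) ^ 2
      + 3 / 2 * (g - 2 / 3) * (1 - γ t 0 ^ 2 - γ t 1 ^ 2))))
    (fun τ hτ => ?_) (by fun_prop) h.zero_mem ht
  refine ((h.deriv hτ 2).const_sub 1).congr_deriv ?_
  simp only [jordanField, Matrix.cons_val]
  ring

lemma mem {t : ℝ} (ht : t ∈ I) : γ t ∈ jordanClosed := by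
  obtain ⟨k, hk, e⟩ := h.omegaPf_eq h.zero_mem ht
  obtain ⟨k', hk', e'⟩ := h.T_eq ht
  obtain ⟨l, hl, e''⟩ := h.one_sub_T_eq ht
  obtain ⟨h1, h2, h3⟩ := h.init
  refine ⟨?_, ?_, ?_⟩
  · rw [e]; positivity
  · rw [e']; positivity
  · have := mul_nonneg hl.le (sub_nonneg.2 h3)
    linarith

/-- The vacuum line `X = -1` is invariant, in both directions of time. -/
lemma X_eq_neg_one {s t : ℝ} (hs : s ∈ I) (ht : t ∈ I) (h0 : γ s 0 = -1) :
    γ t 0 = -1 ∧ γ t 1 = 0 := by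
  have hs1 : γ s 1 = 0 := by
    have := (h.mem hs).1
    rw [omegaPf, h0] at this
    nlinarith [sq_nonneg (γ s 1)]
  have hΩ : ∀ τ ∈ I, omegaPf (γ τ) = 0 := by
    intro τ hτ
    obtain ⟨k, -, e⟩ := h.omegaPf_eq hs hτ
    rw [e, omegaPf, h0, hs1]
    norm_num
  have c0 := h.continuousOn 0
  have c1 := h.continuousOn 1
  have c2 := h.continuousOn 2
  obtain ⟨k, -, e⟩ := exists_pos_mul_of_linear h.conn (f := fun t => 1 + γ t 0)
    (a := fun t => γ t 2 * γ t 1 + (1 - γ t 2) * (1 - γ t 0) ^ 2)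
    (fun τ hτ => by
      refine ((h.deriv hτ 0).const_add 1).congr_deriv ?_
      have := hΩ τ hτ
      rw [omegaPf] at this
      simp only [jordanField, Matrix.cons_val, this]
      ring) (by fun_prop) hs ht
  have ht0 : γ t 0 = -1 := by
    rw [h0] at e
    linarith
  refine ⟨ht0, ?_⟩
  have := hΩ t ht
  rw [omegaPf, ht0] at this
  nlinarith

lemma X_gt_neg_one {s t : ℝ} (hs : s ∈ I) (ht : t ∈ I) (h0 : γ s 0 ≠ -1) : -1 < γ t 0 := by
  have h1 : γ t 0 ≠ -1 := fun e => h0 (h.X_eq_neg_one ht hs e).1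
  refine lt_of_le_of_ne ?_ h1.symm
  have := (h.mem ht).1
  unfold omegaPf at this
  nlinarith [sq_nonneg (γ t 1)]

lemma isLocalOrbit {J : Set ℝ} (hJ : J ⊆ I) (hX : γ 0 0 ≠ -1) (hT : γ 0 2 < 1)
    (hsmall : ∀ τ ∈ J, 1 / 2 ≤ γ τ 2 ∧ 1 + γ τ 0 ≤ 1 / 100 ∧ |γ τ 1| ≤ 1 / 100 ∧
      (1 - γ τ 2) / γ τ 2 ≤ 1 / 100) :
    IsLocalOrbit (1 - 3 / 2 * g) J (fun τ => γ τ 2) (fun τ => 1 + γ τ 0) (fun τ => γ τ 1)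
      (fun τ => (1 - γ τ 2) / γ τ 2) where
  m_cont := (h.continuousOn 2).mono hJ
  m_ge τ hτ := (hsmall τ hτ).1
  x_pos τ hτ := by linarith [h.X_gt_neg_one h.zero_mem (hJ hτ) hX]
  x_le τ hτ := (hsmall τ hτ).2.1
  abs_s_le τ hτ := (hsmall τ hτ).2.2.1
  t_pos τ hτ := by
    obtain ⟨k, hk, e⟩ := h.one_sub_T_eq (hJ hτ)
    rw [e]
    exact div_pos (mul_pos hk (sub_pos.2 hT)) (by linarith [(hsmall τ hτ).1])
  t_le τ hτ := (hsmall τ hτ).2.2.2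
  w_sign := by
    have e : ∀ τ, (1 + γ τ 0) * (2 - (1 + γ τ 0)) - γ τ 1 ^ 2 = omegaPf (γ τ) := fun τ => by
      rw [omegaPf]; ring
    simp only [e]
    rcases h.init.1.lt_or_eq with hΩ | hΩ
    · refine Or.inl fun τ hτ => ?_
      obtain ⟨k, hk, e⟩ := h.omegaPf_eq h.zero_mem (hJ hτ)
      rw [e]
      exact mul_pos hk hΩ
    · refine Or.inr fun τ hτ => ?_
      obtain ⟨k, hk, e⟩ := h.omegaPf_eq h.zero_mem (hJ hτ)
      rw [e, ← hΩ, mul_zero]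
  dx τ hτ := by
    have hT : γ τ 2 ≠ 0 := by linarith [(hsmall τ hτ).1]
    refine (((h.deriv (hJ hτ) 0).const_add 1).mono hJ).congr_deriv ?_
    simp only [jordanField, Matrix.cons_val]
    field_simp
    ring
  ds τ hτ := by
    have hT : γ τ 2 ≠ 0 := by linarith [(hsmall τ hτ).1]
    refine ((h.deriv (hJ hτ) 1).mono hJ).congr_deriv ?_
    simp only [jordanField, Matrix.cons_val]
    field_simp
    ring
  dt τ hτ := by
    have hT : γ τ 2 ≠ 0 := by linarith [(hsmall τ hτ).1]
    refine ((((h.deriv (hJ hτ) 2).const_sub 1).div (h.deriv (hJ hτ) 2) hT).mono hJ).congr_deriv ?_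
    simp only [jordanField, Matrix.cons_val]
    field_simp
    ring

lemma T_pos_of_tendsto {l : Filter ℝ} [l.NeBot] (hl : Tendsto γ l (𝓝 pointN1))
    (hI : ∀ᶠ τ in l, τ ∈ I) : 0 < γ 0 2 := by
  refine lt_of_le_of_ne h.init.2.1 fun e => ?_
  obtain ⟨τ, hτ, hτI⟩ := ((eventually_small hl).1.and hI).exists
  obtain ⟨k, -, e'⟩ := h.T_eq hτI
  rw [← e, mul_zero] at e'
  linarith [hτ.1]

/-- On `{T = 1}` the equations for `s / x` and `1 / x` (with `x = 1 + X`, `s = S`) can be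
integrated: `1 / x` is a quadratic polynomial in time. -/
lemma tendsto_of_T_eq_one {l : Filter ℝ} (hl : Tendsto (fun t : ℝ => |t|) l atTop)
    (hI : ∀ᶠ τ in l, τ ∈ I) (hT : γ 0 2 = 1) (hne : γ 0 ≠ pointN1) :
    Tendsto γ l (𝓝 pointN1) := by
  have hT1 : ∀ τ ∈ I, γ τ 2 = 1 := by
    intro τ hτ
    obtain ⟨k, -, e⟩ := h.one_sub_T_eq hτ
    rw [hT, sub_self, mul_zero] at e
    linarith
  have hX : γ 0 0 ≠ -1 := by
    intro h0
    refine hne (funext fun i => ?_)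
    have h1 := (h.X_eq_neg_one h.zero_mem h.zero_mem h0).2
    fin_cases i <;> simp [pointN1, h0, h1, hT]
  have hx : ∀ τ ∈ I, 0 < 1 + γ τ 0 := fun τ hτ => by
    linarith [h.X_gt_neg_one h.zero_mem hτ hX]
  have hr : ∀ τ ∈ I, γ τ 1 / (1 + γ τ 0) + τ = γ 0 1 / (1 + γ 0 0) := by
    intro τ hτ
    have hd : ∀ τ ∈ I, HasDerivWithinAt (fun τ => γ τ 1 / (1 + γ τ 0) + τ) 0 I τ := by
      intro τ hτ
      refine (((h.deriv hτ 1).div ((h.deriv hτ 0).const_add 1) (hx τ hτ).ne').add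
        (hasDerivAt_id τ).hasDerivWithinAt).congr_deriv ?_
      simp only [jordanField, Matrix.cons_val, hT1 τ hτ]
      have := (hx τ hτ).ne'
      field_simp
      ring
    have := eq_of_deriv_eq_zero h.conn.convex hd hτ h.zero_mem
    simpa using this
  set r := γ 0 1 / (1 + γ 0 0)
  have hinv : ∀ τ ∈ I, (1 + γ τ 0)⁻¹ = (1 + γ 0 0)⁻¹ + (τ ^ 2 / 2 - r * τ) := by
    intro τ hτ
    have hd : ∀ τ ∈ I,
        HasDerivWithinAt (fun τ => (1 + γ τ 0)⁻¹ - (τ ^ 2 / 2 - r * τ)) 0 I τ := by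
      intro τ hτ
      refine ((((h.deriv hτ 0).const_add 1).inv (hx τ hτ).ne').sub
        ((((hasDerivAt_id τ).pow 2).div_const 2).sub
          ((hasDerivAt_id τ).const_mul r)).hasDerivWithinAt).congr_deriv ?_
      rw [← hr τ hτ]
      simp only [jordanField, Matrix.cons_val, hT1 τ hτ, id]
      have := (hx τ hτ).ne'
      field_simp
      ring
    have := eq_of_deriv_eq_zero h.conn.convex hd hτ h.zero_mem
    simp only [ne_eq, OfNat.ofNat_ne_zero, not_false_eq_true, zero_pow, zero_div, mul_zero,
      sub_zero] at this
    linarith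
  have hxinv : Tendsto (fun τ => (1 + γ τ 0)⁻¹) l atTop := by
    refine tendsto_atTop_mono' l ?_ (tendsto_atTop_add_const_right l (-1 - r ^ 2) hl)
    filter_upwards [hI] with τ hτ
    rw [hinv τ hτ, ← sq_abs τ]
    have h1 := inv_pos.2 (hx 0 h.zero_mem)
    nlinarith [sq_nonneg (|τ| / 2 - 1), sq_nonneg (τ / 2 - r), sq_abs τ]
  have hx0 : Tendsto (fun τ => 1 + γ τ 0) l (𝓝 0) := by
    simpa [Function.comp_def] using tendsto_inv_atTop_zero.comp hxinv
  have hs0 : Tendsto (fun τ => γ τ 1) l (𝓝 0) := by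
    refine squeeze_zero_norm' (a := fun τ => √(2 * (1 + γ τ 0))) ?_ ?_
    · filter_upwards [hI] with τ hτ
      refine Real.abs_le_sqrt ?_
      have := (h.mem hτ).1
      rw [omegaPf] at this
      nlinarith [sq_nonneg (1 + γ τ 0)]
    · simpa using (hx0.const_mul 2).sqrt
  rw [tendsto_pi_nhds]
  intro i
  fin_cases i
  · simpa [pointN1] using hx0.const_add (-1)
  · simpa [pointN1] using hs0
  · refine tendsto_const_nhds.congr' ?_
    filter_upwards [hI] with τ hτ
    simp [pointN1, hT1 τ hτ]

lemma T_deriv_vacuum (h0 : γ 0 0 = -1) {τ : ℝ} (hτ : τ ∈ I) :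
    HasDerivWithinAt (fun s => γ s 2) (4 * (γ τ 2 * (1 - γ τ 2) ^ 2)) I τ := by
  obtain ⟨e0, e1⟩ := h.X_eq_neg_one h.zero_mem hτ h0
  refine (h.deriv hτ 2).congr_deriv ?_
  simp only [jordanField, Matrix.cons_val, e0, e1]
  ring

/-- `T` increases along the vacuum line. -/
lemma T_monotoneOn_vacuum (h0 : γ 0 0 = -1) : MonotoneOn (fun s => γ s 2) I :=
  monotoneOn_of_deriv_nonneg' h.conn.convex (fun _ hτ => h.T_deriv_vacuum h0 hτ) fun τ hτ => by
    have := (h.mem hτ).2.1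
    positivity

end IsJordanOrbit

/-- Along the vacuum line `(1 - T)⁻¹` grows at least linearly, as `T` increases. -/
lemma tendsto_of_vacuum {g : ℝ} {γ : ℝ → Fin 3 → ℝ} (h : IsJordanOrbit g (Ici 0) γ)
    (h0 : γ 0 0 = -1) (hT : 0 < γ 0 2) (hT1 : γ 0 2 < 1) : Tendsto γ atTop (𝓝 pointN1) := by
  have hlt : ∀ τ ∈ Ici (0 : ℝ), 0 < 1 - γ τ 2 := by
    intro τ hτ
    obtain ⟨k, hk, e⟩ := h.one_sub_T_eq hτ
    rw [e]
    exact mul_pos hk (sub_pos.2 hT1)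
  have hmono := monotoneOn_of_deriv_nonneg' (convex_Ici 0)
    (f := fun τ => (1 - γ τ 2)⁻¹ - 4 * γ 0 2 * τ) (f' := fun τ => 4 * γ τ 2 - 4 * γ 0 2)
    (fun τ hτ => by
      refine ((((h.T_deriv_vacuum h0 hτ).const_sub 1).inv (hlt τ hτ).ne').sub
        ((hasDerivAt_id τ).const_mul (4 * γ 0 2)).hasDerivWithinAt).congr_deriv ?_
      have := (hlt τ hτ).ne'
      field_simp)
    (fun τ hτ => by
      have := h.T_monotoneOn_vacuum h0 self_mem_Ici hτ hτ
      simp only at this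
      linarith)
  have hinv : Tendsto (fun τ => (1 - γ τ 2)⁻¹) atTop atTop := by
    refine tendsto_atTop_mono' atTop ?_
      (tendsto_id.const_mul_atTop (by linarith : 0 < 4 * γ 0 2))
    filter_upwards [eventually_ge_atTop 0] with τ hτ
    have h1 := hmono self_mem_Ici hτ hτ
    have h2 := inv_pos.2 (hlt 0 self_mem_Ici)
    simp only [mul_zero, sub_zero] at h1
    simp only [id]
    linarith
  have hT0 : Tendsto (fun τ => 1 - γ τ 2) atTop (𝓝 0) := by
    simpa [Function.comp_def] using tendsto_inv_atTop_zero.comp hinv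
  have hv := fun τ (hτ : (0 : ℝ) ≤ τ) => h.X_eq_neg_one h.zero_mem hτ h0
  rw [tendsto_pi_nhds]
  intro i
  fin_cases i
  · refine tendsto_const_nhds.congr' ?_
    filter_upwards [eventually_ge_atTop 0] with τ hτ
    simp [pointN1, (hv τ hτ).1]
  · refine tendsto_const_nhds.congr' ?_
    filter_upwards [eventually_ge_atTop 0] with τ hτ
    simp [pointN1, (hv τ hτ).2]
  · simpa [pointN1] using hT0.const_sub 1

theorem omegaLimitSet_eq_pointN1_iff {g : ℝ} (hg : 2 / 3 < g) (hg' : g < 2) {γ : ℝ → Fin 3 → ℝ}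
    (hγ : IsSolutionOn (jordanField g) (Ici 0) γ) (h0 : γ 0 ∈ jordanClosed) (hne : γ 0 ≠ pointN1) :
    omegaLimitSet γ = {pointN1} ↔ γ 0 2 = 1 ∨ (γ 0 0 = -1 ∧ γ 0 1 = 0 ∧ 0 < γ 0 2) := by
  have h : IsJordanOrbit g (Ici 0) γ := ⟨ordConnected_Ici, self_mem_Ici, hγ, h0⟩
  have hI : ∀ᶠ τ : ℝ in atTop, τ ∈ Ici (0 : ℝ) := eventually_ge_atTop 0
  rw [omegaLimitSet, clusterPts_eq_singleton_iff isCompact_jordanClosed (hI.mono fun τ => h.mem)]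
  constructor
  · intro hlim
    have hT := h.T_pos_of_tendsto hlim hI
    by_cases hT1 : γ 0 2 = 1
    · exact Or.inl hT1
    refine Or.inr ?_
    by_cases hX : γ 0 0 = -1
    · exact ⟨hX, (h.X_eq_neg_one h.zero_mem h.zero_mem hX).2, hT⟩
    obtain ⟨hs, hs0, ht0⟩ := eventually_small hlim
    obtain ⟨a, ha⟩ := eventually_atTop.1 (hs.and hI)
    exact ((h.isLocalOrbit (fun τ hτ => (ha τ hτ).2) hX (lt_of_le_of_ne h0.2.2 hT1)
      fun τ hτ => (ha τ hτ).1).not_tendsto_atTop rfl (by linarith) (by linarith) hs0 ht0).elim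
  · rintro (hT | ⟨hX, hS, hT⟩)
    · exact h.tendsto_of_T_eq_one tendsto_abs_atTop_atTop hI hT hne
    · refine tendsto_of_vacuum h hX hT (lt_of_le_of_ne h0.2.2 fun hT1 => hne (funext fun i => ?_))
      fin_cases i <;> simp [pointN1, hX, hS, hT1]

theorem alphaLimitSet_eq_pointN1_iff {g : ℝ} (hg : 2 / 3 < g) (hg' : g < 2) {γ : ℝ → Fin 3 → ℝ}
    (hγ : IsSolutionOn (jordanField g) (Iic 0) γ) (h0 : γ 0 ∈ jordanClosed) (hne : γ 0 ≠ pointN1) :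
    alphaLimitSet γ = {pointN1} ↔ γ 0 2 = 1 := by
  have h : IsJordanOrbit g (Iic 0) γ := ⟨ordConnected_Iic, self_mem_Iic, hγ, h0⟩
  have hI : ∀ᶠ τ : ℝ in atBot, τ ∈ Iic (0 : ℝ) := eventually_le_atBot 0
  rw [alphaLimitSet, clusterPts_eq_singleton_iff isCompact_jordanClosed (hI.mono fun τ => h.mem)]
  refine ⟨fun hlim => ?_, fun hT => h.tendsto_of_T_eq_one tendsto_abs_atBot_atTop hI hT hne⟩
  by_contra hT1
  have hT1' := lt_of_le_of_ne h0.2.2 hT1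
  obtain ⟨hs, hs0, ht0⟩ := eventually_small hlim
  by_cases hX : γ 0 0 = -1
  · have h2 : Tendsto (fun τ => γ τ 2) atBot (𝓝 1) := by
      simpa [pointN1] using (tendsto_pi_nhds.1 hlim) 2
    have := le_of_tendsto h2 (by
      filter_upwards [hI] with τ hτ using h.T_monotoneOn_vacuum hX hτ self_mem_Iic hτ)
    linarith
  · obtain ⟨a, ha⟩ := eventually_atBot.1 (hs.and hI)
    exact (h.isLocalOrbit (fun τ hτ => (ha τ hτ).2) hX hT1'
      fun τ hτ => (ha τ hτ).1).not_tendsto_atBot rfl (by linarith) (by linarith) hs0 ht0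

theorem omegaLimitSet_ne_of_mem_jordanInterior {g : ℝ} (hg : 2 / 3 < g) (hg' : g < 2)
    {γ : ℝ → Fin 3 → ℝ} (hγ : IsSolutionOn (jordanField g) (Ici 0) γ)
    (h0 : γ 0 ∈ jordanInterior) : omegaLimitSet γ ≠ {pointN1} := by
  obtain ⟨h1, h2, h3⟩ := h0
  have hne : γ 0 ≠ pointN1 := fun e => by
    rw [e] at h3
    simp [pointN1] at h3
  rw [Ne, omegaLimitSet_eq_pointN1_iff hg hg' hγ ⟨h1.le, h2.le, h3.le⟩ hne]
  rintro (h | ⟨hX, hS, -⟩)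
  · linarith
  · rw [omegaPf, hX, hS] at h1
    norm_num at h1

end JordanBlowUp

theorem mainTheorem5 (g : ℝ) (hg : 2 / 3 < g) (hg' : g < 2) :
    -- the local coordinates, and the system in them
    (BijOn JordanBlowUp.localCoord {p ∈ JordanBlowUp.jordanClosed | 0 < p 2}
        JordanBlowUp.localRegion ∧
      JordanBlowUp.localCoord JordanBlowUp.pointN1 = 0 ∧
      ∀ p ∈ JordanBlowUp.jordanClosed, 0 < p 2 →
        fderiv ℝ JordanBlowUp.localCoord p (JordanBlowUp.jordanField g p)
          = p 2 • JordanBlowUp.localField g (JordanBlowUp.localCoord p)) ∧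
    -- the blow-up, and the desingularised field on it
    (BijOn JordanBlowUp.blowUpMap {q ∈ JordanBlowUp.blowUpRegion | 0 < q 3}
        (JordanBlowUp.localRegion \ {0}) ∧
      (∀ q ∈ JordanBlowUp.blowUpSpace, (JordanBlowUp.blowUpMap q = 0 ↔ q 3 = 0)) ∧
      ∀ q ∈ JordanBlowUp.blowUpSpace,
        q 0 * JordanBlowUp.blowUpField g q 0 + q 1 * JordanBlowUp.blowUpField g q 1
            + q 2 * JordanBlowUp.blowUpField g q 2 = 0 ∧
        (q 3 = 0 → JordanBlowUp.blowUpField g q 3 = 0) ∧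
        JordanBlowUp.localField g (JordanBlowUp.blowUpMap q)
          = q 3 • fderiv ℝ JordanBlowUp.blowUpMap q (JordanBlowUp.blowUpField g q)) ∧
    -- the fixed points
    ({q ∈ JordanBlowUp.blowUpRegion | JordanBlowUp.blowUpField g q = 0}
        = {JordanBlowUp.pointR1, JordanBlowUp.pointDS1, JordanBlowUp.pointWplus,
            JordanBlowUp.pointWminus} ∪ JordanBlowUp.liftedLineDS ∧
      ({JordanBlowUp.pointR1, JordanBlowUp.pointDS1, JordanBlowUp.pointWplus,
          JordanBlowUp.pointWminus} : Set (Fin 4 → ℝ)) ⊆ JordanBlowUp.sphereRegion ∧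
      {q ∈ closure JordanBlowUp.liftedLineDS | q 3 = 0} = {JordanBlowUp.pointDS1}) ∧
    -- their linearisations, in the charts
    ((∀ q ∈ JordanBlowUp.blowUpSpace, 0 < q 2 →
        DifferentiableAt ℝ JordanBlowUp.chartZ q ∧
        fderiv ℝ JordanBlowUp.chartZ q (JordanBlowUp.blowUpField g q)
          = q 2 • JordanBlowUp.fieldZ g (JordanBlowUp.chartZ q)) ∧
      (∀ q ∈ JordanBlowUp.blowUpSpace, 0 < q 0 →
        DifferentiableAt ℝ JordanBlowUp.chartX q ∧
        fderiv ℝ JordanBlowUp.chartX q (JordanBlowUp.blowUpField g q)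
          = √(q 0) • JordanBlowUp.fieldX g (JordanBlowUp.chartX q)) ∧
      JordanBlowUp.chartZ JordanBlowUp.pointR1 = ![0, 0, 0] ∧
      JordanBlowUp.chartZ JordanBlowUp.pointDS1 = ![8, -4, 0] ∧
      JordanBlowUp.chartX JordanBlowUp.pointWplus = ![0, √2, 0] ∧
      JordanBlowUp.chartX JordanBlowUp.pointWminus = ![0, -√2, 0] ∧
      JordanBlowUp.HasLinearisation (JordanBlowUp.fieldZ g) ![0, 0, 0]
        ![-2 * (3 * g - 8), 6, -4]
        ![![2 * (3 * g - 5), 1, 0], ![0, 1, 0], ![0, 0, 1]] ∧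
      JordanBlowUp.HasLinearisation (JordanBlowUp.fieldZ g) ![8, -4, 0]
        ![-6, -6 * g, 0]
        ![![-4, 1, 0], ![2 * (3 * g - 5), 1, 0], ![0, 0, 1]] ∧
      JordanBlowUp.HasLinearisation (JordanBlowUp.fieldX g) ![0, √2, 0]
        ![1 / √2, √2, -(3 / √2)]
        ![![1, 0, 0], ![0, 1, 0], ![0, 0, 1]] ∧
      JordanBlowUp.HasLinearisation (JordanBlowUp.fieldX g) ![0, -√2, 0]
        ![-(1 / √2), -√2, 3 / √2]
        ![![1, 0, 0], ![0, 1, 0], ![0, 0, 1]]) ∧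
    -- the flow on the sphere: the interior and the three vacuum edges
    ((∀ q ∈ JordanBlowUp.sphereRegion, 0 < q 2 → q 1 ^ 2 < 2 * q 0 →
        JordanBlowUp.Connects (JordanBlowUp.blowUpField g)
          JordanBlowUp.pointR1 JordanBlowUp.pointDS1 q) ∧
      (∀ q ∈ JordanBlowUp.sphereRegion, 0 < q 2 → q 1 ^ 2 = 2 * q 0 → 0 < q 1 →
        JordanBlowUp.Connects (JordanBlowUp.blowUpField g)
          JordanBlowUp.pointR1 JordanBlowUp.pointWplus q) ∧
      (∀ q ∈ JordanBlowUp.sphereRegion, 0 < q 2 → q 1 ^ 2 = 2 * q 0 →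
        -4 * q 2 < q 1 → q 1 < 0 →
        JordanBlowUp.Connects (JordanBlowUp.blowUpField g)
          JordanBlowUp.pointR1 JordanBlowUp.pointDS1 q) ∧
      (∀ q ∈ JordanBlowUp.sphereRegion, 0 < q 2 → q 1 ^ 2 = 2 * q 0 → q 1 < -4 * q 2 →
        JordanBlowUp.Connects (JordanBlowUp.blowUpField g)
          JordanBlowUp.pointWminus JordanBlowUp.pointDS1 q)) ∧
    -- the equator of the sphere and the boundary `T = 1`
    (∀ q ∈ JordanBlowUp.blowUpRegion, q 2 = 0 →
      q ≠ JordanBlowUp.pointWplus → q ≠ JordanBlowUp.pointWminus →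
      JordanBlowUp.Connects (JordanBlowUp.blowUpField g)
        JordanBlowUp.pointWplus JordanBlowUp.pointWminus q) ∧
    -- the stable manifold of `R₁`
    (∀ u : ℝ, 0 < u →
      ∃ γ : ℝ → Fin 4 → ℝ,
        JordanBlowUp.IsSolutionOn (JordanBlowUp.blowUpField g) (Ici 0) γ ∧
        γ 0 = ![0, 0, 1, u] ∧
        (∀ t ∈ Ici (0 : ℝ), γ t 0 = 0 ∧ γ t 1 = 0 ∧ γ t 2 = 1 ∧ 0 < γ t 3) ∧
        Tendsto γ atTop (𝓝 JordanBlowUp.pointR1)) ∧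
    -- the line of de Sitter fixed points attracts a neighbourhood of `dS₁`
    (∃ U ∈ 𝓝 JordanBlowUp.pointDS1, ∀ q ∈ U ∩ JordanBlowUp.blowUpRegion,
      ∃ γ : ℝ → Fin 4 → ℝ,
        JordanBlowUp.IsSolutionOn (JordanBlowUp.blowUpField g) (Ici 0) γ ∧ γ 0 = q ∧
        (∀ t ∈ Ici (0 : ℝ), γ t ∈ JordanBlowUp.blowUpRegion) ∧
        ∃ e : Fin 4 → ℝ, Tendsto γ atTop (𝓝 e) ∧
          (q 3 = 0 → e = JordanBlowUp.pointDS1) ∧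
          (0 < q 3 → e ∈ JordanBlowUp.liftedLineDS)) ∧
    -- the orbits of the extended state space that end or originate at `N₁`
    (∀ γ : ℝ → Fin 3 → ℝ,
      JordanBlowUp.IsSolutionOn (JordanBlowUp.jordanField g) (Ici 0) γ →
      γ 0 ∈ JordanBlowUp.jordanClosed → γ 0 ≠ JordanBlowUp.pointN1 →
      (JordanBlowUp.omegaLimitSet γ = {JordanBlowUp.pointN1} ↔
        γ 0 2 = 1 ∨ (γ 0 0 = -1 ∧ γ 0 1 = 0 ∧ 0 < γ 0 2))) ∧
    (∀ γ : ℝ → Fin 3 → ℝ,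
      JordanBlowUp.IsSolutionOn (JordanBlowUp.jordanField g) (Iic 0) γ →
      γ 0 ∈ JordanBlowUp.jordanClosed → γ 0 ≠ JordanBlowUp.pointN1 →
      (JordanBlowUp.alphaLimitSet γ = {JordanBlowUp.pointN1} ↔ γ 0 2 = 1)) ∧
    -- no interior orbit has `N₁` as its `ω`-limit set
    (∀ γ : ℝ → Fin 3 → ℝ,
      JordanBlowUp.IsSolutionOn (JordanBlowUp.jordanField g) (Ici 0) γ →
      γ 0 ∈ JordanBlowUp.jordanInterior →
      JordanBlowUp.omegaLimitSet γ ≠ {JordanBlowUp.pointN1}) := by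
  open JordanBlowUp in
  exact ⟨⟨bijOn_localCoord, localCoord_pointN1, fun p _ hp => fderiv_localCoord g hp.ne'⟩,
    ⟨bijOn_blowUpMap, fun q hq => blowUpMap_eq_zero_iff hq, fun q hq =>
      ⟨blowUpField_tangent g q, fun hu => by simp [blowUpField, hu],
        localField_blowUpMap g q⟩⟩,
    ⟨fixedPoints_eq hg hg', points_subset, closure_liftedLineDS⟩,
    ⟨fun q _ hz => chartZ_field g hz, fun q _ hx => chartX_field g hx,
      chartZ_pointR1, chartZ_pointDS1, chartX_pointWplus, chartX_pointWminus,
      hasLinearisation_pointR1 g, hasLinearisation_pointDS1 g,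
      hasLinearisation_pointWplus g, hasLinearisation_pointWminus g⟩,
    ⟨fun q hq hz hw => connects_interior hg hg' hq hz hw,
      fun q hq hz hw hy => connects_edge_pos g hq hz hw hy,
      fun q hq hz hw hy hy' => connects_edge_mid g hq hz hw hy hy',
      fun q hq hz hw hy => connects_edge_neg g hq hz hw hy⟩,
    fun q hq hz hp hm => connects_faceZ g hq hz hp hm,
    fun u hu => stable_line_pointR1 g hu,
    attracting_pointDS1 hg,
    fun γ hγ h0 hne => omegaLimitSet_eq_pointN1_iff hg hg' hγ h0 hne,
    fun γ hγ h0 hne => alphaLimitSet_eq_pointN1_iff hg hg' hγ h0 hne,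
    fun γ hγ h0 => omegaLimitSet_ne_of_mem_jordanInterior hg hg' hγ h0⟩
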